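/- **Setting.** Let $m\ge 1$, $j_0,\dots,j_{2m-1}\in\mathbb N_0$, and let $\beta_{j,i},\gamma_{j,i}\in\mathbb R$ ($0\le j\le 2m-1$, $1\le i\le m$) be coefficients of boundary conditions $$\sum_{j=0}^{2m-1}\beta_{j,i}\,\partial^j v(-1)=0,\qquad \sum_{j=0}^{2m-1}\gamma_{j,i}\,\partial^j v(1)=0,\qquad i=1,\dots,m. \tag{BC}$$ Let $\ell^1$ be the Banach space of sequences $U=(U_n)_{n\ge0}$ with $\|U\|=|U_0|+2\sum_{n\ge1}|U_n|<\infty$, identified with Chebyshev series $u=U_0+2\sum_{n\ge1}U_nT_n$ on $[-1,1]$; it is a Banach algebra for the product $*$ that corresponds to the pointwise product of functions. Operator norms are those induced by $\|\cdot\|$. Let $\pi^{\le N}$ and $\pi^{>N}$ be the projections onto the modes $n\le N$ and $n>N$; operators on $\pi^{\le N}\ell^1$ are identified with $(N+1)\times(N+1)$ matrices and extended to $\ell^1$ by zero. Assume that $0$ is the only polynomial of degree less than $2m$ satisfying (BC). Then $(-1)^{m+1}\partial^{2m}v=w$ with (BC) has a unique solution for each $w$; let $\mathcal L^{-1}$ be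 the bounded solution operator $w\mapsto v$ on $\ell^1$, and let $\mathcal K_i$ be the bounded operator on $\ell^1$ representing $w\mapsto\partial^i v$, $0\le i\le 2m-1$ (so $\mathcal K_0=\mathcal L^{-1}$). For given $\Psi\in\ell^1$ put $$\mathcal K(U)=\prod_{i=0}^{2m-1}(\mathcal K_iU)^{j_i},\qquad \mathcal F(U)=U+\mathcal K(U)+\Psi$$ (products and powers with respect to $*$), and let $D$ denote the Fréchet derivative. Zeros of $\mathcal F$ correspond, through $v=\mathcal L^{-1}U$, to solutions of $(-1)^{m+1}\partial^{2m}v+\prod_i(\partial^iv)^{j_i}+\psi=0$ with (BC). **Existence hypotheses.** Let $N\ge 4m$, let $\mathcal A_0$ be a real $(N+1)\times(N+1)$ matrix, $\mathcal A=\mathcal A_0+\pi^{>N}$, and let $\bar U\in\ell^1$ be real. Let $Y,Z_1\ge0$ and $Z_2:(0,\infty)\to[0,\infty)$ satisfy $\|\mathcal A\mathcal F(\bar U)\|\le Y$, $\|\mathcal I-\mathcal AD\mathcal F(\bar U)\|\le Z_1$ and $\|\mathcal A(D\mathcal F(\bar U+h)-D\mathcal F(\bar U))\|\le Z_2(s)s$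 for all $s>0$ and all real $h$ with $\|h\|\le s$. Let $r>0$ satisfy $\tfrac12Z_2(r)r^2-(1-Z_1)r+Y<0$ and $Z_1+Z_2(r)r<1$, and let $\tilde U$ be the unique real zero of $\mathcal F$ with $\|\tilde U-\bar U\|\le r$. **Eigenproblem.** On the complexification of $\ell^1$ consider the generalized eigenvalue problem $$D\mathcal F(\tilde U)U=\lambda\mathcal L^{-1}U,\qquad U\ne0. \tag{E}$$ The algebraic multiplicity of an eigenvalue $\lambda$ is the dimension of the space of all root vectors, i.e. of all last elements $U_n$ of chains with $(D\mathcal F(\tilde U)-\lambda\mathcal L^{-1})U_1=0$ and $(D\mathcal F(\tilde U)-\lambda\mathcal L^{-1})U_{k+1}=\mathcal L^{-1}U_k$. Let $\mathcal P_0$ be an invertible complex $(N+1)\times(N+1)$ matrix, $\mathcal M_0=\mathcal P_0^{-1}\mathcal A_0\pi^{\le N}\mathcal L^{-1}\pi^{\le N}\mathcal P_0$, let $\mu_0,\dots,\mu_N$ be the diagonal entries of $\mathcal M_0$, $R_0=\mathcal M_0-\operatorname{diag}(\mu_0,\dots,\mu_N)$, and $\lambda_j=1/\mu_j$. For $\delta\in\mathbb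 R$ let $\mathfrak B_j$ be the closed disk $\{z\in\mathbb C:|z-\lambda_j|\le\delta|\lambda_j|\}$, i.e. $\{z:|1-\mu_jz|\le\delta\}$; if $\mu_j=0$ then $\lambda_j=\infty$ and the second description is used (so $\mathfrak B_j=\emptyset$ if $\delta<1$ and $\mathfrak B_j=\mathbb C$ if $\delta\ge1$). **Constants.** For $i\in\mathbb N$ and $k\ge2i$ put $$\gamma_{2p,k}=\prod_{j=1}^{p}\frac1{k^2-(2j)^2},\qquad \gamma_{2p+1,k}=k\prod_{j=0}^{p}\frac1{k^2-(2j+1)^2}.$$ Let $\mathcal B$ be the $2m\times2m$ matrix representing the left-hand sides of (BC) (first the $m$ conditions at $-1$, then the $m$ conditions at $1$) on polynomials of degree less than $2m$ in the coordinates $U_0,\dots,U_{2m-1}$. For each $i\in\{0,\dots,2m-1\}$ fix a reordering of the $2m$ conditions for which the upper left $i\times i$ block $\mathcal B_{11}$ of the reordered matrix is invertible, and let $\mathcal B_{21}$ be the lower left $(2m-i)\times i$ block. Subtracting $\mathcal B_{21}\mathcal B_{11}^{-1}$ times the first $i$ conditions from the last $2m-i$ ones yields conditions $\sum_j(\theta^{(-1)}_{j,n}\partial^jv(-1)+\theta^{(1)}_{j,n}\partial^jv(1))=0$,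 $0\le n\le 2m-i-1$. Let $\mathcal B_{\mathcal K_i}^\dagger$ be the inverse of the $(2m-i)\times(2m-i)$ matrix that represents $w\mapsto\big(\sum_j(\theta^{(-1)}_{j,n}\partial^jv(-1)+\theta^{(1)}_{j,n}\partial^jv(1))\big)_n$ on polynomials $w$ of degree less than $2m-i$, where $v$ is the $i$-fold antiderivative of $w$ whose Chebyshev coefficients of index less than $i$ vanish. Put $$\eta_{i,k}=\gamma_{2m-i,k}+\|\mathcal B_{\mathcal K_i}^\dagger\|\sum_{n=0}^{2m-i-1}\sum_{j=0}^{2m-1}\big(|\theta^{(-1)}_{j,n}|+|\theta^{(1)}_{j,n}|\big)\gamma_{2m-j,k},\qquad \bar{\mathcal V}_i=j_i\,(\mathcal K_i\bar U)^{j_i-1}*\prod_{l\ne i}(\mathcal K_l\bar U)^{j_l}$$ (with $\bar{\mathcal V}_i=0$ if $j_i=0$). Fix $\lambda_{\max}>0$. Let $Z_{1,\mathcal P_0},Z_{2,\mathcal P_0},Z_{2,\le N},Z_{2,>N}$ (depending on the fixed $r$) satisfy $$\begin{aligned} Z_{1,\mathcal P_0}&\ge\|\mathcal P_0^{-1}(\pi^{\le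 N}-\mathcal A_0\pi^{\le N}D\mathcal F(\bar U)\pi^{\le N})\mathcal P_0\|,\\ Z_{2,\mathcal P_0}r&\ge\|\mathcal P_0^{-1}\mathcal A_0\pi^{\le N}(D\mathcal F(\bar U)-D\mathcal F(\tilde U))\pi^{\le N}\mathcal P_0\|,\\ Z_{2,\le N}r&\ge\|\mathcal A_0\pi^{\le N}(D\mathcal F(\bar U)-D\mathcal F(\tilde U))\pi^{>N}\|,\\ Z_{2,>N}r&\ge\|\pi^{>N}(D\mathcal K(\bar U)-D\mathcal K(\tilde U))\|, \end{aligned}$$ and put $$\epsilon=\sum_{i=0}^{2m-1}\Big(2\eta_{i,N+1}\sum_{k>N-2m+i}|(\bar{\mathcal V}_i)_k|+\|\bar{\mathcal V}_i\|\,\gamma_{2m-i,N+1}\Big)+Z_{2,>N}r+\lambda_{\max}\gamma_{2m,N+1}.$$ Let $\beta_{0,1},\dots,\beta_{2,2}$ satisfy $$\begin{aligned} \beta_{0,1}&\ge\|\pi^{>N}D\mathcal K(\bar U)\pi^{\le N}\mathcal P_0\|+\|\mathcal P_0\|Z_{2,>N}r,\\ \beta_{0,2}&\ge\|\mathcal P_0^{-1}\mathcal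 A_0\pi^{\le N}D\mathcal K(\bar U)\pi^{>N}D\mathcal K(\bar U)\pi^{\le N}\mathcal P_0\|+\|\mathcal P_0^{-1}\mathcal A_0\pi^{\le N}D\mathcal K(\bar U)\pi^{>N}\|\,\|\mathcal P_0\|Z_{2,>N}r,\\ \beta_{1,1}&\ge\eta_{0,N+1}\|\mathcal P_0^{-1}\mathcal A_0\|\big(\|\pi^{>N}D\mathcal K(\bar U)\pi^{\le N}\mathcal P_0\|+\|\mathcal P_0\|Z_{2,>N}r\big),\\ \beta_{1,2}&\ge\|\pi^{>N}\mathcal L^{-1}\pi^{\le N}\mathcal P_0\|,\\ \beta_{1,3}&\ge\|\mathcal P_0^{-1}\mathcal A_0\pi^{\le N}D\mathcal K(\bar U)\pi^{>N}\mathcal L^{-1}\pi^{\le N}\mathcal P_0\|,\\ \beta_{1,4}&\ge\|\mathcal P_0^{-1}\mathcal A_0\pi^{\le N}D\mathcal K(\bar U)\pi^{>N}\|+\|\mathcal P_0^{-1}\|Z_{2,\le N}r,\\ \beta_{2,1}&\ge\|\mathcal P_0^{-1}\mathcal A_0\pi^{\le N}\mathcal L^{-1}\pi^{>N}\mathcal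 L^{-1}\pi^{\le N}\mathcal P_0\|,\\ \beta_{2,2}&\ge\eta_{0,N+1}\|\mathcal P_0^{-1}\mathcal A_0\|. \end{aligned}$$ Assume $\epsilon<1$ and put $$\begin{aligned} \beta_2&=\beta_{2,1}+\tfrac{\epsilon}{1-\epsilon}\beta_{1,2}\beta_{2,2},\\ \beta_1&=\beta_{1,1}+\beta_{1,3}+\|\mathcal P_0^{-1}\|Z_{2,\le N}r\,\beta_{1,2}+\tfrac{\epsilon}{1-\epsilon}(\beta_{1,2}\beta_{1,4}+\beta_{0,1}\beta_{2,2}),\\ \beta_0&=\beta_{0,2}+\|\mathcal P_0^{-1}\|Z_{2,\le N}r\,\beta_{0,1}+\tfrac{\epsilon}{1-\epsilon}\beta_{0,1}\beta_{1,4},\\ \delta&=\lambda_{\max}\|R_0\|+\beta_2\lambda_{\max}^2+\beta_1\lambda_{\max}+\beta_0+Z_{1,\mathcal P_0}+Z_{2,\mathcal P_0}r. \end{aligned}$$ **Theorem.** (i) Every eigenvalue $\lambda\in\mathbb C$ of (E) with $|\lambda|\le\lambda_{\max}$ lies in $\mathfrak B_j$ for some $j\in\{0,\dots,N\}$. (ii)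 Let $I\subset\{0,\dots,N\}$ be such that $\mu_j\neq0$ for all $j\in I$ (so that the $\lambda_j$, $j\in I$, are finite). If $\bigcup_{j\in I}\mathfrak B_j$ is contained in the open disk $\{|z|<\lambda_{\max}\}$ and is disjoint from $\bigcup_{j\notin I}\mathfrak B_j$, then $\bigcup_{j\in I}\mathfrak B_j$ contains exactly $|I|$ eigenvalues of (E), counted with algebraic multiplicity (there are finitely many of them, each of finite multiplicity). -/

import Mathlib

open scoped BigOperators

noncomputable section

namespace ChebSpec

/-! ### The sequence space with norm `|U 0| + 2 * ∑_{n ≥ 1} |U n|` -/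

/-- The weights `1, 2, 2, 2, …`. -/
def xi (n : ℕ) : ℝ := if n = 0 then 1 else 2

theorem xi_pos (n : ℕ) : 0 < xi n := by unfold xi; split_ifs <;> norm_num

theorem one_le_xi (n : ℕ) : 1 ≤ xi n := by unfold xi; split_ifs <;> norm_num

theorem xi_le_two (n : ℕ) : xi n ≤ 2 := by unfold xi; split_ifs <;> norm_num

/-- The absolutely summable scalar sequences, as a subspace of all sequences. -/
def ell1Submodule (𝕜 : Type) [RCLike 𝕜] : Submodule 𝕜 (ℕ → 𝕜) where
  carrier := {U | Summable fun n => ‖U n‖}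
  zero_mem' := by simp
  add_mem' := by
    intro U V hU hV
    exact Summable.of_nonneg_of_le (fun n => norm_nonneg _) (fun n => norm_add_le _ _)
      (Summable.add hU hV)
  smul_mem' := by
    intro c U hU
    have : Summable fun n => ‖c‖ * ‖U n‖ := Summable.mul_left _ hU
    simpa [norm_smul] using this

/-- The space of absolutely summable sequences; the sequence `U` is identified with the
Chebyshev series `U 0 + 2 * ∑_{n ≥ 1} U n * T_n(x)` on `[-1, 1]`. -/
def Ell1 (𝕜 : Type) [RCLike 𝕜] : Type := ell1Submodule 𝕜

section Space

variable {𝕜 : Type} [RCLike 𝕜]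

instance : AddCommGroup (Ell1 𝕜) := inferInstanceAs (AddCommGroup (ell1Submodule 𝕜))

instance : Module 𝕜 (Ell1 𝕜) := inferInstanceAs (Module 𝕜 (ell1Submodule 𝕜))

/-- The underlying sequence of coefficients. -/
def Ell1.seq (U : Ell1 𝕜) : ℕ → 𝕜 := (show ell1Submodule 𝕜 from U).1

/-- A sequence that is absolutely summable, as an element of the space. -/
def Ell1.ofSeq (f : ℕ → 𝕜) (hf : Summable fun n => ‖f n‖) : Ell1 𝕜 :=
  (⟨f, hf⟩ : ell1Submodule 𝕜)

instance : CoeFun (Ell1 𝕜) (fun _ => ℕ → 𝕜) := ⟨Ell1.seq⟩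

instance : Norm (Ell1 𝕜) := ⟨fun U => ∑' n, xi n * ‖U n‖⟩

theorem Ell1.ext {U V : Ell1 𝕜} (h : ∀ n, U n = V n) : U = V := Subtype.ext (funext h)

theorem add_apply (U V : Ell1 𝕜) (n : ℕ) : (U + V) n = U n + V n := rfl

theorem smul_apply (c : 𝕜) (U : Ell1 𝕜) (n : ℕ) : (c • U) n = c * U n := rfl

theorem zero_apply (n : ℕ) : (0 : Ell1 𝕜) n = 0 := rfl

theorem norm_def (U : Ell1 𝕜) : ‖U‖ = ∑' n, xi n * ‖U n‖ := rfl

theorem summable_norm (U : Ell1 𝕜) : Summable fun n => ‖U n‖ := U.2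

theorem summable_weighted (U : Ell1 𝕜) : Summable fun n => xi n * ‖U n‖ :=
  Summable.of_nonneg_of_le (fun n => mul_nonneg (xi_pos n).le (norm_nonneg _))
    (fun n => mul_le_mul_of_nonneg_right (xi_le_two n) (norm_nonneg _))
    ((summable_norm U).mul_left 2)

theorem weighted_le_norm (U : Ell1 𝕜) (n : ℕ) : xi n * ‖U n‖ ≤ ‖U‖ :=
  (summable_weighted U).le_tsum n
    (fun k _ => mul_nonneg (xi_pos k).le (norm_nonneg _))

theorem norm_coord_le (U : Ell1 𝕜) (n : ℕ) : ‖U n‖ ≤ ‖U‖ :=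
  le_trans (by nlinarith [one_le_xi n, norm_nonneg (U n)]) (weighted_le_norm U n)

theorem ell1_core : NormedSpace.Core 𝕜 (Ell1 𝕜) where
  norm_nonneg U := tsum_nonneg fun n => mul_nonneg (xi_pos n).le (norm_nonneg _)
  norm_smul c U := by
    rw [norm_def, norm_def, ← tsum_mul_left]
    refine tsum_congr fun n => ?_
    rw [smul_apply, norm_mul]; ring
  norm_triangle U V := by
    rw [norm_def, norm_def, norm_def,
      ← (summable_weighted U).tsum_add (summable_weighted V)]
    refine (summable_weighted (U + V)).tsum_le_tsum (fun n => ?_)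
      ((summable_weighted U).add (summable_weighted V))
    rw [add_apply, ← mul_add]
    exact mul_le_mul_of_nonneg_left (norm_add_le _ _) (xi_pos n).le
  norm_eq_zero_iff U := by
    constructor
    · intro h
      refine Ell1.ext fun n => ?_
      have h1 := norm_coord_le U n
      rw [h] at h1
      rw [zero_apply]
      exact norm_le_zero_iff.mp h1
    · rintro rfl
      simp [norm_def, zero_apply]

instance : NormedAddCommGroup (Ell1 𝕜) := NormedAddCommGroup.ofCore ell1_core

instance : NormedSpace 𝕜 (Ell1 𝕜) := NormedSpace.ofCore ell1_core

end Space

/-- The complexification of a real sequence. -/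
def toC (U : Ell1 ℝ) : Ell1 ℂ :=
  Ell1.ofSeq (fun n => ((U n : ℝ) : ℂ)) (by simpa using summable_norm U)

/-! ### Elementary operators -/

section Operators

variable (𝕜 : Type) [RCLike 𝕜]

/-- The sequence with `1` in position `n` and `0` elsewhere. -/
def unitSeq (n : ℕ) : Ell1 𝕜 :=
  Ell1.ofSeq (Pi.single n 1) (by
    refine summable_of_ne_finset_zero (s := {n}) fun k hk => ?_
    have : k ≠ n := by simpa using hk
    simp [this])

/-- The coordinate functional `U ↦ U n`. -/
def coord (n : ℕ) : Ell1 𝕜 →L[𝕜] 𝕜 :=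
  LinearMap.mkContinuous
    { toFun := fun U => U n
      map_add' := fun _ _ => rfl
      map_smul' := fun _ _ => rfl } 1
    (fun U => by rw [one_mul]; exact norm_coord_le U n)

variable {𝕜} in
/-- The finite-rank operator whose upper left corner is the matrix `M`, all other entries
being zero. -/
def finOp {n : ℕ} (M : Matrix (Fin n) (Fin n) 𝕜) : Ell1 𝕜 →L[𝕜] Ell1 𝕜 :=
  ∑ k : Fin n, ∑ c : Fin n, M k c • (coord 𝕜 c).smulRight (unitSeq 𝕜 k)

/-- The projection onto the modes `0, …, N`. -/
def projLE (N : ℕ) : Ell1 𝕜 →L[𝕜] Ell1 𝕜 :=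
  ∑ n ∈ Finset.range (N + 1), (coord 𝕜 n).smulRight (unitSeq 𝕜 n)

/-- The projection onto the modes `n > N`. -/
def projGT (N : ℕ) : Ell1 𝕜 →L[𝕜] Ell1 𝕜 := ContinuousLinearMap.id 𝕜 _ - projLE 𝕜 N

variable {𝕜} in
/-- The matrix of the section `π^{≤N} T π^{≤N}` of an operator. -/
def sectionMatrix (N : ℕ) (T : Ell1 𝕜 →L[𝕜] Ell1 𝕜) :
    Matrix (Fin (N + 1)) (Fin (N + 1)) 𝕜 :=
  Matrix.of fun n c => T (unitSeq 𝕜 c) n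

variable {𝕜} in
/-- Chebyshev coefficients of the antiderivative (of the function with coefficients `U`) whose
coefficient of index `0` vanishes. -/
def antiderivSeq (U : ℕ → 𝕜) : ℕ → 𝕜 :=
  fun n => if n = 0 then 0 else (U (n - 1) - U (n + 1)) / (2 * (n : 𝕜))

variable {𝕜} in
theorem antiderivSeq_norm_le (U : ℕ → 𝕜) (n : ℕ) :
    ‖antiderivSeq U n‖ ≤ ‖U (n - 1)‖ + ‖U (n + 1)‖ := by
  unfold antiderivSeq
  split_ifs with h
  · simp; positivity
  · rw [norm_div, norm_mul, RCLike.norm_natCast, RCLike.norm_ofNat]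
    have hn : (1 : ℝ) ≤ n := by exact_mod_cast Nat.one_le_iff_ne_zero.mpr h
    refine le_trans (div_le_self (norm_nonneg _) (by linarith)) (norm_sub_le _ _)

variable {𝕜} in
theorem summable_pred {f : ℕ → ℝ} (hf : Summable f) : Summable fun n => f (n - 1) := by
  rw [← summable_nat_add_iff 1]
  simpa using hf

variable {𝕜} in
theorem summable_antideriv (U : Ell1 𝕜) : Summable fun n => ‖antiderivSeq (⇑U) n‖ :=
  Summable.of_nonneg_of_le (fun _ => norm_nonneg _) (antiderivSeq_norm_le _)
    ((summable_pred (summable_norm U)).add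
      ((summable_nat_add_iff 1).mpr (summable_norm U)))

/-- The antiderivative as a bounded operator. -/
def antideriv : Ell1 𝕜 →L[𝕜] Ell1 𝕜 :=
  LinearMap.mkContinuous
    { toFun := fun U => Ell1.ofSeq (antiderivSeq (⇑U)) (summable_antideriv U)
      map_add' := fun U V => by
        refine Ell1.ext fun n => ?_
        rw [add_apply]
        change antiderivSeq (⇑(U + V)) n = antiderivSeq (⇑U) n + antiderivSeq (⇑V) n
        unfold antiderivSeq
        split_ifs
        · simp
        · simp only [add_apply]; ring
      map_smul' := fun a U => by
        refine Ell1.ext fun n => ?_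
        rw [RingHom.id_apply, smul_apply]
        change antiderivSeq (⇑(a • U)) n = a * antiderivSeq (⇑U) n
        unfold antiderivSeq
        split_ifs
        · simp
        · simp only [smul_apply]; ring } 6
    (fun U => by
      have hs := summable_norm U
      have h1 : Summable fun n => ‖U (n + 1)‖ := (summable_nat_add_iff 1).mpr hs
      have h0 : Summable fun n => ‖U (n - 1)‖ := summable_pred hs
      have hle : ∑' n, ‖U n‖ ≤ ‖U‖ :=
        hs.tsum_le_tsum (fun n => by nlinarith [one_le_xi n, norm_nonneg (U n)])
          (summable_weighted U)
      have e1 : ∑' n, ‖U (n + 1)‖ ≤ ∑' n, ‖U n‖ := by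
        rw [hs.tsum_eq_zero_add]
        linarith [norm_nonneg (U 0)]
      have e0 : ∑' n, ‖U (n - 1)‖ = ‖U 0‖ + ∑' n, ‖U n‖ := by
        rw [h0.tsum_eq_zero_add]; simp
      have e2 := norm_coord_le U 0
      calc ∑' n, xi n * ‖antiderivSeq (⇑U) n‖
          ≤ ∑' n, 2 * (‖U (n - 1)‖ + ‖U (n + 1)‖) := by
            refine Summable.tsum_le_tsum (fun n => ?_)
              (summable_weighted (Ell1.ofSeq (antiderivSeq (⇑U)) (summable_antideriv U)))
              ((h0.add h1).mul_left 2)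
            exact mul_le_mul (xi_le_two n) (antiderivSeq_norm_le _ _) (norm_nonneg _)
              (by norm_num)
        _ = 2 * (∑' n, ‖U (n - 1)‖ + ∑' n, ‖U (n + 1)‖) := by
            rw [tsum_mul_left, h0.tsum_add h1]
        _ ≤ 6 * ‖U‖ := by linarith)

/-- Evaluation of the Chebyshev series at the endpoint `s = ±1` (recall `T_n(±1) = (±1)^n`). -/
def evalEnd (s : ℤˣ) : Ell1 𝕜 →L[𝕜] 𝕜 :=
  have hn : ∀ (U : Ell1 𝕜) (n : ℕ),
      ‖((xi n * ((s : ℤ) : ℝ) ^ n : ℝ) : 𝕜) * U n‖ = xi n * ‖U n‖ := fun U n => by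
    have h1 : |((s : ℤ) : ℝ)| = 1 := by
      rcases Int.units_eq_one_or s with h | h <;> simp [h]
    rw [norm_mul, RCLike.norm_ofReal, abs_mul, abs_pow, h1, one_pow, mul_one,
      abs_of_pos (xi_pos n)]
  have hs : ∀ U : Ell1 𝕜, Summable fun n => ((xi n * ((s : ℤ) : ℝ) ^ n : ℝ) : 𝕜) * U n :=
    fun U => Summable.of_norm (by simpa only [hn] using summable_weighted U)
  LinearMap.mkContinuous
    { toFun := fun U => ∑' n, ((xi n * ((s : ℤ) : ℝ) ^ n : ℝ) : 𝕜) * U n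
      map_add' := fun U V => by
        rw [← (hs U).tsum_add (hs V)]
        exact tsum_congr fun n => by rw [add_apply, mul_add]
      map_smul' := fun a U => by
        rw [RingHom.id_apply, smul_eq_mul, ← tsum_mul_left]
        exact tsum_congr fun n => by rw [smul_apply]; ring } 1
    (fun U => by
      rw [one_mul]
      refine (norm_tsum_le_tsum_norm (by simpa only [hn] using summable_weighted U)).trans ?_
      simp only [hn]
      exact le_of_eq rfl)

end Operators

/-! ### The convolution product -/

section Convolution

variable {𝕜 : Type} [RCLike 𝕜]

/-- The coefficients `∑_{k ∈ ℤ} U_{|k|} V_{|n-k|}` of the product of two Chebyshev series. -/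
def convSeq (U V : ℕ → 𝕜) (n : ℕ) : 𝕜 := ∑' k : ℤ, U k.natAbs * V ((n : ℤ) - k).natAbs

theorem summable_natAbs {f : ℕ → ℝ} (hf : Summable f) : Summable fun k : ℤ => f k.natAbs :=
  Summable.of_nat_of_neg (by simpa using hf) (by simpa using hf)

theorem summable_conv (U V : Ell1 𝕜) : Summable fun n => ‖convSeq (⇑U) (⇑V) n‖ := by
  have hU := summable_natAbs (summable_norm U)
  have hV := summable_natAbs (summable_norm V)
  have hp : Summable fun p : ℤ × ℤ => ‖U p.1.natAbs‖ * ‖V p.2.natAbs‖ :=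
    hU.mul_of_nonneg hV (fun _ => norm_nonneg _) (fun _ => norm_nonneg _)
  let e : ℤ × ℤ ≃ ℤ × ℤ :=
    { toFun := fun p => (p.2, p.1 - p.2)
      invFun := fun p => (p.1 + p.2, p.1)
      left_inv := fun p => by ext <;> simp
      right_inv := fun p => by ext <;> simp }
  have hq : Summable fun p : ℤ × ℤ => ‖U p.2.natAbs‖ * ‖V (p.1 - p.2).natAbs‖ :=
    (e.summable_iff (f := fun p : ℤ × ℤ => ‖U p.1.natAbs‖ * ‖V p.2.natAbs‖)).mpr hp
  have hr : Summable fun n : ℤ => ∑' k : ℤ, ‖U k.natAbs‖ * ‖V (n - k).natAbs‖ := hq.prod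
  have hr' : Summable fun n : ℕ => ∑' k : ℤ, ‖U k.natAbs‖ * ‖V ((n : ℤ) - k).natAbs‖ :=
    hr.comp_injective (i := fun n : ℕ => (n : ℤ)) Nat.cast_injective
  refine Summable.of_nonneg_of_le (fun _ => norm_nonneg _) (fun n => ?_) hr'
  have hf : Summable fun k : ℤ => ‖U k.natAbs * V ((n : ℤ) - k).natAbs‖ := by
    simpa only [norm_mul] using hq.prod_factor (n : ℤ)
  simpa only [norm_mul, convSeq] using norm_tsum_le_tsum_norm hf

/-- The discrete convolution product. -/
def conv (U V : Ell1 𝕜) : Ell1 𝕜 := Ell1.ofSeq (convSeq (⇑U) (⇑V)) (summable_conv U V)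

/-- Convolution powers; the unit is the sequence of the constant function `1`. -/
def convPow (U : Ell1 𝕜) : ℕ → Ell1 𝕜
  | 0 => unitSeq 𝕜 0
  | n + 1 => conv U (convPow U n)

/-- Convolution products of lists. -/
def convProd (l : List (Ell1 𝕜)) : Ell1 𝕜 := l.foldr conv (unitSeq 𝕜 0)

end Convolution

/-! ### The boundary value problem -/

/-- The data of the stationary problem
`(-1)^(m+1) ∂^(2m) v + v^(j_0) (∂v)^(j_1) ⋯ (∂^(2m-1) v)^(j_{2m-1}) + ψ = 0` on `(-1, 1)`, with
the boundary conditions `∑_j left j i * ∂^j v(-1) = 0` and `∑_j right j i * ∂^j v(1) = 0`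
for `i = 0, …, m - 1`, and `expo i = j_i`. -/
structure BVP where
  m : ℕ
  left : Fin (2 * m) → Fin m → ℝ
  right : Fin (2 * m) → Fin m → ℝ
  expo : Fin (2 * m) → ℕ

/-- `T_n^{(j)}(s)`, the `j`-th derivative of a Chebyshev polynomial at the endpoint `s = ±1`. -/
def chebDer (s : ℤˣ) (j n : ℕ) : ℝ :=
  ((Polynomial.derivative^[j]) (Polynomial.Chebyshev.T ℝ (n : ℤ))).eval ((s : ℤ) : ℝ)

/-- `∂^j u(s)` for the polynomial `u` of degree less than `d` with coefficients `U`. -/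
def bdryPoly (d : ℕ) (s : ℤˣ) (j : ℕ) (U : ℕ → ℝ) : ℝ :=
  ∑ n ∈ Finset.range d, xi n * U n * chebDer s j n

/-- The matrix of `∂` on polynomials of degree less than `d`, in Chebyshev coefficients:
`(∂U)_n = ∑_{c > n, c - n odd} 2 c U_c`. -/
def diffMatrix (d : ℕ) : Matrix (Fin d) (Fin d) ℝ :=
  Matrix.of fun n c => if n < c ∧ Odd ((n : ℕ) + c) then 2 * ((c : ℕ) : ℝ) else 0

/-- For `k ≥ 2i`, the `ℓ¹` norm of the `i`-fold antiderivative of `T_k` (first `i` coefficients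
removed), divided by the norm of `T_k`. -/
def gam (i k : ℕ) : ℝ :=
  if Even i then ∏ j ∈ Finset.Icc 1 (i / 2), 1 / ((k : ℝ) ^ 2 - (2 * (j : ℝ)) ^ 2)
  else (k : ℝ) * ∏ j ∈ Finset.range (i / 2 + 1), 1 / ((k : ℝ) ^ 2 - (2 * (j : ℝ) + 1) ^ 2)

namespace BVP

variable (P : BVP)

/-- Coefficient of `∂^j v(-1)` in the `r`-th boundary condition; the conditions `0, …, m-1` are
those at `-1`, the conditions `m, …, 2m-1` are those at `1`. -/
def leftRow (r j : Fin (2 * P.m)) : ℝ := if h : (r : ℕ) < P.m then P.left j ⟨r, h⟩ else 0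

/-- Coefficient of `∂^j v(1)` in the `r`-th boundary condition. -/
def rightRow (r j : Fin (2 * P.m)) : ℝ :=
  if _h : P.m ≤ (r : ℕ) then P.right j ⟨(r : ℕ) - P.m, by have := r.2; omega⟩ else 0

/-- The boundary operator restricted to polynomials of degree less than `2m`. -/
def bcMatrix : Matrix (Fin (2 * P.m)) (Fin (2 * P.m)) ℝ :=
  Matrix.of fun r c => ∑ j : Fin (2 * P.m),
    (P.leftRow r j * (xi c * chebDer (-1) j c) + P.rightRow r j * (xi c * chebDer 1 j c))

/-- The `r`-th boundary condition applied to the `2m`-fold antiderivative `S^{2m} w`, whose `j`-th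
derivative is `S^{2m-j} w`. -/
def bcIter (𝕜 : Type) [RCLike 𝕜] (r : Fin (2 * P.m)) : Ell1 𝕜 →L[𝕜] 𝕜 :=
  ∑ j : Fin (2 * P.m),
    (((P.leftRow r j : ℝ) : 𝕜) • (evalEnd 𝕜 (-1) ∘L (antideriv 𝕜) ^ (2 * P.m - j)) +
      ((P.rightRow r j : ℝ) : 𝕜) • (evalEnd 𝕜 1 ∘L (antideriv 𝕜) ^ (2 * P.m - j)))

/-- The operator `w ↦ ∂^i v`, where `v` is the solution of `(-1)^(m+1) ∂^(2m) v = w` subject to the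
boundary conditions. Writing `v = (-1)^(m+1) (S^{2m} w - p)` with `p` a polynomial of degree less
than `2m`, the boundary conditions say that `p` and `S^{2m} w` have the same boundary data, so that
`p` has coefficients `bcMatrix⁻¹ * (boundary data of S^{2m} w)`. For `i = 0` this is `L⁻¹`. -/
def Kop (𝕜 : Type) [RCLike 𝕜] (i : ℕ) : Ell1 𝕜 →L[𝕜] Ell1 𝕜 :=
  ((-1 : 𝕜) ^ (P.m + 1)) • ((antideriv 𝕜) ^ (2 * P.m - i) -
    ∑ n : Fin (2 * P.m), ∑ r : Fin (2 * P.m),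
      ((((diffMatrix (2 * P.m)) ^ i * P.bcMatrix⁻¹) n r : ℝ) : 𝕜) •
        (P.bcIter 𝕜 r).smulRight (unitSeq 𝕜 n))

/-- The solution operator of the linear boundary value problem. -/
def Linv (𝕜 : Type) [RCLike 𝕜] : Ell1 𝕜 →L[𝕜] Ell1 𝕜 := P.Kop 𝕜 0

/-- The nonlinear term `U ↦ ∏_i (∂^i L⁻¹ U)^{j_i}`. -/
def K (𝕜 : Type) [RCLike 𝕜] (U : Ell1 𝕜) : Ell1 𝕜 :=
  convProd ((List.finRange (2 * P.m)).map fun i : Fin (2 * P.m) =>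
    convPow (P.Kop 𝕜 (i : ℕ) U) (P.expo i))

/-- The zero-finding map `F(U) = U + K(U) + Ψ`. -/
def F (𝕜 : Type) [RCLike 𝕜] (Ψ U : Ell1 𝕜) : Ell1 𝕜 := U + P.K 𝕜 U + Ψ

/-- The coefficient sequence `V_i` in `DK(U) W = ∑_i V_i * K_i W`. -/
def V (U : Ell1 ℝ) (i : Fin (2 * P.m)) : Ell1 ℝ :=
  (P.expo i : ℝ) • conv (convPow (P.Kop ℝ (i : ℕ) U) (P.expo i - 1))
    (convProd (((List.finRange (2 * P.m)).filter (fun l => l ≠ i)).map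
      fun l : Fin (2 * P.m) => convPow (P.Kop ℝ (l : ℕ) U) (P.expo l)))

/-! #### The constants `η`

For each `i` the boundary conditions are reordered by a permutation `σ` (new row `r` is old row
`σ r`) for which the upper left `i × i` block of the boundary matrix is invertible; the first `i`
conditions are then used to eliminate the polynomial of degree less than `i` in
`v = S^{(i)} (∂^i v) + (polynomial of degree less than i)`, where `S^{(i)}` is the `i`-fold
antiderivative with the first `i` coefficients removed. -/

/-- Index of the `l`-th of the first `i` rows or columns. -/
def lowIdx (i : Fin (2 * P.m)) (l : Fin i) : Fin (2 * P.m) := ⟨l, l.2.trans i.2⟩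

/-- Index of the `n`-th of the last `2m - i` rows. -/
def highIdx (i : Fin (2 * P.m)) (n : Fin (2 * P.m - i)) : Fin (2 * P.m) :=
  ⟨n + i, by have := n.2; omega⟩

/-- The upper left `i × i` block of the reordered boundary matrix. -/
def block11 (σ : Equiv.Perm (Fin (2 * P.m))) (i : Fin (2 * P.m)) : Matrix (Fin i) (Fin i) ℝ :=
  Matrix.of fun l c => P.bcMatrix (σ (P.lowIdx i l)) (P.lowIdx i c)

/-- The lower left block of the reordered boundary matrix. -/
def block21 (σ : Equiv.Perm (Fin (2 * P.m))) (i : Fin (2 * P.m)) :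
    Matrix (Fin (2 * P.m - i)) (Fin i) ℝ :=
  Matrix.of fun n c => P.bcMatrix (σ (P.highIdx i n)) (P.lowIdx i c)

/-- Coefficient of `∂^j v(-1)` in the `n`-th condition that remains after the elimination. -/
def thetaLeft (σ : Equiv.Perm (Fin (2 * P.m))) (i : Fin (2 * P.m)) (n : Fin (2 * P.m - i))
    (j : Fin (2 * P.m)) : ℝ :=
  P.leftRow (σ (P.highIdx i n)) j -
    ∑ l : Fin i, (P.block21 σ i * (P.block11 σ i)⁻¹) n l * P.leftRow (σ (P.lowIdx i l)) j

/-- Coefficient of `∂^j v(1)` in the `n`-th condition that remains after the elimination. -/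
def thetaRight (σ : Equiv.Perm (Fin (2 * P.m))) (i : Fin (2 * P.m)) (n : Fin (2 * P.m - i))
    (j : Fin (2 * P.m)) : ℝ :=
  P.rightRow (σ (P.highIdx i n)) j -
    ∑ l : Fin i, (P.block21 σ i * (P.block11 σ i)⁻¹) n l * P.rightRow (σ (P.lowIdx i l)) j

/-- The coefficients of `S^{(i)}` applied to the `c`-th unit sequence. -/
def shiftedUnit (i c : ℕ) : ℕ → ℝ :=
  fun n => if n < i then 0 else (antiderivSeq^[i] (Pi.single c (1 : ℝ))) n

/-- The remaining `2m - i` conditions on `w = ∂^i v`, restricted to polynomials `w` of degree less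
than `2m - i`. -/
def reducedMatrix (σ : Equiv.Perm (Fin (2 * P.m))) (i : Fin (2 * P.m)) :
    Matrix (Fin (2 * P.m - i)) (Fin (2 * P.m - i)) ℝ :=
  Matrix.of fun n c => ∑ j : Fin (2 * P.m),
    (P.thetaLeft σ i n j * bdryPoly (2 * P.m) (-1) j (shiftedUnit i c) +
      P.thetaRight σ i n j * bdryPoly (2 * P.m) 1 j (shiftedUnit i c))

/-- The constant `η_{i,k}`. -/
def eta (σ : Equiv.Perm (Fin (2 * P.m))) (i : Fin (2 * P.m)) (k : ℕ) : ℝ :=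
  gam (2 * P.m - i) k + ‖finOp (P.reducedMatrix σ i)⁻¹‖ *
    ∑ n : Fin (2 * P.m - i), ∑ j : Fin (2 * P.m),
      (|P.thetaLeft σ i n j| + |P.thetaRight σ i n j|) * gam (2 * P.m - j) k

/-- The constant `ε`; the argument `ζ` is a bound on
`‖π^{>N} (DK(Ubar) - DK(Utilde))‖`. -/
def eps (σ : Fin (2 * P.m) → Equiv.Perm (Fin (2 * P.m))) (N : ℕ) (Ubar : Ell1 ℝ)
    (lmax ζ : ℝ) : ℝ :=
  ∑ i : Fin (2 * P.m),
    (2 * P.eta (σ i) i (N + 1) *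
        (∑' k : ℕ, if N - 2 * P.m + i < k then |P.V Ubar i k| else 0) +
      ‖P.V Ubar i‖ * gam (2 * P.m - i) (N + 1)) +
  ζ + lmax * gam (2 * P.m) (N + 1)

end BVP

/-! ### Generalized eigenvalues and disks -/

section Pencil

variable {E : Type} [NormedAddCommGroup E] [NormedSpace ℂ E]

/-- `z` is an eigenvalue of the generalized eigenvalue problem `T U = z K U`. -/
def IsGenEigenvalue (T K : E →L[ℂ] E) (z : ℂ) : Prop := ∃ U : E, U ≠ 0 ∧ T U = z • K U

/-- The vectors `U_n` that end a Jordan chain of length `n` of the pencil `T - z K`, that is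
`(T - z K) U_1 = 0` and `(T - z K) U_{k+1} = K U_k` for `1 ≤ k < n` (with `U_1 = 0` allowed). -/
def rootSpace (T K : E →L[ℂ] E) (z : ℂ) : ℕ → Submodule ℂ E
  | 0 => ⊥
  | n + 1 => ((rootSpace T K z n).map (K : E →ₗ[ℂ] E)).comap ((T - z • K : E →L[ℂ] E) : E →ₗ[ℂ] E)

/-- The space of all root vectors; its dimension is the algebraic multiplicity of `z`. -/
def maxRootSpace (T K : E →L[ℂ] E) (z : ℂ) : Submodule ℂ E := ⨆ n, rootSpace T K z n

/-- The algebraic multiplicity of a generalized eigenvalue. -/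
def algMult (T K : E →L[ℂ] E) (z : ℂ) : ℕ := Module.finrank ℂ (maxRootSpace T K z)

end Pencil

/-- The closed disk of centre `1/μ` and radius `δ |1/μ|`, i.e. the set of all `z` with
`|1 - μ z| ≤ δ`; the latter is also its meaning for `μ = 0`, where the centre is `∞`. -/
def disk (δ : ℝ) (μ : ℂ) : Set ℂ :=
  if μ = 0 then {_z : ℂ | 1 ≤ δ} else Metric.closedBall (1 / μ) (δ * ‖1 / μ‖)

end ChebSpec

end

noncomputable section

namespace ChebSpec

open Filter Topology Set Metric

/-! ### Counting zeros of analytic functions -/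

/-! Write p, q for the projections onto the modes up to N and above N, and T for the derivative of F
at the exact zero. The pencil is T - zL = 1 + D(z), with D(z) = DK - zL and DK taken at that zero.
Each operator `Kop i` integrates at least once and so damps high modes: for |z| ≤ λmax the block
qD(z)q has norm at most ε < 1, and 1 + qDq has an inverse W(z). Hence C(z) = 1 + D(z)q, which agrees
with the pencil on the range of q, is invertible, and C(z)⁻¹(T - zL) is the identity on that range.
All spectral information sits in its compression to the first N + 1 modes, the Schur complement S(z)
= p + pDp - pDqWqDp. The eigenvalues in the disk are the zeros of g = det S.

The order of such a zero is the algebraic multiplicity (`finrank_maxRootSpace_eq_order`). Choose z₀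
near z with T - z₀L bijective and put M = (T - z₀L)⁻¹L, so that T - wL = (T - z₀L)(1 - (w - z₀)M).
The root vectors at z form the generalized kernel of A = 1 - (z - z₀)M. For a finite-dimensional
A-invariant subspace V of ker Aⁿ, split 1 - (w - z₀)M|V off the pencil. Determinants of
perturbations of the identity that live on a finite-dimensional quotient are multiplicative and do
not depend on the compression used, so g(w) = u(w)(w - z)^dim V near z, with u continuous. This
bounds dim V by the order of g; for the largest V the remaining factor is injective at z, so u(z) ≠
0 and equality holds.

For localization, P₀⁻¹A₀S(z)P₀ = diag(1 - zμⱼ) + G(z) with ‖G(z)‖ ≤ δ (`norm_schur_correction_le`,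
`norm_schur_sub_le`); A₀ is invertible since Z₁ < 1, so the determinant of this matrix is a nonzero
multiple of g. If diag(1 - zμⱼ) + tG(z) is singular for some t in [0, 1], a kernel vector gives |1 -
zμⱼ| ≤ δ for some j. At t = 1 this is (i). For (ii), let t run from 1 to 0: zeros in the open disk
and off the disks with j ∉ I stay in the compact union over I, so by `zero_count_eq` their number is
constant, and at t = 0 the product of the 1 - zμⱼ has |I| zeros there.

The quantitative input (`norm_projGT_sub_smul_le`, `norm_Linv_projGT_le`) rests on a recurrence for
`gam` that matches integration of Chebyshev polynomials, and on the elimination that expresses the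
polynomial part of ∂ⁱv through the reduced boundary conditions. -/

theorem finite_zeros_of_isCompact {K : Set ℂ} (hK : IsCompact K) {f : ℂ → ℂ}
    (hf : AnalyticOnNhd ℂ f K) (hord : ∀ z ∈ K, analyticOrderAt f z ≠ ⊤) :
    {z ∈ K | f z = 0}.Finite := by
  by_contra hinf
  obtain ⟨x, hxK, hx⟩ := Set.Infinite.exists_accPt_of_subset_isCompact hinf hK (sep_subset _ _)
  refine hord x hxK (analyticOrderAt_eq_top.mpr ?_)
  refine (hf x hxK).frequently_zero_iff_eventually_zero.mp ?_
  rw [accPt_iff_frequently_nhdsNE] at hx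
  exact hx.mono fun z hz => hz.2

theorem support_analyticOrderNatAt_subset (f : ℂ → ℂ) (s : Set ℂ) :
    s ∩ Function.support (analyticOrderNatAt f) ⊆ {z ∈ s | f z = 0} :=
  fun _ hz => ⟨hz.1, apply_eq_zero_of_analyticOrderNatAt_ne_zero hz.2⟩

/-- A zero of infinite order would spread over the connected closed disk to its boundary, where f
does not vanish. -/
theorem analyticOrderAt_ne_top_of_sphere {U : Set ℂ} {c : ℂ} {R : ℝ} (hR : 0 < R)
    (hcU : closedBall c R ⊆ U) {f : ℂ → ℂ} (hf : AnalyticOnNhd ℂ f U)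
    (hs : ∀ z ∈ sphere c R, f z ≠ 0) : ∀ z ∈ closedBall c R, analyticOrderAt f z ≠ ⊤ := by
  intro z hz
  have hx : c + R ∈ sphere c R := by simp [abs_of_pos hR]
  refine (hf.mono hcU).analyticOrderAt_ne_top_of_isPreconnected
    (convex_closedBall c R).isPreconnected (sphere_subset_closedBall hx) hz ?_
  rw [((hf _ (hcU (sphere_subset_closedBall hx))).analyticOrderAt_eq_zero).mpr (hs _ hx)]
  simp

/-- Argument principle for a disk, by induction on the number of zeros: `dslope` divides out one
factor z - a, whose logarithmic derivative integrates to 2πi. With no zeros left, Cauchy's theorem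
applies. -/
theorem circleIntegral_logDeriv_eq {U : Set ℂ} (hU : IsOpen U) {c : ℂ} {R : ℝ} (hR : 0 < R)
    (hcU : closedBall c R ⊆ U) (n : ℕ) : ∀ f : ℂ → ℂ, DifferentiableOn ℂ f U →
    (∀ z ∈ sphere c R, f z ≠ 0) → ∑ᶠ z ∈ ball c R, analyticOrderNatAt f z = n →
    (∮ z in C(c, R), logDeriv f z) = 2 * Real.pi * Complex.I * n := by
  induction n with
  | zero =>
    intro f hf hs hn
    by_cases hz : ∃ a ∈ ball c R, f a = 0
    · obtain ⟨a, ha, hfa⟩ := hz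
      have han : AnalyticOnNhd ℂ f U := hf.analyticOnNhd hU
      have hord := analyticOrderAt_ne_top_of_sphere hR hcU han hs
      -- A `finsum` with infinite support is 0 by convention, so finiteness is needed before a zero
      -- sum can be read as the vanishing of every order.
      have hfin : (ball c R ∩ Function.support (analyticOrderNatAt f)).Finite :=
        (finite_zeros_of_isCompact (isCompact_closedBall c R) (han.mono hcU) hord).subset
          ((support_analyticOrderNatAt_subset f _).trans fun z hz =>
            ⟨ball_subset_closedBall hz.1, hz.2⟩)
      rw [finsum_mem_eq_sum _ hfin, Finset.sum_eq_zero_iff] at hn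
      have h0 : analyticOrderNatAt f a ≠ 0 := by
        intro h
        have h1 := Nat.cast_analyticOrderNatAt (hord a (ball_subset_closedBall ha))
        rw [h, Nat.cast_zero, eq_comm,
          (han a (hcU (ball_subset_closedBall ha))).analyticOrderAt_eq_zero] at h1
        exact h1 hfa
      exact absurd (hn a (by simp [h0, ha])) h0
    · push Not at hz
      have hne : ∀ z ∈ closedBall c R, f z ≠ 0 := fun z hzc => by
        rcases (mem_closedBall.mp hzc).lt_or_eq with h | h
        · exact hz z h
        · exact hs z h
      rw [Nat.cast_zero, mul_zero]
      refine DiffContOnCl.circleIntegral_eq_zero hR.le ?_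
      refine DifferentiableOn.diffContOnCl ?_
      rw [closure_ball c hR.ne']
      intro z hzc
      have hd : DifferentiableAt ℂ f z := hf.differentiableAt (hU.mem_nhds (hcU hzc))
      have hd' : DifferentiableAt ℂ (deriv f) z :=
        (hf.deriv hU).differentiableAt (hU.mem_nhds (hcU hzc))
      exact (hd'.div hd (hne z hzc)).differentiableWithinAt
  | succ n ih =>
    intro f hf hs hn
    have han : AnalyticOnNhd ℂ f U := hf.analyticOnNhd hU
    have hz : ∃ a ∈ ball c R, f a = 0 := by
      by_contra hz
      push Not at hz
      rw [finsum_mem_eq_zero_of_forall_eq_zero] at hn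
      · omega
      · intro z hzb
        by_contra h
        exact hz z hzb (apply_eq_zero_of_analyticOrderNatAt_ne_zero h)
    obtain ⟨a, ha, hfa⟩ := hz
    have haU : a ∈ U := hcU (ball_subset_closedBall ha)
    set g := dslope f a with hg
    have hgd : DifferentiableOn ℂ g U :=
      (Complex.differentiableOn_dslope (hU.mem_nhds haU)).mpr hf
    have hgan : AnalyticOnNhd ℂ g U := hgd.analyticOnNhd hU
    have hfg : f = (fun z => z - a) * g := by
      funext z
      have := sub_smul_dslope f a z
      rw [hfa, sub_zero] at this
      simpa using this.symm
    have hgs : ∀ z ∈ sphere c R, g z ≠ 0 := fun z hz h => hs z hz (by rw [hfg]; simp [h])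
    have hgord := analyticOrderAt_ne_top_of_sphere hR hcU hgan hgs
    have hfing : (ball c R ∩ Function.support (analyticOrderNatAt g)).Finite :=
      (finite_zeros_of_isCompact (isCompact_closedBall c R) (hgan.mono hcU) hgord).subset
        ((support_analyticOrderNatAt_subset g _).trans fun z hz =>
          ⟨ball_subset_closedBall hz.1, hz.2⟩)
    have hlin : AnalyticOnNhd ℂ (fun z : ℂ => z - a) univ := fun z _ => by fun_prop
    have hlord : ∀ z : ℂ, analyticOrderAt (fun z : ℂ => z - a) z = if z = a then 1 else 0 := by
      intro z
      split_ifs with h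
      · subst h; exact analyticOrderAt_id_sub_const_self
      · rw [(hlin z trivial).analyticOrderAt_eq_zero]; exact sub_ne_zero.mpr h
    have hcount : ∑ᶠ z ∈ ball c R, analyticOrderNatAt f z =
        1 + ∑ᶠ z ∈ ball c R, analyticOrderNatAt g z := by
      have h1 : ∀ z ∈ ball c R, analyticOrderNatAt f z =
          analyticOrderNatAt (fun z : ℂ => z - a) z + analyticOrderNatAt g z := by
        intro z hz
        rw [hfg]
        refine analyticOrderNatAt_mul (hlin z trivial) (hgan z (hcU (ball_subset_closedBall hz)))
          ?_ (hgord z (ball_subset_closedBall hz))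
        rw [hlord]; split_ifs <;> simp
      have h2 : ∀ z : ℂ, analyticOrderNatAt (fun z : ℂ => z - a) z = if z = a then 1 else 0 := by
        intro z; rw [analyticOrderNatAt, hlord]; split_ifs <;> simp
      rw [finsum_mem_congr rfl h1, finsum_mem_add_distrib' _ hfing]
      · congr 1
        rw [finsum_mem_eq_sum_of_inter_support_eq (t := {a})]
        · simp [h2]
        · ext z
          simp only [mem_inter_iff, Function.mem_support, h2]
          by_cases h : z = a
          · simp [h, ha]
          · simp [h]
      · refine (Set.finite_singleton a).subset ?_
        intro z hz
        by_contra h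
        exact hz.2 (by rw [h2, if_neg (by simpa using h)])
    have hI := ih g hgd hgs (by omega)
    have hcongr : ∀ z ∈ sphere c R, logDeriv f z = (z - a)⁻¹ + logDeriv g z := by
      intro z hz
      have hza : z - a ≠ 0 := fun h => hs z hz (by rw [hfg]; simp [h])
      rw [hfg]
      have := logDeriv_mul z (f := fun z => z - a) (g := g) hza (hgs z hz) (by fun_prop)
        (hgd.differentiableAt (hU.mem_nhds (hcU (sphere_subset_closedBall hz))))
      simp only [logDeriv_apply] at this ⊢
      rw [show ((fun z => z - a) * g) = fun z => (z - a) * g z from rfl, this]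
      simp
    have hcont : ContinuousOn (logDeriv g) (sphere c R) := by
      intro z hz
      have hzU := hU.mem_nhds (hcU (sphere_subset_closedBall hz))
      exact ((((hgd.deriv hU).differentiableAt hzU).div (hgd.differentiableAt hzU)
        (hgs z hz)).continuousAt).continuousWithinAt
    have hcont' : ContinuousOn (fun z => (z - a)⁻¹) (sphere c R) := by
      intro z hz
      have hza : z - a ≠ 0 := fun h => hs z hz (by rw [hfg]; simp [h])
      have hct : ContinuousAt (fun w : ℂ => w - a) z := by fun_prop
      exact (hct.inv₀ hza).continuousWithinAt
    rw [circleIntegral.integral_congr hR.le hcongr,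
      circleIntegral.integral_add (hcont'.circleIntegrable hR.le) (hcont.circleIntegrable hR.le),
      hI, circleIntegral.integral_sub_inv_of_mem_ball ha]
    push_cast; ring

theorem analyticOnNhd_slice {U : Set ℂ} {h : ℂ → ℂ → ℂ}
    (han : AnalyticOnNhd ℂ (fun p : ℂ × ℂ => h p.1 p.2) (univ ×ˢ U)) (t : ℂ) :
    AnalyticOnNhd ℂ (h t) U := fun z hz =>
  (han (t, z) ⟨trivial, hz⟩).comp₂ analyticAt_const analyticAt_id

/-- U need not be connected. The points of infinite order form an open set inside the compact Ω, and
a limit of such points is another one; so the set is clopen in ℂ, and it cannot be ℂ, which is not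
compact. -/
theorem analyticOrderAt_ne_top_of_zeros {U Ω : Set ℂ} (hU : IsOpen U) (hΩ : IsCompact Ω)
    (hΩU : Ω ⊆ U) {f : ℂ → ℂ} (hf : AnalyticOnNhd ℂ f U) (hz : ∀ z ∈ U, f z = 0 → z ∈ Ω) :
    ∀ z ∈ U, analyticOrderAt f z ≠ ⊤ := by
  set T : Set ℂ := {z ∈ U | analyticOrderAt f z = ⊤} with hT
  have hTopen : IsOpen T := by
    rw [isOpen_iff_mem_nhds]
    rintro z ⟨hzU, hzt⟩
    rw [analyticOrderAt_eq_top] at hzt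
    filter_upwards [hU.mem_nhds hzU, hzt.eventually_nhds] with w hw hw'
    exact ⟨hw, analyticOrderAt_eq_top.mpr hw'⟩
  have hTΩ : T ⊆ Ω := fun z hzT =>
    hz z hzT.1 (analyticOrderAt_eq_top.mp hzT.2).self_of_nhds
  have hTclosed : IsClosed T := by
    rw [← closure_subset_iff_isClosed]
    intro z hzc
    have hzU : z ∈ U := hΩU (closure_minimal hTΩ hΩ.isClosed hzc)
    refine ⟨hzU, analyticOrderAt_eq_top.mpr ?_⟩
    rcases (hf z hzU).eventually_eq_zero_or_eventually_ne_zero with h | h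
    · exact h
    · exfalso
      rw [eventually_nhdsWithin_iff] at h
      obtain ⟨w, hwT, hw⟩ := (mem_closure_iff_frequently.mp hzc).and_eventually h |>.exists
      have hwz : w = z := by
        by_contra hne
        exact hw hne (analyticOrderAt_eq_top.mp hwT.2).self_of_nhds
      subst hwz
      obtain ⟨ε, hε, hball⟩ := Metric.eventually_nhds_iff.mp
        (h.and (analyticOrderAt_eq_top.mp hwT.2))
      have h1 : dist (w + (ε / 2 : ℝ)) w < ε := by
        rw [dist_eq_norm, add_sub_cancel_left, Complex.norm_real, Real.norm_of_nonneg (by linarith)]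
        linarith
      have h2 := hball h1
      refine h2.1 ?_ h2.2
      simp [hε.ne']
  rcases isClopen_iff.mp ⟨hTclosed, hTopen⟩ with h | h
  · intro z hzU hzt
    have : z ∈ T := ⟨hzU, hzt⟩
    rw [h] at this
    exact this
  · exfalso
    have : IsCompact (univ : Set ℂ) := hΩ.of_isClosed_subset isClosed_univ (h ▸ hTΩ)
    exact noncompact_univ ℂ this

/-- Enclose the finitely many zeros at t₀ in small disjoint disks. For t near t₀ no zero lies in Ω
outside the disks, and the integrals of the logarithmic derivative over the circles are so close
that the integer counts agree. -/
theorem zero_count_eventually_const {U Ω : Set ℂ} (hU : IsOpen U) (hΩ : IsCompact Ω)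
    (hΩU : Ω ⊆ U) {h : ℂ → ℂ → ℂ}
    (han : AnalyticOnNhd ℂ (fun p : ℂ × ℂ => h p.1 p.2) (univ ×ˢ U))
    (hz : ∀ t ∈ Icc (0 : ℝ) 1, ∀ z ∈ U, h t z = 0 → z ∈ Ω) {t₀ : ℝ} (ht₀ : t₀ ∈ Icc (0 : ℝ) 1) :
    ∀ᶠ t : ℝ in 𝓝[Icc 0 1] t₀, ∑ᶠ z ∈ Ω, analyticOrderNatAt (h t) z =
      ∑ᶠ z ∈ Ω, analyticOrderNatAt (h t₀) z := by
  have hsl := analyticOnNhd_slice han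
  have hfinΩ : ∀ t ∈ Icc (0 : ℝ) 1, {z ∈ Ω | h t z = 0}.Finite := fun t ht =>
    finite_zeros_of_isCompact hΩ ((hsl t).mono hΩU) fun z hzΩ =>
      analyticOrderAt_ne_top_of_zeros hU hΩ hΩU (hsl t) (hz t ht) z (hΩU hzΩ)
  set Z : Set ℂ := {z ∈ Ω | h t₀ z = 0} with hZ
  have hZfin : Z.Finite := hfinΩ t₀ ht₀
  obtain ⟨ρ, hρ, hρU, hρd⟩ : ∃ ρ : ℝ, 0 < ρ ∧ (∀ a ∈ Z, closedBall a ρ ⊆ U) ∧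
      ∀ a ∈ Z, ∀ b ∈ Z, a ≠ b → 2 * ρ < dist a b := by
    have h1 : ∀ᶠ ρ : ℝ in 𝓝[>] 0, ∀ a ∈ Z, closedBall a ρ ⊆ U := by
      rw [hZfin.eventually_all]
      intro a ha
      obtain ⟨ε, hε, hεU⟩ := Metric.isOpen_iff.mp hU a (hΩU ha.1)
      filter_upwards [Ioo_mem_nhdsGT hε] with ρ hρ
      exact (closedBall_subset_ball hρ.2).trans hεU
    have h2 : ∀ᶠ ρ : ℝ in 𝓝[>] 0, ∀ a ∈ Z, ∀ b ∈ Z, a ≠ b → 2 * ρ < dist a b := by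
      rw [hZfin.eventually_all]
      intro a _
      rw [hZfin.eventually_all]
      intro b _
      by_cases hab : a = b
      · exact Eventually.of_forall fun _ h => absurd hab h
      · have : 0 < dist a b / 2 := by have := dist_pos.mpr hab; linarith
        filter_upwards [Ioo_mem_nhdsGT this] with ρ hρ _
        linarith [hρ.2]
    obtain ⟨ρ, ⟨h1, h2⟩, h3⟩ := ((h1.and h2).and self_mem_nhdsWithin).exists
    exact ⟨ρ, h3, h1, h2⟩
  have hsph : ∀ a ∈ Z, ∀ z ∈ sphere a ρ, h t₀ z ≠ 0 := by
    intro a ha z hza h0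
    have hzU : z ∈ U := hρU a ha (sphere_subset_closedBall hza)
    have hzZ : z ∈ Z := ⟨hz t₀ ht₀ z hzU h0, h0⟩
    have hne : z ≠ a := by
      rintro rfl
      simp at hza
      linarith
    have := hρd z hzZ a ha hne
    rw [mem_sphere.mp hza] at this
    linarith
  set V : Set ℂ := ⋃ a ∈ Z, ball a ρ with hV
  have hVopen : IsOpen V := isOpen_biUnion fun _ _ => isOpen_ball
  have hK : ∀ z ∈ Ω \ V, h t₀ z ≠ 0 := fun z hzK h0 =>
    hzK.2 (mem_biUnion (show z ∈ Z from ⟨hzK.1, h0⟩) (mem_ball_self hρ))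
  have hcts : ∀ z ∈ U, ContinuousAt (fun p : ℂ × ℂ => h p.1 p.2) ((t₀ : ℂ), z) := fun z hzU =>
    (han _ ⟨trivial, hzU⟩).continuousAt
  have hev1 : ∀ᶠ t : ℂ in 𝓝 (t₀ : ℂ), ∀ z ∈ Ω \ V, h t z ≠ 0 := by
    refine (hΩ.diff hVopen).eventually_forall_of_forall_eventually fun z hzK => ?_
    exact (hcts z (hΩU hzK.1)).eventually_ne (hK z hzK)
  have hev2 : ∀ᶠ t : ℂ in 𝓝 (t₀ : ℂ), ∀ a ∈ Z, ∀ z ∈ sphere a ρ, h t z ≠ 0 := by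
    rw [hZfin.eventually_all]
    intro a ha
    refine (isCompact_sphere a ρ).eventually_forall_of_forall_eventually fun z hza => ?_
    exact (hcts z (hρU a ha (sphere_subset_closedBall hza))).eventually_ne (hsph a ha z hza)
  -- The circle has length 2πρ, so this tolerance keeps the two integrals within π of each other,
  -- half of what a single zero contributes.
  have hev3 : ∀ᶠ t : ℂ in 𝓝 (t₀ : ℂ), ∀ a ∈ Z, ∀ z ∈ sphere a ρ,
      ‖logDeriv (h t) z - logDeriv (h t₀) z‖ < 1 / (2 * ρ) := by
    rw [hZfin.eventually_all]
    intro a ha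
    refine (isCompact_sphere a ρ).eventually_forall_of_forall_eventually fun z hza => ?_
    have hzU : z ∈ U := hρU a ha (sphere_subset_closedBall hza)
    -- Writing the z-derivative as a partial derivative of the joint function makes it jointly
    -- continuous in (t, z).
    have hd : ∀ p ∈ (univ : Set ℂ) ×ˢ U, deriv (h p.1) p.2 =
        fderiv ℂ (fun p : ℂ × ℂ => h p.1 p.2) p (0, 1) := by
      intro p hp
      have h1 : HasFDerivAt (fun p : ℂ × ℂ => h p.1 p.2)
          (fderiv ℂ (fun p : ℂ × ℂ => h p.1 p.2) p) (p.1, p.2) :=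
        (han p hp).differentiableAt.hasFDerivAt
      have h2 : HasDerivAt (fun z : ℂ => (p.1, z)) ((0 : ℂ), (1 : ℂ)) p.2 :=
        (hasDerivAt_const _ _).prodMk (hasDerivAt_id _)
      exact (h1.comp_hasDerivAt p.2 h2).deriv
    have hopen : IsOpen ((univ : Set ℂ) ×ˢ U) := isOpen_univ.prod hU
    have hld : ContinuousAt (fun p : ℂ × ℂ => logDeriv (h p.1) p.2) ((t₀ : ℂ), z) := by
      have h1 : ContinuousAt (fun p : ℂ × ℂ => fderiv ℂ (fun p : ℂ × ℂ => h p.1 p.2) p (0, 1) /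
          h p.1 p.2) ((t₀ : ℂ), z) := by
        refine ContinuousAt.div ?_ (hcts z hzU) (hsph a ha z hza)
        exact (han.fderiv _ ⟨trivial, hzU⟩).continuousAt.clm_apply continuousAt_const
      refine h1.congr ?_
      filter_upwards [hopen.mem_nhds (show ((t₀ : ℂ), z) ∈ _ from ⟨trivial, hzU⟩)] with p hp
      rw [logDeriv_apply, hd p hp]
    have hld2 : ContinuousAt (fun p : ℂ × ℂ => logDeriv (h t₀) p.2) ((t₀ : ℂ), z) := by
      have : ContinuousAt (fun w : ℂ => logDeriv (h t₀) w) z :=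
        hld.comp (f := fun w : ℂ => ((t₀ : ℂ), w)) (by fun_prop)
      exact this.comp (f := fun p : ℂ × ℂ => p.2) (x := ((t₀ : ℂ), z)) continuousAt_snd
    have := (hld.sub hld2).norm
    refine this.eventually_lt continuousAt_const ?_
    simp [hρ]
  have hpull : Tendsto (fun t : ℝ => (t : ℂ)) (𝓝[Icc 0 1] t₀) (𝓝 (t₀ : ℂ)) :=
    (Complex.continuous_ofReal.tendsto t₀).mono_left nhdsWithin_le_nhds
  -- the count over `Ω` is the sum of the counts over the disks
  have hsum : ∀ t ∈ Icc (0 : ℝ) 1, (∀ z ∈ Ω \ V, h t z ≠ 0) →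
      ∑ᶠ z ∈ Ω, analyticOrderNatAt (h t) z =
        ∑ᶠ a ∈ Z, ∑ᶠ z ∈ ball a ρ, analyticOrderNatAt (h t) z := by
    intro t ht hne
    set f := analyticOrderNatAt (h t) with hf
    have hsub : ∀ a ∈ Z, ball a ρ ∩ Function.support f ⊆ {z ∈ Ω | h t z = 0} := by
      intro a ha z hza
      have h0 := apply_eq_zero_of_analyticOrderNatAt_ne_zero hza.2
      exact ⟨hz t ht z (hρU a ha (ball_subset_closedBall hza.1)) h0, h0⟩
    have h1 : ∑ᶠ z ∈ Ω, f z = ∑ᶠ z ∈ ⋃ a ∈ Z, (ball a ρ ∩ Function.support f), f z := by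
      refine finsum_mem_inter_support_eq' f _ _ fun z hzs => ?_
      constructor
      · intro hzΩ
        have hzV : z ∈ V := by
          by_contra hzV
          exact hne z ⟨hzΩ, hzV⟩ (apply_eq_zero_of_analyticOrderNatAt_ne_zero hzs)
        obtain ⟨a, ha, hza⟩ := mem_iUnion₂.mp hzV
        exact mem_iUnion₂.mpr ⟨a, ha, hza, hzs⟩
      · intro hzu
        obtain ⟨a, ha, hza⟩ := mem_iUnion₂.mp hzu
        exact (hsub a ha hza).1
    rw [h1, finsum_mem_biUnion _ hZfin fun a ha => (hfinΩ t ht).subset (hsub a ha)]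
    · refine finsum_mem_congr rfl fun a _ => ?_
      rw [finsum_mem_inter_support]
    · intro a ha b hb hab
      refine Disjoint.mono inter_subset_left inter_subset_left ?_
      exact ball_disjoint_ball (by linarith [hρd a ha b hb hab])
  filter_upwards [hpull.eventually hev1, hpull.eventually hev2, hpull.eventually hev3,
    self_mem_nhdsWithin] with t h1 h2 h3 ht
  rw [hsum t ht h1, hsum t₀ ht₀ hK]
  refine finsum_mem_congr rfl fun a ha => ?_
  have e1 := circleIntegral_logDeriv_eq hU hρ (hρU a ha) _ (h t) (hsl t).differentiableOn
    (h2 a ha) rfl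
  have e2 := circleIntegral_logDeriv_eq hU hρ (hρU a ha) _ (h t₀) (hsl t₀).differentiableOn
    (hsph a ha) rfl
  have hint : ∀ s : ℂ, (∀ z ∈ sphere a ρ, h s z ≠ 0) →
      CircleIntegrable (logDeriv (h s)) a ρ := by
    intro s hs
    refine ContinuousOn.circleIntegrable hρ.le fun z hza => ?_
    have hzU := hU.mem_nhds (hρU a ha (sphere_subset_closedBall hza))
    have hd := (hsl s).differentiableOn
    exact ((((hd.deriv hU).differentiableAt hzU).div (hd.differentiableAt hzU)
      (hs z hza)).continuousAt).continuousWithinAt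
  have e3 := circleIntegral.norm_integral_le_of_norm_le_const hρ.le
    (fun z hza => (h3 a ha z hza).le)
  rw [circleIntegral.integral_sub (hint _ (h2 a ha)) (hint _ (hsph a ha)), e1, e2, ← mul_sub,
    norm_mul] at e3
  have e4 : ‖(2 * Real.pi * Complex.I : ℂ)‖ = 2 * Real.pi := by
    simp [abs_of_pos Real.pi_pos]
  rw [e4] at e3
  have e5 : 2 * Real.pi * ρ * (1 / (2 * ρ)) = 2 * Real.pi * (1 / 2) := by
    field_simp
  rw [e5] at e3
  have e6 := le_of_mul_le_mul_left e3 (by positivity)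
  set x := ∑ᶠ z ∈ ball a ρ, analyticOrderNatAt (h t) z
  set y := ∑ᶠ z ∈ ball a ρ, analyticOrderNatAt (h t₀) z
  have e7 : ‖((x : ℤ) - (y : ℤ) : ℤ)‖ ≤ 1 / 2 := by
    rw [Int.norm_eq_abs]
    have : ((x : ℂ) - y) = (((x : ℤ) - (y : ℤ) : ℤ) : ℂ) := by push_cast; rfl
    rw [this, Complex.norm_intCast] at e6
    exact e6
  have e8 : ((x : ℤ) - y) = 0 := by
    by_contra hne
    have : (1 : ℝ) ≤ |(((x : ℤ) - y : ℤ) : ℝ)| := by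
      exact_mod_cast Int.one_le_abs hne
    rw [Int.norm_eq_abs] at e7
    linarith
  omega

/-- The number of zeros of an analytic family does not change as long as the zeros stay in a
compact subset. -/
theorem zero_count_eq {U Ω : Set ℂ} (hU : IsOpen U) (hΩ : IsCompact Ω)
    (hΩU : Ω ⊆ U) {h : ℂ → ℂ → ℂ}
    (han : AnalyticOnNhd ℂ (fun p : ℂ × ℂ => h p.1 p.2) (univ ×ˢ U))
    (hz : ∀ t ∈ Icc (0 : ℝ) 1, ∀ z ∈ U, h t z = 0 → z ∈ Ω) :
    ∑ᶠ z ∈ Ω, analyticOrderNatAt (h 1) z = ∑ᶠ z ∈ Ω, analyticOrderNatAt (h 0) z := by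
  have hc : ContinuousOn (fun t : ℝ => ∑ᶠ z ∈ Ω, analyticOrderNatAt (h t) z) (Icc 0 1) := by
    intro t₀ ht₀
    refine Tendsto.congr' (f₁ := fun _ => ∑ᶠ z ∈ Ω, analyticOrderNatAt (h t₀) z) ?_
      tendsto_const_nhds
    filter_upwards [zero_count_eventually_const hU hΩ hΩU han hz ht₀] with t ht
    exact ht.symm
  have := isPreconnected_Icc.constant hc (x := 1) (y := 0) (by simp) (by simp)
  simpa using this

end ChebSpec

end

noncomputable section

namespace ChebSpec

open Filter Topology

/-! ### Determinants of perturbations of the identity that live on a finite-dimensional space -/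

section Compression

variable {E V W : Type} [AddCommGroup E] [Module ℂ E] [AddCommGroup V] [Module ℂ V]
  [AddCommGroup W] [Module ℂ W]

/-- As X preserves ker Q, its compression is the map induced on the quotient by ker Q; nothing is
required of Y. -/
theorem det_compression_mul (Q : E →ₗ[ℂ] W) (J : W →ₗ[ℂ] E) (hQJ : ∀ w, Q (J w) = w)
    {X Y : E →ₗ[ℂ] E} (hX : ∀ x, Q x = 0 → Q (X x) = 0) :
    LinearMap.det (Q ∘ₗ (X ∘ₗ Y) ∘ₗ J) =
      LinearMap.det (Q ∘ₗ X ∘ₗ J) * LinearMap.det (Q ∘ₗ Y ∘ₗ J) := by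
  rw [← LinearMap.det_comp]
  congr 1
  ext w
  have := hX (Y (J w) - J (Q (Y (J w)))) (by rw [map_sub, hQJ, sub_self])
  rw [map_sub, map_sub, sub_eq_zero] at this
  simpa using this

variable [FiniteDimensional ℂ V] [FiniteDimensional ℂ W]

theorem det_id_sub_comp_comm (a : V →ₗ[ℂ] W) (b : W →ₗ[ℂ] V) :
    LinearMap.det (LinearMap.id - a ∘ₗ b) = LinearMap.det (LinearMap.id - b ∘ₗ a) := by
  let v := Module.finBasis ℂ V
  let w := Module.finBasis ℂ W
  rw [← LinearMap.det_toMatrix w, ← LinearMap.det_toMatrix v, map_sub, map_sub,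
    LinearMap.toMatrix_id, LinearMap.toMatrix_id, LinearMap.toMatrix_comp w v w,
    LinearMap.toMatrix_comp v w v, Matrix.det_one_sub_mul_comm]

/-- Since X is the identity on ker π, the map 1 - X factors through π. Any finer quotient Q then
sees the same determinant, by Sylvester's identity det(1 - ab) = det(1 - ba). -/
theorem det_compression_eq (Q : E →ₗ[ℂ] W) (J : W →ₗ[ℂ] E) (hQJ : ∀ w, Q (J w) = w)
    (π : E →ₗ[ℂ] V) (j : V →ₗ[ℂ] E) (hπj : ∀ v, π (j v) = v) (hQπ : ∀ x, Q x = 0 → π x = 0)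
    {X : E →ₗ[ℂ] E} (hX : ∀ x, π x = 0 → X x = x) :
    LinearMap.det (Q ∘ₗ X ∘ₗ J) = LinearMap.det (π ∘ₗ X ∘ₗ j) := by
  have hF : ∀ x, x - X x = j (π x) - X (j (π x)) := by
    intro x
    have h := hX (x - j (π x)) (by rw [map_sub, hπj, sub_self])
    rw [map_sub] at h
    rw [sub_eq_sub_iff_add_eq_add, ← sub_eq_sub_iff_add_eq_add, ← sub_eq_zero] at *
    rw [← neg_eq_zero] at h
    rw [← h]
    abel
  have hJQ : ∀ x, π (J (Q x)) = π x := by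
    intro x
    have := hQπ (J (Q x) - x) (by rw [map_sub, hQJ, sub_self])
    rwa [map_sub, sub_eq_zero] at this
  have e1 : Q ∘ₗ X ∘ₗ J = LinearMap.id - (Q ∘ₗ (j - X ∘ₗ j)) ∘ₗ (π ∘ₗ J) := by
    ext w
    have := congrArg Q (hF (J w))
    simp only [map_sub, hQJ] at this
    simp [← this]
  have e2 : π ∘ₗ X ∘ₗ j = LinearMap.id - (π ∘ₗ J) ∘ₗ (Q ∘ₗ (j - X ∘ₗ j)) := by
    ext v
    simp [hJQ, hπj]
  rw [e1, e2, det_id_sub_comp_comm]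

/-- X is block triangular with respect to ker π: the identity there, and the compression on the
quotient. -/
theorem bijective_of_det_compression_ne_zero (π : E →ₗ[ℂ] V) (j : V →ₗ[ℂ] E)
    (hπj : ∀ v, π (j v) = v) {X : E →ₗ[ℂ] E} (hX : ∀ x, π x = 0 → X x = x)
    (hdet : LinearMap.det (π ∘ₗ X ∘ₗ j) ≠ 0) : Function.Bijective X := by
  have hker : (π ∘ₗ X ∘ₗ j).ker = ⊥ := by
    by_contra h
    exact hdet (LinearMap.det_eq_zero_iff_ker_ne_bot.mpr h)
  constructor
  · rw [← LinearMap.ker_eq_bot, LinearMap.ker_eq_bot']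
    intro x hx
    have h := hX (x - j (π x)) (by rw [map_sub, hπj, sub_self])
    rw [map_sub, hx, zero_sub] at h
    have h1 : π x = 0 := by
      rw [← Submodule.mem_bot ℂ, ← hker, LinearMap.mem_ker]
      have := congrArg π h
      simp only [map_neg, map_sub, hπj, sub_self, neg_eq_zero] at this
      simpa using this
    rw [← hX x h1, hx]
  · intro y
    obtain ⟨v, hv⟩ := LinearMap.surjective_of_injective (LinearMap.ker_eq_bot.mp hker) (π y)
    refine ⟨j v + (y - X (j v)), ?_⟩
    rw [map_add, hX (y - X (j v))]
    · abel
    · rw [map_sub, ← hv]; simp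

/-- For v in the kernel of the compression, X(jv) lies in ker π and is fixed by X, so X kills jv -
X(jv); applying π to this vector returns v. -/
theorem exists_ker_of_det_compression_eq_zero (π : E →ₗ[ℂ] V) (j : V →ₗ[ℂ] E)
    (hπj : ∀ v, π (j v) = v) {X : E →ₗ[ℂ] E} (hX : ∀ x, π x = 0 → X x = x)
    (hdet : LinearMap.det (π ∘ₗ X ∘ₗ j) = 0) : ∃ x, x ≠ 0 ∧ X x = 0 := by
  obtain ⟨v, hv, hv0⟩ := Submodule.exists_mem_ne_zero_of_ne_bot
    (LinearMap.det_eq_zero_iff_ker_ne_bot.mp hdet)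
  have hv' : π (X (j v)) = 0 := by simpa using hv
  refine ⟨j v - X (j v), fun h => hv0 ?_, ?_⟩
  · have := congrArg π h
    rwa [map_sub, hπj, hv', sub_zero, map_zero] at this
  · rw [map_sub, hX _ hv', sub_self]

theorem det_smul_id_sub_of_isNilpotent (f : W →ₗ[ℂ] W) (hf : IsNilpotent f) (c : ℂ) :
    LinearMap.det (c • LinearMap.id - f) = c ^ Module.finrank ℂ W := by
  have := LinearMap.eval_charpoly f c
  rw [IsNilpotent.charpoly_eq_X_pow_finrank hf] at this
  simp only [Polynomial.eval_pow, Polynomial.eval_X] at this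
  rw [this]
  rfl

end Compression

/-! ### Orders of vanishing -/

/-- Continuity of u suffices: cancel the common power of w - z off z and compare limits. This
matters because the cofactor built below is only known to be continuous. -/
theorem natCast_le_analyticOrderAt_of_eq_mul {g u : ℂ → ℂ} {z : ℂ} {p : ℕ}
    (hg : AnalyticAt ℂ g z) (hu : ContinuousAt u z)
    (h : ∀ᶠ w in 𝓝 z, g w = u w * (w - z) ^ p) : (p : ℕ∞) ≤ analyticOrderAt g z := by
  by_contra hlt
  push Not at hlt
  have htop : analyticOrderAt g z ≠ ⊤ := hlt.ne_top
  obtain ⟨v, hv, hv0, hgv⟩ := hg.analyticOrderAt_ne_top.mp htop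
  set q := analyticOrderNatAt g z with hq
  have hqp : q < p := by
    rw [← Nat.cast_analyticOrderNatAt htop] at hlt
    exact_mod_cast hlt
  have h1 : Tendsto v (𝓝[≠] z) (𝓝 (v z)) := hv.continuousAt.tendsto.mono_left nhdsWithin_le_nhds
  have h2 : Tendsto (fun w => u w * (w - z) ^ (p - q)) (𝓝[≠] z) (𝓝 (u z * (z - z) ^ (p - q))) := by
    have : ContinuousAt (fun w => u w * (w - z) ^ (p - q)) z := by fun_prop
    exact this.tendsto.mono_left nhdsWithin_le_nhds
  have h3 : v =ᶠ[𝓝[≠] z] fun w => u w * (w - z) ^ (p - q) := by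
    filter_upwards [nhdsWithin_le_nhds h, nhdsWithin_le_nhds hgv, self_mem_nhdsWithin]
      with w hw1 hw2 hw3
    have hne : (w - z) ^ q ≠ 0 := pow_ne_zero _ (sub_ne_zero.mpr hw3)
    apply mul_left_cancel₀ hne
    rw [← smul_eq_mul, ← hw2, hw1, mul_left_comm, ← pow_add, Nat.add_sub_cancel' hqp.le]
  have := tendsto_nhds_unique h1 (h2.congr' h3.symm)
  rw [sub_self, zero_pow (by omega), mul_zero] at this
  exact hv0 this

theorem analyticOrderAt_eq_of_eq_mul {g u : ℂ → ℂ} {z : ℂ} {p : ℕ}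
    (hg : AnalyticAt ℂ g z) (htop : analyticOrderAt g z ≠ ⊤) (hu : ContinuousAt u z)
    (h : ∀ᶠ w in 𝓝 z, g w = u w * (w - z) ^ p) (huz : u z ≠ 0) :
    analyticOrderNatAt g z = p := by
  have hle := natCast_le_analyticOrderAt_of_eq_mul hg hu h
  rw [← Nat.cast_analyticOrderNatAt htop, Nat.cast_le] at hle
  refine le_antisymm ?_ hle
  by_contra hlt
  push Not at hlt
  obtain ⟨v, hv, hv0, hgv⟩ := hg.analyticOrderAt_ne_top.mp htop
  set q := analyticOrderNatAt g z with hq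
  have h1 : Tendsto u (𝓝[≠] z) (𝓝 (u z)) := hu.tendsto.mono_left nhdsWithin_le_nhds
  have h2 : Tendsto (fun w => v w * (w - z) ^ (q - p)) (𝓝[≠] z) (𝓝 (v z * (z - z) ^ (q - p))) := by
    have hvc := hv.continuousAt
    have : ContinuousAt (fun w => v w * (w - z) ^ (q - p)) z := by fun_prop
    exact this.tendsto.mono_left nhdsWithin_le_nhds
  have h3 : u =ᶠ[𝓝[≠] z] fun w => v w * (w - z) ^ (q - p) := by
    filter_upwards [nhdsWithin_le_nhds h, nhdsWithin_le_nhds hgv, self_mem_nhdsWithin]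
      with w hw1 hw2 hw3
    have hne : (w - z) ^ p ≠ 0 := pow_ne_zero _ (sub_ne_zero.mpr hw3)
    apply mul_right_cancel₀ hne
    rw [← hw1, hw2, smul_eq_mul, mul_comm, mul_assoc, ← pow_add, Nat.sub_add_cancel hlt.le]
  have := tendsto_nhds_unique h1 (h2.congr' h3.symm)
  rw [sub_self, zero_pow (by omega), mul_zero] at this
  exact huz this

/-! ### Algebraic multiplicity as an order of vanishing -/

section Multiplicity

variable {E : Type} [NormedAddCommGroup E] [NormedSpace ℂ E] {d : ℕ}
  {T L : E →L[ℂ] E} {π : E →L[ℂ] (Fin d → ℂ)} {j : (Fin d → ℂ) →L[ℂ] E}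
  {C Cinv : ℂ → E →L[ℂ] E}

/-- The compression to a finite-dimensional space of `C(z)⁻¹ (T - z L)`. -/
def compressedDet (T L : E →L[ℂ] E) (π : E →L[ℂ] (Fin d → ℂ)) (j : (Fin d → ℂ) →L[ℂ] E)
    (Cinv : ℂ → E →L[ℂ] E) (z : ℂ) : ℂ :=
  LinearMap.det ((π ∘L (Cinv z ∘L (T - z • L)) ∘L j : (Fin d → ℂ) →L[ℂ] (Fin d → ℂ)) :
    (Fin d → ℂ) →ₗ[ℂ] (Fin d → ℂ))

/-- With R a projection onto N, the pencil is the product of (T - wL)(1 - R) + (T - z₀L)R and 1 - (w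
- z₀)MR. After applying `Cinv`, both factors are the identity on ker R ∩ ker π, so their
determinants can be taken on the quotient by that space and multiplied. The last clause quantifies
over all projections R because the one in use is chosen inside the proof. -/
theorem exists_compressedDet_factor {z z₀ : ℂ} (hπj : ∀ v, π (j v) = v)
    (hC : ∀ᶠ w in 𝓝 z, ∀ x, Cinv w (C w x) = x)
    (hB : ∀ᶠ w in 𝓝 z, ∀ x, π x = 0 → T x - w • L x = C w x)
    (hcts : ContinuousAt Cinv z) (N : Submodule ℂ E) [FiniteDimensional ℂ N]
    (M : N →ₗ[ℂ] N) (hM : ∀ x : N, L x = T (M x) - z₀ • L (M x)) :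
    ∃ u : ℂ → ℂ, ContinuousAt u z ∧
      (∀ᶠ w in 𝓝 z, compressedDet T L π j Cinv w =
        u w * LinearMap.det (LinearMap.id - (w - z₀) • M)) ∧
      ((∀ R : E →L[ℂ] N, (∀ x : N, R x = x) →
        ∀ x, T (x - R x) - z • L (x - R x) + (T (R x) - z₀ • L (R x)) = 0 → x = 0) →
        (∀ x, C z (Cinv z x) = x) → u z ≠ 0) := by
  -- A finite-dimensional subspace has a continuous projection; its continuity is what makes the
  -- regular factor continuous in w.
  obtain ⟨R, hR⟩ := Submodule.ClosedComplemented.of_finiteDimensional (𝕜 := ℂ) N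
  set ι : N →L[ℂ] E := N.subtypeL with hι
  -- the quotient by the intersection of the kernels
  set Q₀ : E →L[ℂ] N × (Fin d → ℂ) := R.prod π with hQ₀
  set W : Submodule ℂ (N × (Fin d → ℂ)) := LinearMap.range (Q₀ : E →ₗ[ℂ] _) with hW
  set Q : E →L[ℂ] W := Q₀.codRestrict W (fun x => ⟨x, rfl⟩) with hQ
  have hQ0 : ∀ x, Q x = 0 ↔ R x = 0 ∧ π x = 0 := by
    intro x
    have : Q x = 0 ↔ (R x, π x) = (0 : N × (Fin d → ℂ)) := Subtype.ext_iff
    rw [this, Prod.mk_eq_zero]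
  have hQsurj : (Q : E →ₗ[ℂ] W).range = ⊤ := by
    rw [LinearMap.range_eq_top]
    rintro ⟨_, x, rfl⟩
    exact ⟨x, rfl⟩
  obtain ⟨J₀, hJ₀⟩ := LinearMap.exists_rightInverse_of_surjective (Q : E →ₗ[ℂ] W) hQsurj
  obtain ⟨J, hQJ⟩ : ∃ J : W →L[ℂ] E, ∀ w, Q (J w) = w :=
    ⟨LinearMap.toContinuousLinearMap J₀, fun w => LinearMap.congr_fun hJ₀ w⟩
  -- the regular factor
  set G : ℂ → E →L[ℂ] E := fun w =>
    Cinv w ∘L ((T - w • L) ∘L (ContinuousLinearMap.id ℂ E - ι ∘L R) +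
      (T - z₀ • L) ∘L (ι ∘L R)) with hG
  have hGa : ∀ w x, G w x = Cinv w (T (x - R x) - w • L (x - R x) +
      (T (R x) - z₀ • L (R x))) := fun _ _ => rfl
  have hGc : ContinuousAt G z := by
    refine hcts.clm_comp ?_
    fun_prop
  have hGid : ∀ w, (∀ x, Cinv w (C w x) = x) → (∀ x, π x = 0 → T x - w • L x = C w x) →
      ∀ x, Q x = 0 → G w x = x := by
    intro w hw1 hw2 x hx
    obtain ⟨h1, h2⟩ := (hQ0 x).mp hx
    rw [hGa, h1]
    simp only [ZeroMemClass.coe_zero, sub_zero, map_zero, smul_zero, add_zero]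
    rw [hw2 x h2, hw1]
  refine ⟨fun w => (Q ∘L G w ∘L J).det, ?_, ?_, ?_⟩
  · refine ContinuousLinearMap.continuous_det.continuousAt.comp ?_
    exact continuousAt_const.clm_comp (hGc.clm_comp continuousAt_const)
  · filter_upwards [hC, hB] with w hw1 hw2
    set X : E →ₗ[ℂ] E := LinearMap.id - (w - z₀) • ((ι : N →ₗ[ℂ] E) ∘ₗ M ∘ₗ (R : E →ₗ[ℂ] N))
      with hX
    have hfac : ((Cinv w ∘L (T - w • L) : E →L[ℂ] E) : E →ₗ[ℂ] E) = (G w : E →ₗ[ℂ] E) ∘ₗ X := by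
      ext x
      have hRX : R (X x) = R x - (w - z₀) • M (R x) := by
        simp only [hX, LinearMap.sub_apply, LinearMap.id_apply, LinearMap.smul_apply,
          LinearMap.comp_apply, ContinuousLinearMap.coe_coe, map_sub, map_smul, hι,
          Submodule.subtypeL_apply, hR]
      have hXR : X x - (R (X x) : E) = x - R x := by
        rw [hRX]; simp [hX, hι]
      have key : T x - w • L x = T (X x - (R (X x) : E)) - w • L (X x - (R (X x) : E)) +
          (T (R (X x) : E) - z₀ • L (R (X x) : E)) := by
        rw [hXR, hRX]
        have hMx := hM (R x)
        simp only [map_sub, Submodule.coe_sub, Submodule.coe_smul, map_smul]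
        have hMx' : T (M (R x) : E) = L (R x) + z₀ • L (M (R x)) := by rw [hMx]; abel
        rw [hMx']
        module
      change Cinv w (T x - w • L x) = G w (X x)
      rw [key, hGa]
    have h1 : compressedDet T L π j Cinv w =
        LinearMap.det ((Q : E →ₗ[ℂ] W) ∘ₗ ((G w : E →ₗ[ℂ] E) ∘ₗ X) ∘ₗ (J : W →ₗ[ℂ] E)) := by
      rw [← hfac, det_compression_eq (Q : E →ₗ[ℂ] W) (J : W →ₗ[ℂ] E) hQJ
        (π : E →ₗ[ℂ] (Fin d → ℂ)) (j : (Fin d → ℂ) →ₗ[ℂ] E) hπj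
        (fun x hx => ((hQ0 x).mp hx).2) ?_]
      · rfl
      · intro x hx
        change Cinv w (T x - w • L x) = x
        rw [hw2 x hx, hw1]
    have h2 : LinearMap.det ((Q : E →ₗ[ℂ] W) ∘ₗ X ∘ₗ (J : W →ₗ[ℂ] E)) =
        LinearMap.det (LinearMap.id - (w - z₀) • M) := by
      rw [det_compression_eq (Q : E →ₗ[ℂ] W) (J : W →ₗ[ℂ] E) hQJ
        (R : E →ₗ[ℂ] N) (ι : N →ₗ[ℂ] E) hR (fun x hx => ((hQ0 x).mp hx).1) ?_]
      · congr 1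
        ext x
        simp [hX, hι, hR]
      · intro x hx
        have : R x = 0 := hx
        simp [hX, this]
    rw [h1, det_compression_mul (Q : E →ₗ[ℂ] W) (J : W →ₗ[ℂ] E) hQJ, h2]
    · rfl
    · intro x hx
      have hx' := hGid w hw1 hw2 x hx
      simp only [ContinuousLinearMap.coe_coe] at hx ⊢
      rw [hx', hx]
  · intro hinj hCz
    have hw1 := hC.self_of_nhds
    have hw2 := hB.self_of_nhds
    change LinearMap.det ((Q ∘L G z ∘L J : W →L[ℂ] W) : W →ₗ[ℂ] W) ≠ 0
    intro h0
    obtain ⟨v, hv, hv0⟩ := Submodule.exists_mem_ne_zero_of_ne_bot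
      (LinearMap.det_eq_zero_iff_ker_ne_bot.mp h0)
    apply hv0
    have hv' : Q (G z (J v)) = 0 := by simpa using hv
    -- G(z)Jv lies in ker Q, where G(z) is the identity, so G(z) kills Jv - G(z)Jv.
    have h1 := hGid z hw1 hw2 _ hv'
    have h2 : G z (J v - G z (J v)) = 0 := by rw [map_sub, h1, sub_self]
    have h3 : J v - G z (J v) = 0 := by
      apply hinj R hR
      have := congrArg (C z) h2
      rwa [map_zero, hGa, hCz] at this
    rw [sub_eq_zero] at h3
    rw [← hQJ v, h3, hv']

end Multiplicity

end ChebSpec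

end

noncomputable section

namespace ChebSpec

open Filter Topology

/-! ### Root vectors as a generalized kernel, and its dimension. -/

section RootSpace

variable {E : Type} [NormedAddCommGroup E] [NormedSpace ℂ E]

theorem isGenEigenvalue_iff (T L : E →L[ℂ] E) (z : ℂ) :
    IsGenEigenvalue T L z ↔ ∃ x, x ≠ 0 ∧ T x - z • L x = 0 :=
  exists_congr fun x => by rw [sub_eq_zero]

theorem pencil_shift {T L : E →L[ℂ] E} {z z₀ : ℂ} (M : E →ₗ[ℂ] E)
    (hM : ∀ x, T (M x) - z₀ • L (M x) = L x) (x : E) :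
    T x - z • L x = T (x - (z - z₀) • M x) - z₀ • L (x - (z - z₀) • M x) := by
  have h : T (M x) = L x + z₀ • L (M x) := by rw [← hM x]; abel
  simp only [map_sub, map_smul, h]
  module

/-- By injectivity of T - z₀L, the chain relation (T - zL)x = Ly says A x = M y with A = 1 - (z -
z₀)M. As M commutes with A, climbing a Jordan chain raises the power of A by one. -/
theorem rootSpace_eq_ker_pow {T L : E →L[ℂ] E} {z z₀ : ℂ}
    (M : E →ₗ[ℂ] E) (hinj : ∀ x, T x - z₀ • L x = 0 → x = 0)
    (hM : ∀ x, T (M x) - z₀ • L (M x) = L x) (n : ℕ) :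
    rootSpace T L z n = LinearMap.ker ((1 - (z - z₀) • M : Module.End ℂ E) ^ n) := by
  set A : Module.End ℂ E := 1 - (z - z₀) • M with hA
  have hMA : Commute M A := by
    rw [hA]
    exact (Commute.one_right M).sub_right ((Commute.refl M).smul_right _)
  have hBA : ∀ x, T x - z • L x = T (A x) - z₀ • L (A x) :=
    fun x => pencil_shift M hM x
  induction n with
  | zero => simp [rootSpace, Module.End.one_eq_id]
  | succ n ih =>
    ext x
    have h1 : x ∈ rootSpace T L z (n + 1) ↔ ∃ y ∈ rootSpace T L z n, L y = T x - z • L x := by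
      rw [rootSpace]; exact Iff.rfl
    rw [h1, ih, LinearMap.mem_ker]
    constructor
    · rintro ⟨y, hy, hyx⟩
      rw [LinearMap.mem_ker] at hy
      have h2 : M y = A x := by
        rw [← sub_eq_zero]
        apply hinj
        rw [hBA, ← hM] at hyx
        rw [map_sub, map_sub, smul_sub, sub_sub_sub_comm, hyx, sub_self]
      rw [pow_succ, Module.End.mul_apply, ← h2, ← Module.End.mul_apply,
        ← (hMA.pow_right n).eq, Module.End.mul_apply, hy, map_zero]
    · intro hx
      rw [pow_succ, Module.End.mul_apply] at hx
      -- A geometric sum: (z - z₀)M = 1 - A, so M maps this vector to (1 - Aⁿ)(A x), which is A x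
      -- because A^(n+1) kills x.
      refine ⟨(z - z₀) • (∑ k ∈ Finset.range n, A ^ k) (A x), ?_, ?_⟩
      · have hc : Commute (A ^ n) (∑ k ∈ Finset.range n, A ^ k) :=
          Commute.sum_right _ _ _ fun k _ => (Commute.refl A).pow_pow _ _
        rw [LinearMap.mem_ker, map_smul, ← Module.End.mul_apply, hc.eq, Module.End.mul_apply, hx,
          map_zero, smul_zero]
      · have h3 : (z - z₀) • M = 1 - A := by rw [hA]; abel
        rw [← hM, hBA]
        have h4 : M ((z - z₀) • (∑ k ∈ Finset.range n, A ^ k) (A x)) = A x := by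
          rw [map_smul, ← LinearMap.smul_apply, h3, ← Module.End.mul_apply, mul_neg_geom_sum,
            LinearMap.sub_apply, hx, sub_zero, Module.End.one_apply]
        rw [h4]

/-- Adjoining the images under A, …, A^(n-1) keeps the set finite and makes its span invariant. This
lets dimensions be bounded before the kernel is known to be finite-dimensional. -/
theorem exists_invariant_of_card {A : Module.End ℂ E} {n : ℕ}
    (s : Finset (LinearMap.ker (A ^ n)))
    (hs : LinearIndependent ℂ fun i : s => (i : LinearMap.ker (A ^ n))) :
    ∃ N : Submodule ℂ E, FiniteDimensional ℂ N ∧ N ≤ LinearMap.ker (A ^ n) ∧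
      (∀ x ∈ N, A x ∈ N) ∧ s.card ≤ Module.finrank ℂ N := by
  set S : Set E := ⋃ k ∈ Finset.range n, (fun x : LinearMap.ker (A ^ n) => (A ^ k) x) '' s with hS
  have hSfin : S.Finite := by
    refine Set.Finite.biUnion (Finset.finite_toSet _) fun k _ => ?_
    exact s.finite_toSet.image _
  have hmem : ∀ x : LinearMap.ker (A ^ n), (A ^ n) (x : E) = 0 := fun x => x.2
  have hfd : FiniteDimensional ℂ (Submodule.span ℂ S) := FiniteDimensional.span_of_finite ℂ hSfin
  refine ⟨Submodule.span ℂ S, hfd, ?_, ?_, ?_⟩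
  · rw [Submodule.span_le]
    intro y hy
    simp only [hS, Set.mem_iUnion] at hy
    obtain ⟨k, _, x, _, rfl⟩ := hy
    change (A ^ n) ((A ^ k) x) = 0
    rw [← Module.End.mul_apply, ← pow_add, add_comm, pow_add, Module.End.mul_apply, hmem, map_zero]
  · suffices h : Submodule.span ℂ S ≤ (Submodule.span ℂ S).comap A from h
    rw [Submodule.span_le]
    intro y hy
    simp only [hS, Set.mem_iUnion] at hy
    obtain ⟨k, hk, x, hx, rfl⟩ := hy
    change A ((A ^ k) (x : E)) ∈ Submodule.span ℂ S
    rw [← Module.End.mul_apply, ← pow_succ']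
    rcases Nat.lt_or_ge (k + 1) n with h | h
    · refine Submodule.subset_span ?_
      simp only [hS, Set.mem_iUnion]
      exact ⟨k + 1, by simpa using h, x, hx, rfl⟩
    · have : k + 1 = n := by have := Finset.mem_range.mp hk; omega
      rw [this, hmem]
      exact Submodule.zero_mem _
  · have hin : ∀ x ∈ s, (x : E) ∈ Submodule.span ℂ S := by
      intro x hx
      rcases Nat.eq_zero_or_pos n with h | h
      · subst h
        have : (x : E) = 0 := by simpa using hmem x
        rw [this]
        exact Submodule.zero_mem _
      · refine Submodule.subset_span ?_
        simp only [hS, Set.mem_iUnion]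
        exact ⟨0, by simpa using h, x, hx, by simp⟩
    have h1 : LinearIndependent ℂ fun i : s => ((i : LinearMap.ker (A ^ n)) : E) :=
      hs.map' (LinearMap.ker (A ^ n)).subtype (Submodule.ker_subtype _)
    have h2 : LinearIndependent ℂ
        fun i : s => (⟨(i : LinearMap.ker (A ^ n)), hin i i.2⟩ : Submodule.span ℂ S) :=
      LinearIndependent.of_comp (Submodule.span ℂ S).subtype h1
    simpa using h2.fintype_card_le_finrank

variable {d : ℕ} {T L : E →L[ℂ] E} {π : E →L[ℂ] (Fin d → ℂ)} {j : (Fin d → ℂ) →L[ℂ] E}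
  {C Cinv : ℂ → E →L[ℂ] E}

theorem bijective_of_compressedDet_ne_zero {z : ℂ} (hπj : ∀ v, π (j v) = v)
    (hC : ∀ x, Cinv z (C z x) = x) (hC' : ∀ x, C z (Cinv z x) = x)
    (hB : ∀ x, π x = 0 → T x - z • L x = C z x) (hg : compressedDet T L π j Cinv z ≠ 0) :
    Function.Bijective fun x => T x - z • L x := by
  have h := bijective_of_det_compression_ne_zero (π : E →ₗ[ℂ] (Fin d → ℂ))
    (j : (Fin d → ℂ) →ₗ[ℂ] E) hπj (X := (Cinv z ∘L (T - z • L) : E →L[ℂ] E)) (fun x hx => by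
      change Cinv z (T x - z • L x) = x
      rw [hB x hx, hC]) hg
  have hbij : Function.Bijective (C z) :=
    Function.bijective_iff_has_inverse.mpr ⟨Cinv z, hC, hC'⟩
  have := hbij.comp h
  convert this using 1
  funext x
  exact (hC' _).symm

theorem isGenEigenvalue_iff_compressedDet_eq_zero {z : ℂ} (hπj : ∀ v, π (j v) = v)
    (hC : ∀ x, Cinv z (C z x) = x) (hC' : ∀ x, C z (Cinv z x) = x)
    (hB : ∀ x, π x = 0 → T x - z • L x = C z x) :
    IsGenEigenvalue T L z ↔ compressedDet T L π j Cinv z = 0 := by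
  rw [isGenEigenvalue_iff]
  constructor
  · rintro ⟨x, hx, hx0⟩
    by_contra hg
    have h := (bijective_of_compressedDet_ne_zero hπj hC hC' hB hg).1
    exact hx (h (a₁ := x) (a₂ := 0) (by simpa using hx0))
  · intro hg
    obtain ⟨x, hx, hx0⟩ := exists_ker_of_det_compression_eq_zero (π : E →ₗ[ℂ] (Fin d → ℂ))
      (j : (Fin d → ℂ) →ₗ[ℂ] E) hπj (X := (Cinv z ∘L (T - z • L) : E →L[ℂ] E)) (fun x hx => by
        change Cinv z (T x - z • L x) = x
        rw [hB x hx, hC]) hg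
    refine ⟨x, hx, ?_⟩
    have := congrArg (C z) (show Cinv z (T x - z • L x) = 0 from hx0)
    rwa [hC', map_zero] at this

/-- The algebraic multiplicity of a generalized eigenvalue is the order of vanishing of the
determinant of the compressed pencil. -/
theorem finrank_maxRootSpace_eq_order {z : ℂ} (hπj : ∀ v, π (j v) = v)
    (hC : ∀ᶠ w in 𝓝 z, ∀ x, Cinv w (C w x) = x) (hC' : ∀ᶠ w in 𝓝 z, ∀ x, C w (Cinv w x) = x)
    (hB : ∀ᶠ w in 𝓝 z, ∀ x, π x = 0 → T x - w • L x = C w x)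
    (hcts : ContinuousAt Cinv z) (hg : AnalyticAt ℂ (compressedDet T L π j Cinv) z)
    (htop : analyticOrderAt (compressedDet T L π j Cinv) z ≠ ⊤) :
    FiniteDimensional ℂ (maxRootSpace T L z) ∧
      algMult T L z = analyticOrderNatAt (compressedDet T L π j Cinv) z := by
  set g := compressedDet T L π j Cinv with hgdef
  -- g is not identically zero near z, so the pencil is bijective at nearby points other than z.
  obtain ⟨z₀, hz₀, hbij⟩ : ∃ z₀, z₀ ≠ z ∧ Function.Bijective fun x => T x - z₀ • L x := by
    have h1 : ∀ᶠ w in 𝓝[≠] z, g w ≠ 0 :=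
      hg.eventually_eq_zero_or_eventually_ne_zero.resolve_left
        fun h => htop (analyticOrderAt_eq_top.mpr h)
    obtain ⟨w, ⟨⟨⟨hw1, hw2⟩, hw3⟩, hw4⟩, hw5⟩ := ((((h1.and (nhdsWithin_le_nhds hC)).and
      (nhdsWithin_le_nhds hC')).and (nhdsWithin_le_nhds hB)).and self_mem_nhdsWithin).exists
    exact ⟨w, hw5, bijective_of_compressedDet_ne_zero hπj hw2 hw3 hw4 hw1⟩
  set ζ := z - z₀ with hζ
  have hζ0 : ζ ≠ 0 := sub_ne_zero.mpr hz₀.symm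
  set e : E ≃ₗ[ℂ] E := LinearEquiv.ofBijective ((T - z₀ • L : E →L[ℂ] E) : E →ₗ[ℂ] E) hbij with he
  have hea : ∀ x, e x = T x - z₀ • L x := fun x => rfl
  set M : E →ₗ[ℂ] E := (e.symm : E →ₗ[ℂ] E) ∘ₗ (L : E →ₗ[ℂ] E) with hM
  have hMx : ∀ x, T (M x) - z₀ • L (M x) = L x := fun x => e.apply_symm_apply (L x)
  have hinj : ∀ x, T x - z₀ • L x = 0 → x = 0 := fun x hx =>
    hbij.1 (a₁ := x) (a₂ := 0) (by simpa using hx)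
  set A : Module.End ℂ E := 1 - ζ • M with hA
  have hAx : ∀ x, A x = x - ζ • M x := fun x => rfl
  have hroot : ∀ n, rootSpace T L z n = LinearMap.ker (A ^ n) := rootSpace_eq_ker_pow M hinj hMx
  -- invariant subspaces
  have hfac : ∀ (N : Submodule ℂ E) (_ : FiniteDimensional ℂ N) (n : ℕ),
      N ≤ LinearMap.ker (A ^ n) → (∀ x ∈ N, A x ∈ N) → ∃ u : ℂ → ℂ, ContinuousAt u z ∧
      (∀ᶠ w in 𝓝 z, g w = u w * (w - z) ^ Module.finrank ℂ N) ∧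
      ((∀ R : E →L[ℂ] N, (∀ x : N, R x = x) →
        ∀ x, T (x - R x) - z • L (x - R x) + (T (R x) - z₀ • L (R x)) = 0 → x = 0) →
        u z ≠ 0) := by
    intro N hN n hNn hNA
    have hNM : ∀ x ∈ N, M x ∈ N := by
      intro x hx
      have : M x = ζ⁻¹ • (x - A x) := by
        rw [hAx, sub_sub_cancel, inv_smul_smul₀ hζ0]
      rw [this]
      exact N.smul_mem _ (N.sub_mem hx (hNA x hx))
    set MN : N →ₗ[ℂ] N := M.restrict hNM with hMN
    obtain ⟨u, hu, hgu, hu0⟩ := exists_compressedDet_factor (z₀ := z₀) hπj hC hB hcts N MN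
      (fun x => (hMx x).symm)
    set AN : Module.End ℂ N := A.restrict hNA with hAN
    have hnil : IsNilpotent AN := by
      refine ⟨n, ?_⟩
      ext x
      rw [hAN, Module.End.pow_restrict]
      exact hNn x.2
    have hMA : MN = ζ⁻¹ • (1 - AN) := by
      ext x
      change M x = ζ⁻¹ • ((x : E) - A x)
      rw [hAx, sub_sub_cancel, inv_smul_smul₀ hζ0]
    -- On N the map A is nilpotent, so M has the single eigenvalue 1/ζ and 1 - (w - z₀)M has the
    -- single eigenvalue -(w - z)/ζ.
    have hdet : ∀ w, LinearMap.det (LinearMap.id - (w - z₀) • MN) =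
        (-ζ⁻¹) ^ Module.finrank ℂ N * (w - z) ^ Module.finrank ℂ N := by
      intro w
      have h1 : LinearMap.id - (w - z₀) • MN = (-ζ⁻¹ * (w - z)) • LinearMap.id -
          (-((w - z₀) * ζ⁻¹)) • AN := by
        have h2 : (-ζ⁻¹ * (w - z)) = 1 - (w - z₀) * ζ⁻¹ := by
          field_simp
          rw [hζ]; ring
        rw [h2, hMA]
        ext x
        simp only [LinearMap.sub_apply, LinearMap.smul_apply, LinearMap.id_apply,
          Module.End.one_apply]
        congr 1
        module
      rw [h1, det_smul_id_sub_of_isNilpotent _ (hnil.smul _), mul_pow]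
    refine ⟨fun w => u w * (-ζ⁻¹) ^ Module.finrank ℂ N, hu.mul continuousAt_const, ?_, ?_⟩
    · filter_upwards [hgu] with w hw
      rw [hgdef, hw, hdet, mul_assoc]
    · intro h
      exact mul_ne_zero (hu0 h hC'.self_of_nhds)
        (pow_ne_zero _ (neg_ne_zero.mpr (inv_ne_zero hζ0)))
  have hle : ∀ (N : Submodule ℂ E) (_ : FiniteDimensional ℂ N) (n : ℕ),
      N ≤ LinearMap.ker (A ^ n) → (∀ x ∈ N, A x ∈ N) →
      Module.finrank ℂ N ≤ analyticOrderNatAt g z := by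
    intro N hN n hNn hNA
    obtain ⟨u, hu, hgu, -⟩ := hfac N hN n hNn hNA
    have := natCast_le_analyticOrderAt_of_eq_mul hg hu hgu
    rw [← Nat.cast_analyticOrderNatAt htop] at this
    exact_mod_cast this
  have hrank : ∀ n, Module.rank ℂ (LinearMap.ker (A ^ n)) ≤ (analyticOrderNatAt g z : ℕ) := by
    intro n
    refine rank_le fun s hs => ?_
    obtain ⟨N, hN, hNn, hNA, hcard⟩ := exists_invariant_of_card s hs
    exact hcard.trans (hle N hN n hNn hNA)
  have hfd : ∀ n, FiniteDimensional ℂ (LinearMap.ker (A ^ n)) := fun n =>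
    Module.rank_lt_aleph0_iff.mp ((hrank n).trans_lt (Cardinal.natCast_lt_aleph0))
  have hkerA : ∀ n, ∀ x ∈ LinearMap.ker (A ^ n), A x ∈ LinearMap.ker (A ^ n) := by
    intro n x hx
    rw [LinearMap.mem_ker] at hx ⊢
    rw [← Module.End.mul_apply, ← pow_succ, pow_succ', Module.End.mul_apply, hx, map_zero]
  have hmono : ∀ {n m}, n ≤ m → LinearMap.ker (A ^ n) ≤ LinearMap.ker (A ^ m) := by
    intro n m hnm x hx
    rw [LinearMap.mem_ker] at hx ⊢
    rw [← Nat.sub_add_cancel hnm, pow_add, Module.End.mul_apply, hx, map_zero]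
  -- The increasing kernels have bounded dimension, so they are exhausted by one of them.
  obtain ⟨n₀, hn₀⟩ : ∃ n₀, ∀ n, Module.finrank ℂ (LinearMap.ker (A ^ n)) ≤
      Module.finrank ℂ (LinearMap.ker (A ^ n₀)) := by
    have hb : BddAbove (Set.range fun n => Module.finrank ℂ (LinearMap.ker (A ^ n))) := by
      refine ⟨analyticOrderNatAt g z, ?_⟩
      rintro _ ⟨n, rfl⟩
      exact hle _ (hfd n) n le_rfl (hkerA n)
    obtain ⟨n₀, hn₀⟩ := Nat.sSup_mem (Set.range_nonempty _) hb
    refine ⟨n₀, fun n => ?_⟩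
    refine (le_csSup hb ⟨n, rfl⟩).trans hn₀.ge
  have hstab : ∀ n, LinearMap.ker (A ^ n) ≤ LinearMap.ker (A ^ n₀) := by
    intro n
    rcases le_total n n₀ with h | h
    · exact hmono h
    · have := hfd n
      exact (Submodule.eq_of_le_of_finrank_le (hmono h) (hn₀ n)).ge
  have hmax : maxRootSpace T L z = LinearMap.ker (A ^ n₀) := by
    rw [maxRootSpace]
    refine le_antisymm (iSup_le fun n => (hroot n).trans_le (hstab n)) ?_
    exact (hroot n₀).symm.trans_le (le_iSup (fun n => rootSpace T L z n) n₀)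
  rw [algMult, hmax]
  refine ⟨hfd n₀, ?_⟩
  have := hfd n₀
  obtain ⟨u, hu, hgu, hu0⟩ := hfac _ (hfd n₀) n₀ le_rfl (hkerA n₀)
  refine (analyticOrderAt_eq_of_eq_mul hg htop hu hgu (hu0 ?_)).symm
  -- With y = x - Rx, the relation becomes Ay + Rx = 0. Thus Ay lies in the stabilized kernel, hence
  -- so does y; but Ry = 0, so y = 0, and then Rx = 0.
  intro R hR x hx
  have hBA : ∀ x, T x - z • L x = T (A x) - z₀ • L (A x) :=
    fun x => pencil_shift M hMx x
  set y : E := x - (R x : E) with hy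
  have h1 : A y + R x = 0 := by
    apply hinj
    rw [hBA] at hx
    rw [map_add, map_add, smul_add, ← hx]
    abel
  have h2 : A y ∈ LinearMap.ker (A ^ n₀) := by
    rw [eq_neg_of_add_eq_zero_left h1]
    exact Submodule.neg_mem _ (R x).2
  have h3 : y ∈ LinearMap.ker (A ^ n₀) := by
    apply hstab (n₀ + 1)
    rw [LinearMap.mem_ker, pow_succ, Module.End.mul_apply]
    exact h2
  have h4 : R y = 0 := by rw [hy, map_sub, hR, sub_self]
  have h5 : y = 0 := by
    have := hR ⟨y, h3⟩
    rw [h4] at this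
    exact (congrArg Subtype.val this).symm
  rw [h5, map_zero, zero_add] at h1
  rw [h5, h1, eq_comm, sub_zero] at hy
  exact hy

end RootSpace

end ChebSpec

end

noncomputable section

namespace ChebSpec

open Filter Topology

/-! ### Coordinates, completeness and columnwise norm bounds. -/

section Coordinates

variable {𝕜 : Type} [RCLike 𝕜]

theorem sub_apply (U V : Ell1 𝕜) (n : ℕ) : (U - V) n = U n - V n := rfl

theorem sum_apply {ι : Type} (s : Finset ι) (f : ι → Ell1 𝕜) (n : ℕ) :
    (∑ i ∈ s, f i) n = ∑ i ∈ s, f i n := by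
  exact map_sum (coord 𝕜 n) f s

theorem unitSeq_apply (k n : ℕ) : unitSeq 𝕜 k n = if n = k then 1 else 0 := by
  change (Pi.single k 1 : ℕ → 𝕜) n = _
  rw [Pi.single_apply]

theorem norm_unitSeq (k : ℕ) : ‖unitSeq 𝕜 k‖ = xi k := by
  rw [norm_def, tsum_eq_single k]
  · simp [unitSeq_apply]
  · intro n hn
    simp [unitSeq_apply, hn]

/-- Multiplying the n-th coordinate by `xi n` is an isometry onto the unweighted ℓ¹. Completeness is
needed for Neumann inverses of operators. -/
instance : CompleteSpace (Ell1 𝕜) := by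
  let f : Ell1 𝕜 → lp (fun _ : ℕ => 𝕜) 1 := fun U => ⟨fun n => ((xi n : ℝ) : 𝕜) * U n, by
    refine memℓp_gen ?_
    simp only [ENNReal.toReal_one, Real.rpow_one, norm_mul, RCLike.norm_ofReal,
      abs_of_pos (xi_pos _)]
    exact summable_weighted U⟩
  have hf : Isometry f := by
    refine Isometry.of_dist_eq fun U V => ?_
    rw [dist_eq_norm, dist_eq_norm, lp.norm_eq_tsum_rpow (by simp), norm_def]
    simp only [ENNReal.toReal_one, Real.rpow_one, div_one]
    refine tsum_congr fun n => ?_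
    have : (f U - f V : lp (fun _ : ℕ => 𝕜) 1) n = ((xi n : ℝ) : 𝕜) * (U - V) n := by
      rw [sub_apply, mul_sub]; rfl
    rw [this, norm_mul, RCLike.norm_ofReal, abs_of_pos (xi_pos _)]
  have hsurj : Function.Surjective f := by
    intro g
    have hg : Summable fun n => ‖(g : ∀ _ : ℕ, 𝕜) n‖ := by
      have := (lp.memℓp g).summable (by simp)
      simpa using this
    have hx : ∀ n, ((xi n : ℝ) : 𝕜) ≠ 0 := fun n => by
      simpa using (xi_pos n).ne'
    refine ⟨Ell1.ofSeq (fun n => ((xi n : ℝ) : 𝕜)⁻¹ * g n) ?_, ?_⟩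
    · refine Summable.of_nonneg_of_le (fun _ => norm_nonneg _) (fun n => ?_) hg
      rw [norm_mul, norm_inv, RCLike.norm_ofReal, abs_of_pos (xi_pos _)]
      exact mul_le_of_le_one_left (norm_nonneg _) (inv_le_one_of_one_le₀ (one_le_xi n))
    · ext n
      change ((xi n : ℝ) : 𝕜) * (((xi n : ℝ) : 𝕜)⁻¹ * g n) = g n
      rw [mul_inv_cancel_left₀ (hx n)]
  exact (hf.isUniformInducing.completeSpace_congr hsurj).mpr inferInstance

theorem hasSum_unitSeq (U : Ell1 𝕜) : HasSum (fun k => U k • unitSeq 𝕜 k) U := by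
  have hs := (summable_weighted U).hasSum
  rw [← norm_def] at hs
  have h0 := (hs.tendsto_sum_nat.const_sub ‖U‖)
  rw [sub_self] at h0
  have hsum : Summable fun k => ‖U k • unitSeq 𝕜 k‖ := by
    refine (summable_weighted U).congr fun k => ?_
    rw [norm_smul, norm_unitSeq, mul_comm]
  have hpart : ∀ n, ‖U - ∑ k ∈ Finset.range n, U k • unitSeq 𝕜 k‖ =
      ‖U‖ - ∑ k ∈ Finset.range n, xi k * ‖U k‖ := by
    intro n
    rw [norm_def, norm_def, ← (summable_weighted U).sum_add_tsum_nat_add n,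
      ← (summable_weighted (U - ∑ k ∈ Finset.range n, U k • unitSeq 𝕜 k)).sum_add_tsum_nat_add n]
    have hc : ∀ i, (U - ∑ k ∈ Finset.range n, U k • unitSeq 𝕜 k) i = if i < n then 0 else U i := by
      intro i
      rw [sub_apply, sum_apply]
      simp only [smul_apply, unitSeq_apply, mul_ite, mul_one, mul_zero, Finset.sum_ite_eq,
        Finset.mem_range]
      split_ifs <;> simp
    rw [Finset.sum_eq_zero]
    · simp only [hc, add_lt_iff_neg_right, not_lt_zero, if_false, zero_add]
      ring
    · intro i hi
      rw [hc, if_pos (Finset.mem_range.mp hi)]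
      simp
  have hlim : Tendsto (fun n => ∑ k ∈ Finset.range n, U k • unitSeq 𝕜 k) atTop (𝓝 U) := by
    rw [tendsto_iff_norm_sub_tendsto_zero]
    refine h0.congr fun n => ?_
    rw [norm_sub_rev, hpart]
  have h1 := hsum.of_norm.hasSum
  rwa [tendsto_nhds_unique h1.tendsto_sum_nat hlim] at h1

/-- In a weighted ℓ¹ norm an operator is controlled by its columns. Only columns met by the support
of U matter, which is how bounds for high modes enter. -/
theorem norm_apply_le_of_unitSeq {F : Type*} [NormedAddCommGroup F] [NormedSpace 𝕜 F]
    (T : Ell1 𝕜 →L[𝕜] F) {c : ℝ} (U : Ell1 𝕜)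
    (h : ∀ k, U k ≠ 0 → ‖T (unitSeq 𝕜 k)‖ ≤ c * xi k) : ‖T U‖ ≤ c * ‖U‖ := by
  have h1 : HasSum (fun k => T (U k • unitSeq 𝕜 k)) (T U) := (hasSum_unitSeq U).mapL T
  rw [norm_def, ← tsum_mul_left, ← h1.tsum_eq]
  refine tsum_of_norm_bounded ((summable_weighted U).mul_left c).hasSum fun k => ?_
  rw [map_smul, norm_smul]
  by_cases hk : U k = 0
  · simp [hk]
  · nlinarith [h k hk, norm_nonneg (U k)]

end Coordinates

/-! ### Finite sections -/

section Sections

variable (𝕜 : Type) [RCLike 𝕜] (n : ℕ)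

/-- The first `n` coordinates. -/
def res : Ell1 𝕜 →L[𝕜] (Fin n → 𝕜) := ContinuousLinearMap.pi fun k => coord 𝕜 k

/-- The inclusion of the finite sequences of length `n`. -/
def emb : (Fin n → 𝕜) →L[𝕜] Ell1 𝕜 :=
  ∑ k : Fin n, (ContinuousLinearMap.proj k).smulRight (unitSeq 𝕜 k)

variable {𝕜 n}

theorem res_apply (U : Ell1 𝕜) (k : Fin n) : res 𝕜 n U k = U k := rfl

theorem emb_eq (v : Fin n → 𝕜) : emb 𝕜 n v = ∑ k : Fin n, v k • unitSeq 𝕜 k := by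
  simp [emb]

theorem emb_apply (v : Fin n → 𝕜) (k : ℕ) :
    emb 𝕜 n v k = if h : k < n then v ⟨k, h⟩ else 0 := by
  rw [emb_eq, sum_apply]
  simp only [smul_apply, unitSeq_apply, mul_ite, mul_one, mul_zero]
  split_ifs with h
  · rw [Finset.sum_eq_single ⟨k, h⟩]
    · simp
    · intro c _ hc
      rw [if_neg]
      rintro rfl
      exact hc rfl
    · simp
  · refine Finset.sum_eq_zero fun c _ => ?_
    rw [if_neg]
    rintro rfl
    exact h c.2

theorem res_emb (v : Fin n → 𝕜) : res 𝕜 n (emb 𝕜 n v) = v := by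
  funext k
  rw [res_apply, emb_apply, dif_pos k.2]

theorem emb_single (k : Fin n) : emb 𝕜 n (Pi.single k 1) = unitSeq 𝕜 k := by
  rw [emb_eq, Finset.sum_eq_single k]
  · simp
  · intro c _ hc; simp [hc]
  · simp

theorem finOp_apply (M : Matrix (Fin n) (Fin n) 𝕜) (U : Ell1 𝕜) :
    finOp M U = emb 𝕜 n (M.mulVec (res 𝕜 n U)) := by
  rw [emb_eq]
  simp only [finOp, _root_.sum_apply, Matrix.mulVec, dotProduct]
  refine Finset.sum_congr rfl fun k _ => ?_
  rw [Finset.sum_smul]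
  refine Finset.sum_congr rfl fun c _ => ?_
  rw [mul_smul]
  rfl

theorem projLE_eq (N : ℕ) (U : Ell1 𝕜) : projLE 𝕜 N U = emb 𝕜 (N + 1) (res 𝕜 (N + 1) U) := by
  rw [emb_eq]
  simp only [projLE, _root_.sum_apply, Finset.sum_range]
  rfl

theorem projLE_apply (N : ℕ) (U : Ell1 𝕜) (k : ℕ) :
    projLE 𝕜 N U k = if k ≤ N then U k else 0 := by
  rw [projLE_eq, emb_apply]
  simp only [Nat.lt_succ_iff, res_apply]
  split_ifs <;> rfl

theorem projGT_apply (N : ℕ) (U : Ell1 𝕜) (k : ℕ) :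
    projGT 𝕜 N U k = if k ≤ N then 0 else U k := by
  have : projGT 𝕜 N U k = U k - projLE 𝕜 N U k := rfl
  rw [this, projLE_apply]
  split_ifs <;> simp

theorem finOp_mul (M M' : Matrix (Fin n) (Fin n) 𝕜) :
    finOp (M * M') = finOp M ∘L finOp M' := by
  ext1 U
  rw [ContinuousLinearMap.comp_apply, finOp_apply, finOp_apply, finOp_apply, res_emb,
    Matrix.mulVec_mulVec]

theorem finOp_add (M M' : Matrix (Fin n) (Fin n) 𝕜) : finOp (M + M') = finOp M + finOp M' := by
  ext1 U
  rw [_root_.add_apply, finOp_apply, finOp_apply, finOp_apply, Matrix.add_mulVec, map_add]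

theorem finOp_smul (c : 𝕜) (M : Matrix (Fin n) (Fin n) 𝕜) : finOp (c • M) = c • finOp M := by
  ext1 U
  rw [_root_.smul_apply, finOp_apply, finOp_apply, Matrix.smul_mulVec, map_smul]

theorem finOp_sub (M M' : Matrix (Fin n) (Fin n) 𝕜) : finOp (M - M') = finOp M - finOp M' := by
  ext1 U
  rw [_root_.sub_apply, finOp_apply, finOp_apply, finOp_apply, Matrix.sub_mulVec, map_sub]

theorem finOp_one (N : ℕ) : finOp (1 : Matrix (Fin (N + 1)) (Fin (N + 1)) 𝕜) = projLE 𝕜 N := by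
  ext1 U
  rw [finOp_apply, projLE_eq, Matrix.one_mulVec]

theorem mulVec_sectionMatrix (N : ℕ) (T : Ell1 𝕜 →L[𝕜] Ell1 𝕜) (v : Fin (N + 1) → 𝕜) :
    (sectionMatrix N T).mulVec v = res 𝕜 (N + 1) (T (emb 𝕜 (N + 1) v)) := by
  funext k
  rw [res_apply, emb_eq, map_sum, sum_apply]
  simp only [Matrix.mulVec, dotProduct, sectionMatrix, Matrix.of_apply, map_smul, smul_apply]
  exact Finset.sum_congr rfl fun c _ => mul_comm _ _

theorem finOp_sectionMatrix (N : ℕ) (T : Ell1 𝕜 →L[𝕜] Ell1 𝕜) :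
    finOp (sectionMatrix N T) = projLE 𝕜 N ∘L T ∘L projLE 𝕜 N := by
  ext1 U
  rw [finOp_apply, mulVec_sectionMatrix, ContinuousLinearMap.comp_apply,
    ContinuousLinearMap.comp_apply, projLE_eq, projLE_eq]

theorem sectionMatrix_finOp (N : ℕ) (M : Matrix (Fin (N + 1)) (Fin (N + 1)) 𝕜) :
    sectionMatrix N (finOp M) = M := by
  refine Matrix.ext_iff_mulVec.mpr fun v => ?_
  rw [mulVec_sectionMatrix, finOp_apply, res_emb, res_emb]

theorem norm_emb (v : Fin n → 𝕜) : ‖emb 𝕜 n v‖ = ∑ k : Fin n, xi k * ‖v k‖ := by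
  rw [norm_def, tsum_eq_sum (s := Finset.range n)]
  · rw [Finset.sum_range]
    refine Finset.sum_congr rfl fun k _ => ?_
    rw [emb_apply, dif_pos k.2]
  · intro k hk
    rw [emb_apply, dif_neg (by simpa using hk)]
    simp

theorem norm_emb_mulVec_le (M : Matrix (Fin n) (Fin n) 𝕜) (v : Fin n → 𝕜) :
    ‖emb 𝕜 n (M.mulVec v)‖ ≤ ‖finOp M‖ * ∑ k : Fin n, xi k * ‖v k‖ := by
  rw [← norm_emb]
  have := (finOp M).le_opNorm (emb 𝕜 n v)
  rwa [finOp_apply, res_emb] at this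

theorem mul_norm_le_norm_emb_diagonal {a : Fin n → 𝕜} {c : ℝ} (h : ∀ k, c ≤ ‖a k‖)
    (v : Fin n → 𝕜) : c * ‖emb 𝕜 n v‖ ≤ ‖emb 𝕜 n ((Matrix.diagonal a).mulVec v)‖ := by
  rw [norm_emb, norm_emb, Finset.mul_sum]
  refine Finset.sum_le_sum fun k _ => ?_
  rw [Matrix.mulVec_diagonal, norm_mul]
  nlinarith [mul_nonneg (xi_pos k).le (norm_nonneg (v k)), h k]

theorem emb_injective : Function.Injective (emb 𝕜 n) := fun v w h => by
  rw [← res_emb v, h, res_emb]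

end Sections

end ChebSpec

end

noncomputable section

namespace ChebSpec

open Filter Topology

/-! ### The Banach algebra structure -/

section Algebra

variable {𝕜 : Type} [RCLike 𝕜]

/-- The weights 1, 2, 2, … turn the norm into the ℓ¹(ℤ) norm of the even extension, for which `conv`
is ordinary convolution; submultiplicativity follows. -/
theorem norm_eq_tsum_int (U : Ell1 𝕜) : ‖U‖ = ∑' k : ℤ, ‖U k.natAbs‖ := by
  have h0 := summable_norm U
  have h1 : Summable fun n => ‖U (n + 1)‖ := (summable_nat_add_iff 1).mpr h0
  have h := HasSum.of_nat_of_neg_add_one (f := fun k : ℤ => ‖U k.natAbs‖)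
    (by simpa using h0.hasSum) (m' := ∑' n, ‖U (n + 1)‖) (by
      refine h1.hasSum.congr_fun ?_ |> fun h => h
      intro n
      congr 2)
  rw [h.tsum_eq, norm_def, (summable_weighted U).tsum_eq_zero_add, h0.tsum_eq_zero_add]
  have : ∀ n, xi (n + 1) * ‖U (n + 1)‖ = 2 * ‖U (n + 1)‖ := fun n => by simp [xi]
  simp only [this, tsum_mul_left]
  simp [xi]
  ring

theorem convSeq_natAbs (U V : ℕ → 𝕜) (n : ℤ) :
    convSeq U V n.natAbs = ∑' k : ℤ, U k.natAbs * V (n - k).natAbs := by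
  rw [convSeq]
  rcases Int.natAbs_eq n with h | h
  · rw [← h]
  · rw [← (Equiv.neg ℤ).tsum_eq]
    refine tsum_congr fun k => ?_
    simp only [Equiv.neg_apply, Int.natAbs_neg]
    rw [show ((n.natAbs : ℤ) - -k) = -(n - k) by omega, Int.natAbs_neg]

theorem conv_apply_natAbs (U V : Ell1 𝕜) (n : ℤ) :
    conv U V n.natAbs = ∑' k : ℤ, U k.natAbs * V (n - k).natAbs := convSeq_natAbs _ _ n

theorem conv_apply (U V : Ell1 𝕜) (n : ℕ) :
    conv U V n = ∑' k : ℤ, U k.natAbs * V ((n : ℤ) - k).natAbs := rfl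

theorem summable_int (U : Ell1 𝕜) : Summable fun k : ℤ => ‖U k.natAbs‖ :=
  summable_natAbs (summable_norm U)

theorem summable_conv_term (U V : Ell1 𝕜) (n : ℤ) :
    Summable fun k : ℤ => ‖U k.natAbs * V (n - k).natAbs‖ := by
  refine Summable.of_nonneg_of_le (fun _ => norm_nonneg _) (fun k => ?_)
    ((summable_int U).mul_right ‖V‖)
  rw [norm_mul]
  exact mul_le_mul_of_nonneg_left (norm_coord_le V _) (norm_nonneg _)

/-- The shear `(n, k) ↦ (k, n - k)`. -/
def shear : ℤ × ℤ ≃ ℤ × ℤ where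
  toFun p := (p.2, p.1 - p.2)
  invFun p := (p.1 + p.2, p.1)
  left_inv p := by ext <;> simp
  right_inv p := by ext <;> simp

theorem summable_shear (U V : Ell1 𝕜) :
    Summable fun p : ℤ × ℤ => ‖U p.2.natAbs‖ * ‖V (p.1 - p.2).natAbs‖ := by
  have hp : Summable fun p : ℤ × ℤ => ‖U p.1.natAbs‖ * ‖V p.2.natAbs‖ :=
    (summable_int U).mul_of_nonneg (summable_int V) (fun _ => norm_nonneg _)
      (fun _ => norm_nonneg _)
  exact (shear.summable_iff (f := fun p : ℤ × ℤ => ‖U p.1.natAbs‖ * ‖V p.2.natAbs‖)).mpr hp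

theorem norm_conv_le (U V : Ell1 𝕜) : ‖conv U V‖ ≤ ‖U‖ * ‖V‖ := by
  have hp : Summable fun p : ℤ × ℤ => ‖U p.1.natAbs‖ * ‖V p.2.natAbs‖ :=
    (summable_int U).mul_of_nonneg (summable_int V) (fun _ => norm_nonneg _)
      (fun _ => norm_nonneg _)
  have h1 : ‖U‖ * ‖V‖ = ∑' n : ℤ, ∑' k : ℤ, ‖U k.natAbs‖ * ‖V (n - k).natAbs‖ := by
    rw [norm_eq_tsum_int, norm_eq_tsum_int, (summable_int U).tsum_mul_tsum (summable_int V) hp,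
      ← shear.tsum_eq, ← (summable_shear U V).tsum_prod]
    rfl
  rw [h1, norm_eq_tsum_int]
  refine (summable_int (conv U V)).tsum_le_tsum (fun n => ?_) (summable_shear U V).prod
  rw [conv_apply_natAbs]
  refine (norm_tsum_le_tsum_norm (summable_conv_term U V n)).trans_eq ?_
  exact tsum_congr fun k => norm_mul _ _

theorem conv_comm (U V : Ell1 𝕜) : conv U V = conv V U := by
  refine Ell1.ext fun n => ?_
  rw [conv_apply, conv_apply, ← (Equiv.subLeft (n : ℤ)).tsum_eq]
  refine tsum_congr fun k => ?_
  rw [Equiv.subLeft_apply, sub_sub_cancel, mul_comm]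

theorem conv_add (U V W : Ell1 𝕜) : conv U (V + W) = conv U V + conv U W := by
  refine Ell1.ext fun n => ?_
  rw [add_apply, conv_apply, conv_apply, conv_apply,
    ← (summable_conv_term U V n).of_norm.tsum_add (summable_conv_term U W n).of_norm]
  exact tsum_congr fun k => by rw [add_apply, mul_add]

theorem conv_smul (c : 𝕜) (U V : Ell1 𝕜) : conv U (c • V) = c • conv U V := by
  refine Ell1.ext fun n => ?_
  rw [smul_apply, conv_apply, conv_apply, ← tsum_mul_left]
  exact tsum_congr fun k => by rw [smul_apply]; ring

theorem conv_unitSeq_zero (U : Ell1 𝕜) : conv U (unitSeq 𝕜 0) = U := by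
  refine Ell1.ext fun n => ?_
  rw [conv_apply, tsum_eq_single (n : ℤ)]
  · simp [unitSeq_apply]
  · intro k hk
    have : ((n : ℤ) - k).natAbs ≠ 0 := by omega
    simp [unitSeq_apply, this]

theorem summable_triple (U V W : Ell1 𝕜) (n : ℤ) : Summable fun p : ℤ × ℤ =>
    U p.2.natAbs * V (p.1 - p.2).natAbs * W (n - p.1).natAbs := by
  refine Summable.of_norm_bounded ((summable_shear U V).mul_right ‖W‖) fun p => ?_
  rw [norm_mul, norm_mul]
  exact mul_le_mul_of_nonneg_left (norm_coord_le W _)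
    (mul_nonneg (norm_nonneg _) (norm_nonneg _))

theorem conv_assoc (U V W : Ell1 𝕜) : conv (conv U V) W = conv U (conv V W) := by
  refine Ell1.ext fun n => ?_
  rw [conv_apply, conv_apply]
  have h1 : ∀ k : ℤ, conv U V k.natAbs * W ((n : ℤ) - k).natAbs =
      ∑' l : ℤ, U l.natAbs * V (k - l).natAbs * W ((n : ℤ) - k).natAbs := by
    intro k
    rw [conv_apply_natAbs, tsum_mul_right]
  have h2 : ∀ l : ℤ, U l.natAbs * conv V W ((n : ℤ) - l).natAbs =
      ∑' k : ℤ, U l.natAbs * V (k - l).natAbs * W ((n : ℤ) - k).natAbs := by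
    intro l
    rw [conv_apply_natAbs, ← tsum_mul_left, ← (Equiv.subRight l).tsum_eq]
    refine tsum_congr fun k => ?_
    rw [Equiv.subRight_apply, mul_assoc, sub_sub_sub_cancel_right]
  rw [tsum_congr h1, tsum_congr h2]
  exact Summable.tsum_comm
    (f := fun l k : ℤ => U l.natAbs * V (k - l).natAbs * W ((n : ℤ) - k).natAbs)
    ((Equiv.prodComm ℤ ℤ).summable_iff.mpr (summable_triple U V W n))

/-- The convolution algebra. -/
@[reducible] def convRing : NormedCommRing (Ell1 𝕜) :=
  { (inferInstance : NormedAddCommGroup (Ell1 𝕜)) with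
    mul := conv
    one := unitSeq 𝕜 0
    left_distrib := conv_add
    right_distrib := fun U V W => by
      change conv (U + V) W = conv U W + conv V W
      rw [conv_comm, conv_add, conv_comm W, conv_comm W]
    zero_mul := fun U => by
      change conv 0 U = 0
      rw [conv_comm, ← zero_smul 𝕜 U, conv_smul, zero_smul, zero_smul]
    mul_zero := fun U => by
      change conv U 0 = 0
      rw [← zero_smul 𝕜 U, conv_smul, zero_smul, zero_smul]
    mul_assoc := conv_assoc
    one_mul := fun U => by
      change conv (unitSeq 𝕜 0) U = U
      rw [conv_comm, conv_unitSeq_zero]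
    mul_one := conv_unitSeq_zero
    mul_comm := conv_comm
    norm_mul_le := norm_conv_le }

attribute [local instance] convRing

/-- Scalar multiplication on the convolution algebra. -/
@[reducible] def convAlgebra : NormedAlgebra 𝕜 (Ell1 𝕜) :=
  { Algebra.ofModule
      (fun c U V => by
        change conv (c • U) V = c • conv U V
        rw [conv_comm, conv_smul, conv_comm])
      (fun c U V => conv_smul c U V) with
    norm_smul_le := fun c U => (norm_smul c U).le }

attribute [local instance] convAlgebra

theorem mul_eq_conv (U V : Ell1 𝕜) : U * V = conv U V := rfl

theorem convPow_eq_pow (U : Ell1 𝕜) (n : ℕ) : convPow U n = U ^ n := by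
  induction n with
  | zero => exact (pow_zero U).symm
  | succ n ih => rw [convPow, ih, pow_succ', mul_eq_conv]

theorem convProd_eq_prod (l : List (Ell1 𝕜)) : convProd l = l.prod := by
  induction l with
  | nil => rfl
  | cons U l ih =>
    rw [List.prod_cons, ← ih]
    rfl

/-- The coefficient `V_i` in `DK(U) W = ∑_i V_i * K_i W`, for both scalar fields. -/
def BVP.Vk (P : BVP) (U : Ell1 𝕜) (i : Fin (2 * P.m)) : Ell1 𝕜 :=
  (P.expo i : 𝕜) • conv (convPow (P.Kop 𝕜 (i : ℕ) U) (P.expo i - 1))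
    (convProd (((List.finRange (2 * P.m)).filter (fun l => l ≠ i)).map
      fun l : Fin (2 * P.m) => convPow (P.Kop 𝕜 (l : ℕ) U) (P.expo l)))

/-- Product and power rules in the commutative Banach algebra, since each `Kop` is linear and
continuous. -/
theorem BVP.hasFDerivAt_K (P : BVP) (U : Ell1 𝕜) :
    ∃ D : Ell1 𝕜 →L[𝕜] Ell1 𝕜, HasFDerivAt (P.K 𝕜) D U ∧
      ∀ W, D W = ∑ i : Fin (2 * P.m), conv (P.Vk U i) (P.Kop 𝕜 (i : ℕ) W) := by
  have hK : P.K 𝕜 = fun U => ∏ i : Fin (2 * P.m), (P.Kop 𝕜 (i : ℕ) U) ^ P.expo i := by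
    funext U
    rw [K, convProd_eq_prod, ← List.prod_ofFn, List.ofFn_eq_map]
    simp only [convPow_eq_pow]
  have hd : ∀ i : Fin (2 * P.m), HasFDerivAt (fun U => (P.Kop 𝕜 (i : ℕ) U) ^ P.expo i)
      ((P.expo i • (P.Kop 𝕜 (i : ℕ) U) ^ (P.expo i - 1)) • P.Kop 𝕜 (i : ℕ)) U :=
    fun i => (P.Kop 𝕜 (i : ℕ)).hasFDerivAt.pow (P.expo i)
  refine ⟨_, hK ▸ HasFDerivAt.finsetProd fun i _ => hd i, fun W => ?_⟩
  rw [_root_.sum_apply]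
  refine Finset.sum_congr rfl fun i _ => ?_
  have hprod : ∏ l ∈ Finset.univ.erase i, (P.Kop 𝕜 (l : ℕ) U) ^ P.expo l =
      convProd (((List.finRange (2 * P.m)).filter (fun l => l ≠ i)).map
        fun l : Fin (2 * P.m) => convPow (P.Kop 𝕜 (l : ℕ) U) (P.expo l)) := by
    rw [convProd_eq_prod]
    simp only [convPow_eq_pow]
    rw [← List.prod_toFinset _ ((List.nodup_finRange _).filter _)]
    refine Finset.prod_congr ?_ fun _ _ => rfl
    ext l
    simp
  change (∏ l ∈ Finset.univ.erase i, (P.Kop 𝕜 (l : ℕ) U) ^ P.expo l) *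
    ((P.expo i • (P.Kop 𝕜 (i : ℕ) U) ^ (P.expo i - 1)) * P.Kop 𝕜 (i : ℕ) W) = _
  rw [hprod, Vk, ← mul_eq_conv, ← mul_eq_conv, convPow_eq_pow, Nat.cast_smul_eq_nsmul]
  simp only [nsmul_eq_mul]
  ring

end Algebra

end ChebSpec

end

noncomputable section

namespace ChebSpec

open Filter Topology

/-! ### Iterated antiderivatives of high modes -/

section Gam

/-- The product over the odd factors in `gam`. -/
def oddProd (q : ℕ) (x : ℝ) : ℝ := ∏ j ∈ Finset.range (q + 1), 1 / (x ^ 2 - (2 * (j : ℝ) + 1) ^ 2)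

/-- The product over the even factors in `gam`. -/
def evenProd (q : ℕ) (x : ℝ) : ℝ := ∏ j ∈ Finset.range q, 1 / (x ^ 2 - (2 * (j : ℝ) + 2) ^ 2)

theorem gam_even (q k : ℕ) : gam (2 * q) k = evenProd q k := by
  rw [gam, if_pos (even_two_mul q), Nat.mul_div_cancel_left q two_pos, evenProd]
  induction q with
  | zero => simp
  | succ q ih =>
    rw [Finset.prod_Icc_succ_top (by omega), ih, Finset.prod_range_succ]
    push_cast
    ring

theorem gam_odd (q k : ℕ) : gam (2 * q + 1) k = k * oddProd q k := by
  rw [gam, if_neg (by simp), oddProd, show (2 * q + 1) / 2 = q by omega]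

/-- Shifting x by one gives (x + 1)² - (2j + 2)² = (x - (2j + 1))(x + (2j + 3)), so the factors
regroup into those of `oddProd` and a single end factor remains. The three companions below work the
same way. -/
theorem evenProd_add_one (q : ℕ) {x : ℝ} (hx : 2 * q + 1 < x) :
    evenProd q (x + 1) / (x + 1) = (x - (2 * q + 1)) * oddProd q x := by
  induction q with
  | zero =>
    have h1 : x + 1 ≠ 0 := by norm_num at hx; linarith
    have h2 : x - 1 ≠ 0 := by norm_num at hx; linarith
    have h3 : x ^ 2 - 1 ≠ 0 := by
      rw [show x ^ 2 - 1 = (x - 1) * (x + 1) by ring]; exact mul_ne_zero h2 h1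
    simp [evenProd, oddProd]
    field_simp
    ring
  | succ q ih =>
    push_cast at hx ⊢
    have hq : (0 : ℝ) ≤ q := q.cast_nonneg
    have := ih (by linarith)
    rw [evenProd, Finset.prod_range_succ, ← evenProd, oddProd, Finset.prod_range_succ, ← oddProd,
      mul_div_right_comm, this]
    push_cast
    have h1 : x - (2 * q + 1) ≠ 0 := by linarith
    have h2 : x - (2 * q + 3) ≠ 0 := by linarith
    have h3 : x + (2 * q + 3) ≠ 0 := by linarith
    rw [show (x + 1) ^ 2 - (2 * (q : ℝ) + 2) ^ 2 = (x - (2 * q + 1)) * (x + (2 * q + 3)) by ring,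
      show x ^ 2 - (2 * ((q : ℝ) + 1) + 1) ^ 2 = (x - (2 * q + 3)) * (x + (2 * q + 3)) by ring,
      show x - (2 * ((q : ℝ) + 1) + 1) = x - (2 * q + 3) by ring]
    field_simp

theorem evenProd_sub_one (q : ℕ) {x : ℝ} (hx : 2 * q + 1 < x) :
    evenProd q (x - 1) / (x - 1) = (x + (2 * q + 1)) * oddProd q x := by
  induction q with
  | zero =>
    have h1 : x + 1 ≠ 0 := by norm_num at hx; linarith
    have h2 : x - 1 ≠ 0 := by norm_num at hx; linarith
    have h3 : x ^ 2 - 1 ≠ 0 := by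
      rw [show x ^ 2 - 1 = (x - 1) * (x + 1) by ring]; exact mul_ne_zero h2 h1
    simp [evenProd, oddProd]
    field_simp
    ring
  | succ q ih =>
    push_cast at hx ⊢
    have hq : (0 : ℝ) ≤ q := q.cast_nonneg
    have := ih (by linarith)
    rw [evenProd, Finset.prod_range_succ, ← evenProd, oddProd, Finset.prod_range_succ, ← oddProd,
      mul_div_right_comm, this]
    push_cast
    have h1 : x + (2 * q + 1) ≠ 0 := by linarith
    have h2 : x - (2 * q + 3) ≠ 0 := by linarith
    have h3 : x + (2 * q + 3) ≠ 0 := by linarith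
    rw [show (x - 1) ^ 2 - (2 * (q : ℝ) + 2) ^ 2 = (x + (2 * q + 1)) * (x - (2 * q + 3)) by ring,
      show x ^ 2 - (2 * ((q : ℝ) + 1) + 1) ^ 2 = (x - (2 * q + 3)) * (x + (2 * q + 3)) by ring,
      show x + (2 * ((q : ℝ) + 1) + 1) = x + (2 * q + 3) by ring]
    field_simp

theorem oddProd_add_one (q : ℕ) {x : ℝ} (hx : 2 * q + 2 < x) :
    x * oddProd q (x + 1) = (x - (2 * q + 2)) * evenProd (q + 1) x := by
  induction q with
  | zero =>
    norm_num at hx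
    have h1 : x + 2 ≠ 0 := by linarith
    have h2 : x - 2 ≠ 0 := by linarith
    have h3 : x ≠ 0 := by linarith
    simp only [evenProd, oddProd, zero_add, Finset.prod_range_one, Nat.cast_zero, mul_zero]
    rw [show (x + 1) ^ 2 - 1 ^ 2 = x * (x + 2) by ring,
      show x ^ 2 - 2 ^ 2 = (x - 2) * (x + 2) by ring]
    field_simp
  | succ q ih =>
    push_cast at hx ⊢
    have hq : (0 : ℝ) ≤ q := q.cast_nonneg
    have := ih (by linarith)
    rw [evenProd, Finset.prod_range_succ, ← evenProd, oddProd, Finset.prod_range_succ, ← oddProd,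
      ← mul_assoc, this]
    push_cast
    have h1 : x - (2 * q + 2) ≠ 0 := by linarith
    have h2 : x - (2 * q + 4) ≠ 0 := by linarith
    have h3 : x + (2 * q + 4) ≠ 0 := by linarith
    rw [show (x + 1) ^ 2 - (2 * ((q : ℝ) + 1) + 1) ^ 2 = (x - (2 * q + 2)) * (x + (2 * q + 4)) by
        ring,
      show x ^ 2 - (2 * ((q : ℝ) + 1) + 2) ^ 2 = (x - (2 * q + 4)) * (x + (2 * q + 4)) by ring,
      show x - (2 * ((q : ℝ) + 1) + 2) = x - (2 * q + 4) by ring]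
    field_simp
    exact mul_div_cancel_left₀ _ (by linarith)

theorem oddProd_sub_one (q : ℕ) {x : ℝ} (hx : 2 * q + 2 < x) :
    x * oddProd q (x - 1) = (x + (2 * q + 2)) * evenProd (q + 1) x := by
  induction q with
  | zero =>
    norm_num at hx
    have h1 : x + 2 ≠ 0 := by linarith
    have h2 : x - 2 ≠ 0 := by linarith
    have h3 : x ≠ 0 := by linarith
    simp only [evenProd, oddProd, zero_add, Finset.prod_range_one, Nat.cast_zero, mul_zero]
    rw [show (x - 1) ^ 2 - 1 ^ 2 = x * (x - 2) by ring,
      show x ^ 2 - 2 ^ 2 = (x - 2) * (x + 2) by ring]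
    field_simp
  | succ q ih =>
    push_cast at hx ⊢
    have hq : (0 : ℝ) ≤ q := q.cast_nonneg
    have := ih (by linarith)
    rw [evenProd, Finset.prod_range_succ, ← evenProd, oddProd, Finset.prod_range_succ, ← oddProd,
      ← mul_assoc, this]
    push_cast
    have h1 : x + (2 * q + 2) ≠ 0 := by linarith
    have h2 : x - (2 * q + 4) ≠ 0 := by linarith
    have h3 : x + (2 * q + 4) ≠ 0 := by linarith
    rw [show (x - 1) ^ 2 - (2 * ((q : ℝ) + 1) + 1) ^ 2 = (x + (2 * q + 2)) * (x - (2 * q + 4)) by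
        ring,
      show x ^ 2 - (2 * ((q : ℝ) + 1) + 2) ^ 2 = (x - (2 * q + 4)) * (x + (2 * q + 4)) by ring,
      show x + (2 * ((q : ℝ) + 1) + 2) = x + (2 * q + 4) by ring]
    field_simp
    exact mul_div_cancel_left₀ _ (by linarith)

/-- This mirrors the integral of T_k, which is T_{k+1}/(2(k+1)) - T_{k-1}/(2(k-1)). In the sum of
the two shifted products the end factors x ∓ c add up to 2x. -/
theorem gam_succ {p k : ℕ} (hk : p + 1 < k) :
    gam (p + 1) k = (gam p (k + 1) / (k + 1) + gam p (k - 1) / (k - 1)) / 2 := by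
  have hc : ((k - 1 : ℕ) : ℝ) = k - 1 := by rw [Nat.cast_sub (by omega)]; simp
  have hk' : (p : ℝ) + 1 < k := by exact_mod_cast hk
  have hp : (0 : ℝ) ≤ p := p.cast_nonneg
  rcases Nat.even_or_odd' p with ⟨q, rfl | rfl⟩
  · push_cast at hk'
    rw [gam_odd, gam_even, gam_even, hc]
    push_cast
    rw [evenProd_add_one q hk', evenProd_sub_one q hk']
    ring
  · push_cast at hk' hp
    rw [show 2 * q + 1 + 1 = 2 * (q + 1) by ring, gam_odd, gam_odd, gam_even, hc]
    push_cast
    have h1 := oddProd_add_one q (x := k) (by linarith)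
    have h2 := oddProd_sub_one q (x := k) (by linarith)
    rw [mul_div_cancel_left₀ _ (by linarith), mul_div_cancel_left₀ _ (by linarith)]
    have hk0 : (k : ℝ) ≠ 0 := by linarith
    refine mul_left_cancel₀ hk0 ?_
    linear_combination - (h1 + h2) / 2

theorem gam_zero (k : ℕ) : gam 0 k = 1 := by simp [gam]

theorem gam_one (k : ℕ) : gam 1 k = k * (1 / ((k : ℝ) ^ 2 - 1)) := by simp [gam]

theorem gam_nonneg {p k : ℕ} (hk : p < k) : 0 ≤ gam p k := by
  induction p generalizing k with
  | zero => simp [gam_zero]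
  | succ p ih =>
    have : (1 : ℝ) ≤ k := by exact_mod_cast (by omega : 1 ≤ k)
    rw [gam_succ hk]
    exact div_nonneg (add_nonneg (div_nonneg (ih (by omega)) (by linarith))
      (div_nonneg (ih (by omega)) (by linarith))) two_pos.le

theorem gam_antitone {p k l : ℕ} (hk : p < k) (hkl : k ≤ l) : gam p l ≤ gam p k := by
  induction p generalizing k l with
  | zero => simp [gam_zero]
  | succ p ih =>
    have h1 : (1 : ℝ) < k := by exact_mod_cast (by omega : 1 < k)
    have h2 : (k : ℝ) ≤ l := by exact_mod_cast hkl
    rw [gam_succ hk, gam_succ (by omega)]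
    have ha := ih (k := k + 1) (l := l + 1) (by omega) (by omega)
    have hb := ih (k := k - 1) (l := l - 1) (by omega) (by omega)
    have := gam_nonneg (p := p) (k := k + 1) (by omega)
    have := gam_nonneg (p := p) (k := k - 1) (by omega)
    have ha' : gam p (l + 1) / (l + 1) ≤ gam p (k + 1) / (k + 1) :=
      div_le_div₀ (by assumption) ha (by linarith) (by linarith)
    have hb' : gam p (l - 1) / (l - 1) ≤ gam p (k - 1) / (k - 1) :=
      div_le_div₀ (by assumption) hb (by linarith) (by linarith)
    linarith

end Gam

/-! ### Norms and endpoint values of iterated antiderivatives of high modes. -/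

section Antideriv

variable {𝕜 : Type} [RCLike 𝕜]

theorem antideriv_apply (U : Ell1 𝕜) (n : ℕ) : antideriv 𝕜 U n = antiderivSeq (⇑U) n := rfl

theorem antideriv_unitSeq {k : ℕ} (hk : 1 < k) :
    antideriv 𝕜 (unitSeq 𝕜 k) = (((1 / (2 * ((k : ℝ) + 1)) : ℝ)) : 𝕜) • unitSeq 𝕜 (k + 1) -
      (((1 / (2 * ((k : ℝ) - 1)) : ℝ)) : 𝕜) • unitSeq 𝕜 (k - 1) := by
  refine Ell1.ext fun n => ?_
  rw [antideriv_apply, sub_apply, smul_apply, smul_apply, antiderivSeq]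
  simp only [unitSeq_apply]
  by_cases h0 : n = 0
  · have h1 : ¬ (0 = k - 1) := by omega
    simp [h0, h1]
  by_cases h1 : n = k + 1
  · have h2 : ¬ (k + 1 + 1 = k) := by omega
    have h3 : ¬ (k + 1 = k - 1) := by omega
    have h4 : ¬ (k + 1 = 0) := by omega
    have h5 : ((k + 1 : ℕ) : 𝕜) = k + 1 := by push_cast; rfl
    subst h1
    simp only [h2, h3, h4, h5, Nat.add_sub_cancel, if_true, if_false, map_ofNat, RCLike.ofReal_div,
      RCLike.ofReal_mul, RCLike.ofReal_add, RCLike.ofReal_one, RCLike.ofReal_natCast]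
    ring
  · by_cases h2 : n = k - 1
    · have h3 : ¬ (n - 1 = k) := by omega
      have h4 : n + 1 = k := by omega
      have h5 : (n : 𝕜) = (k : 𝕜) - 1 := by rw [← h4]; simp
      have h7 : ¬ (k - 1 = k + 1) := by omega
      have h8 : ¬ (k - 1 = 0) := by omega
      have h9 : (k - 1 + 1 = k) := by omega
      subst h2
      simp only [h3, h5, h7, h8, h9, if_true, if_false, map_ofNat, RCLike.ofReal_div,
        RCLike.ofReal_mul, RCLike.ofReal_sub, RCLike.ofReal_one, RCLike.ofReal_natCast]
      ring
    · have h3 : ¬ (n - 1 = k) := by omega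
      have h4 : ¬ (n + 1 = k) := by omega
      simp [h0, h1, h2, h3, h4]

theorem antideriv_pow_succ_apply (p : ℕ) (U : Ell1 𝕜) :
    (antideriv 𝕜 ^ (p + 1)) U = (antideriv 𝕜 ^ p) (antideriv 𝕜 U) := by
  rw [pow_succ]; rfl

theorem norm_map_antideriv_unitSeq_le {F : Type*} [NormedAddCommGroup F] [NormedSpace 𝕜 F]
    (T : Ell1 𝕜 →L[𝕜] F) {k : ℕ} (hk : 1 < k) {a b : ℝ} (ha : ‖T (unitSeq 𝕜 (k + 1))‖ ≤ a)
    (hb : ‖T (unitSeq 𝕜 (k - 1))‖ ≤ b) :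
    ‖T (antideriv 𝕜 (unitSeq 𝕜 k))‖ ≤ (a / (k + 1) + b / (k - 1)) / 2 := by
  have hk' : (1 : ℝ) < k := by exact_mod_cast hk
  have h1 : 0 < 1 / (2 * ((k : ℝ) + 1)) := by positivity
  have h2 : 0 < 1 / (2 * ((k : ℝ) - 1)) := by
    have : 0 < (k : ℝ) - 1 := by linarith
    positivity
  rw [antideriv_unitSeq hk, map_sub, map_smul, map_smul]
  refine (norm_sub_le _ _).trans ?_
  rw [norm_smul, norm_smul, RCLike.norm_ofReal, RCLike.norm_ofReal, abs_of_pos h1, abs_of_pos h2]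
  refine (add_le_add (mul_le_mul_of_nonneg_left ha h1.le)
    (mul_le_mul_of_nonneg_left hb h2.le)).trans_eq ?_
  field_simp

/-- The recurrence of `gam_succ`, started from `xi k ≤ 2`. The condition p < k keeps repeated
integration away from the modes 0 and 1, where the formula for the antiderivative differs. -/
theorem norm_antideriv_pow_unitSeq_le {p k : ℕ} (hk : p < k) :
    ‖(antideriv 𝕜 ^ p) (unitSeq 𝕜 k)‖ ≤ 2 * gam p k := by
  induction p generalizing k with
  | zero =>
    change ‖unitSeq 𝕜 k‖ ≤ _
    rw [norm_unitSeq, gam_zero, mul_one]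
    exact xi_le_two k
  | succ p ih =>
    rw [antideriv_pow_succ_apply]
    refine (norm_map_antideriv_unitSeq_le _ (by omega) (ih (k := k + 1) (by omega))
      (ih (k := k - 1) (by omega))).trans_eq ?_
    rw [gam_succ hk]
    ring

theorem evalEnd_unitSeq (s : ℤˣ) (k : ℕ) :
    evalEnd 𝕜 s (unitSeq 𝕜 k) = ((xi k * ((s : ℤ) : ℝ) ^ k : ℝ) : 𝕜) := by
  change ∑' n, ((xi n * ((s : ℤ) : ℝ) ^ n : ℝ) : 𝕜) * unitSeq 𝕜 k n = _
  rw [tsum_eq_single k]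
  · simp [unitSeq_apply]
  · intro n hn
    simp [unitSeq_apply, hn]

/-- At an endpoint T_{k+1} and T_{k-1} have the same value, so the first integration produces a
difference of size 2/(k² - 1), at most `gam 1 k` because k ≥ 2. This cancellation saves the factor 2
of the norm bound, and is why the induction starts at one integration. -/
theorem norm_evalEnd_antideriv_pow_unitSeq_le (s : ℤˣ) {p k : ℕ} (hk : p + 1 < k) :
    ‖evalEnd 𝕜 s ((antideriv 𝕜 ^ (p + 1)) (unitSeq 𝕜 k))‖ ≤ gam (p + 1) k := by
  induction p generalizing k with
  | zero =>
    have hk' : (2 : ℝ) ≤ k := by exact_mod_cast hk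
    have h1 : (k : ℝ) - 1 ≠ 0 := by linarith
    have h2 : (k : ℝ) + 1 ≠ 0 := by linarith
    have h3 : (k : ℝ) ^ 2 - 1 ≠ 0 := by nlinarith
    have hs : ∀ n : ℕ, ((s : ℤ) : ℝ) ^ (n + 2) = ((s : ℤ) : ℝ) ^ n := fun n => by
      rcases Int.units_eq_one_or s with h | h <;> simp [h, pow_add]
    have habs : |((s : ℤ) : ℝ) ^ (k - 1)| = 1 := by
      rcases Int.units_eq_one_or s with h | h <;> simp [h]
    rw [zero_add, pow_one, antideriv_unitSeq (by omega), map_sub, map_smul, map_smul,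
      evalEnd_unitSeq, evalEnd_unitSeq, show k + 1 = k - 1 + 2 by omega, hs, smul_eq_mul,
      smul_eq_mul, ← RCLike.ofReal_mul, ← RCLike.ofReal_mul, ← RCLike.ofReal_sub,
      RCLike.norm_ofReal, gam_one]
    have hx1 : xi (k - 1 + 2) = 2 := by simp [xi]
    have hx2 : xi (k - 1) = 2 := by simp [xi]; omega
    rw [hx1, hx2, ← mul_assoc, ← mul_assoc, ← sub_mul, abs_mul, habs, mul_one]
    have h4 : 1 / (2 * ((k : ℝ) + 1)) * 2 - 1 / (2 * ((k : ℝ) - 1)) * 2 =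
        -(2 * (1 / ((k : ℝ) ^ 2 - 1))) := by
      field_simp
      ring
    have h5 : 0 ≤ 1 / ((k : ℝ) ^ 2 - 1) := by
      have : 0 < (k : ℝ) ^ 2 - 1 := by nlinarith
      positivity
    rw [h4, abs_neg, abs_of_nonneg (by positivity)]
    exact mul_le_mul_of_nonneg_right hk' h5
  | succ p ih =>
    rw [antideriv_pow_succ_apply]
    refine (norm_map_antideriv_unitSeq_le (evalEnd 𝕜 s ∘L antideriv 𝕜 ^ (p + 1)) (by omega)
      (ih (k := k + 1) (by omega)) (ih (k := k - 1) (by omega))).trans_eq ?_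
    rw [gam_succ hk]

theorem norm_antideriv_pow_le {p N : ℕ} (hp : p ≤ N) {U : Ell1 𝕜} (hU : ∀ k ≤ N, U k = 0) :
    ‖(antideriv 𝕜 ^ p) U‖ ≤ gam p (N + 1) * ‖U‖ := by
  refine norm_apply_le_of_unitSeq _ U fun k hk => ?_
  have hN : N < k := by
    by_contra h
    exact hk (hU k (by omega))
  have hx : xi k = 2 := by simp [xi]; omega
  rw [hx]
  linarith [norm_antideriv_pow_unitSeq_le (𝕜 := 𝕜) (p := p) (k := k) (by omega),
    gam_antitone (p := p) (k := N + 1) (l := k) (by omega) (by omega)]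

theorem norm_evalEnd_antideriv_pow_le (s : ℤˣ) {p N : ℕ} (hp0 : p ≠ 0) (hp : p ≤ N) {U : Ell1 𝕜}
    (hU : ∀ k ≤ N, U k = 0) :
    ‖evalEnd 𝕜 s ((antideriv 𝕜 ^ p) U)‖ ≤ gam p (N + 1) / 2 * ‖U‖ := by
  obtain ⟨p, rfl⟩ := Nat.exists_eq_succ_of_ne_zero hp0
  refine norm_apply_le_of_unitSeq (evalEnd 𝕜 s ∘L antideriv 𝕜 ^ (p + 1)) U fun k hk => ?_
  have hN : N < k := by
    by_contra h
    exact hk (hU k (by omega))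
  have hx : xi k = 2 := by simp [xi]; omega
  rw [hx]
  have := norm_evalEnd_antideriv_pow_unitSeq_le (𝕜 := 𝕜) s (p := p) (k := k) (by omega)
  have := gam_antitone (p := p + 1) (k := N + 1) (l := k) (by omega) (by omega)
  calc _ ≤ gam (p + 1) k := by assumption
    _ ≤ gam (p + 1) (N + 1) := by assumption
    _ = _ := by ring

end Antideriv

end ChebSpec

end

noncomputable section

namespace ChebSpec

open Filter Topology

/-! ### The polynomial part of the solution operators -/

section Differentiation

/-- Extension of a vector by zero. -/
def extSeq {d : ℕ} (u : Fin d → ℝ) : ℕ → ℝ := fun n => if h : n < d then u ⟨n, h⟩ else 0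

theorem extSeq_fin {d : ℕ} (u : Fin d → ℝ) (n : Fin d) : extSeq u n = u n := by
  simp [extSeq]

theorem extSeq_diffMatrix {d : ℕ} (u : Fin d → ℝ) (n : ℕ) :
    extSeq ((diffMatrix d).mulVec u) n =
      ∑ c : Fin d, (if n < c ∧ Odd (n + c) then 2 * ((c : ℕ) : ℝ) else 0) * u c := by
  rw [extSeq]
  split_ifs with h
  · simp only [Matrix.mulVec, dotProduct, diffMatrix, Matrix.of_apply, Fin.lt_def]
  · symm
    refine Finset.sum_eq_zero fun c _ => ?_
    have : ¬ (n < c ∧ Odd (n + c)) := fun h' => by have := c.2; omega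
    rw [if_neg this, zero_mul]

/-- Rows n - 1 and n + 1 of the differentiation matrix differ only in column n. The constant term is
lost, hence n ≥ 1. -/
theorem antiderivSeq_diffMatrix {d : ℕ} (u : Fin d → ℝ) {n : ℕ} (hn : 1 ≤ n) :
    antiderivSeq (extSeq ((diffMatrix d).mulVec u)) n = extSeq u n := by
  have hn0 : (n : ℝ) ≠ 0 := by exact_mod_cast (by omega : n ≠ 0)
  have key : ∀ c : Fin d,
      (if n - 1 < c ∧ Odd (n - 1 + c) then 2 * ((c : ℕ) : ℝ) else 0) * u c -
        (if n + 1 < c ∧ Odd (n + 1 + c) then 2 * ((c : ℕ) : ℝ) else 0) * u c =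
      if (c : ℕ) = n then 2 * (n : ℝ) * u c else 0 := by
    intro c
    by_cases hc : (c : ℕ) = n
    · have h1 : n - 1 < (c : ℕ) ∧ Odd (n - 1 + c) := ⟨by omega, by rw [Nat.odd_iff]; omega⟩
      have h2 : ¬ (n + 1 < (c : ℕ) ∧ Odd (n + 1 + c)) := fun h => by omega
      rw [if_pos h1, if_neg h2, if_pos hc, hc]
      ring
    · have h1 : (n - 1 < (c : ℕ) ∧ Odd (n - 1 + c)) ↔ (n + 1 < (c : ℕ) ∧ Odd (n + 1 + c)) := by
        rw [Nat.odd_iff, Nat.odd_iff]; omega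
      simp only [h1, hc, if_false, sub_self]
  rw [antiderivSeq, if_neg (by omega), extSeq_diffMatrix, extSeq_diffMatrix,
    ← Finset.sum_sub_distrib, Finset.sum_congr rfl fun c _ => key c, extSeq]
  split_ifs with h
  · rw [Finset.sum_eq_single ⟨n, h⟩]
    · simp only [if_true]
      field_simp
    · intro c _ hc
      rw [if_neg fun h' => hc (Fin.ext h')]
    · simp
  · rw [Finset.sum_eq_zero, zero_div]
    intro c _
    rw [if_neg fun h' : (c : ℕ) = n => h (h' ▸ c.2)]

/-- Each integration spoils one further low coefficient, so only those of index at least i are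
recovered. -/
theorem antiderivSeq_iterate_diffMatrix {d : ℕ} (i : ℕ) (u : Fin d → ℝ) {n : ℕ} (hn : i ≤ n) :
    antiderivSeq^[i] (extSeq ((diffMatrix d ^ i).mulVec u)) n = extSeq u n := by
  induction i generalizing u n with
  | zero => simp
  | succ i ih =>
    rw [Function.iterate_succ_apply', pow_succ, ← Matrix.mulVec_mulVec,
      ← antiderivSeq_diffMatrix u (by omega : 1 ≤ n)]
    conv_lhs => rw [antiderivSeq]
    conv_rhs => rw [antiderivSeq]
    rw [ih _ (by omega), ih _ (by omega)]

theorem diffMatrix_pow_apply_eq_zero {d i : ℕ} {n c : Fin d} (h : (c : ℕ) < n + i) :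
    (diffMatrix d ^ i) n c = 0 := by
  induction i generalizing c with
  | zero =>
    rw [pow_zero, Matrix.one_apply_ne]
    rintro rfl
    omega
  | succ i ih =>
    rw [pow_succ, Matrix.mul_apply]
    refine Finset.sum_eq_zero fun k _ => ?_
    by_cases hk : (k : ℕ) < n + i
    · rw [ih hk, zero_mul]
    · have : ¬ (k < c ∧ Odd ((k : ℕ) + c)) := fun h' => by
        have := Fin.lt_def.mp h'.1
        omega
      rw [diffMatrix, Matrix.of_apply, if_neg this, mul_zero]

/-- `antiderivSeq` as a linear map. -/
def antiderivLin : (ℕ → ℝ) →ₗ[ℝ] (ℕ → ℝ) where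
  toFun := antiderivSeq
  map_add' U V := by
    funext n
    simp only [antiderivSeq, Pi.add_apply]
    split_ifs
    · simp
    · ring
  map_smul' a U := by
    funext n
    simp only [antiderivSeq, Pi.smul_apply, smul_eq_mul, RingHom.id_apply]
    split_ifs
    · simp
    · ring

theorem antiderivLin_pow (i : ℕ) (f : ℕ → ℝ) : (antiderivLin ^ i) f = antiderivSeq^[i] f := by
  induction i with
  | zero => rfl
  | succ i ih =>
    rw [pow_succ', Module.End.mul_apply, ih, Function.iterate_succ_apply']
    rfl

theorem BVP.sum_shiftedUnit {d : ℕ} (i : ℕ) (v : Fin d → ℝ) {n : ℕ} (hn : i ≤ n) :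
    ∑ c : Fin d, shiftedUnit i c n * v c = antiderivSeq^[i] (extSeq v) n := by
  have hv : extSeq v = ∑ c : Fin d, v c • (Pi.single (c : ℕ) (1 : ℝ) : ℕ → ℝ) := by
    funext k
    rw [Finset.sum_apply]
    simp only [Pi.smul_apply, Pi.single_apply, smul_eq_mul, mul_ite, mul_one, mul_zero, extSeq]
    split_ifs with h
    · rw [Finset.sum_eq_single ⟨k, h⟩]
      · simp
      · intro c _ hc
        rw [if_neg fun h' => hc (Fin.ext h'.symm)]
      · simp
    · symm
      refine Finset.sum_eq_zero fun c _ => ?_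
      rw [if_neg fun h' : k = (c : ℕ) => h (h' ▸ c.2)]
  rw [hv, ← antiderivLin_pow, map_sum, Finset.sum_apply]
  refine Finset.sum_congr rfl fun c _ => ?_
  rw [map_smul, antiderivLin_pow, Pi.smul_apply, smul_eq_mul, shiftedUnit, if_neg (by omega),
    mul_comm]

end Differentiation

/-! ### Elimination of boundary conditions and bounds for the solution operators. -/

namespace BVP

variable (P : BVP)

/-- The combination of the boundary conditions that is left after the elimination. -/
def thetaMatrix (σ : Equiv.Perm (Fin (2 * P.m))) (i : Fin (2 * P.m)) :
    Matrix (Fin (2 * P.m - i)) (Fin (2 * P.m)) ℝ :=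
  Matrix.of fun n r => (if r = σ (P.highIdx i n) then 1 else 0) -
    ∑ l : Fin i, (P.block21 σ i * (P.block11 σ i)⁻¹) n l * (if r = σ (P.lowIdx i l) then 1 else 0)

theorem sum_thetaMatrix_mul (σ : Equiv.Perm (Fin (2 * P.m))) (i : Fin (2 * P.m))
    (n : Fin (2 * P.m - i)) (f : Fin (2 * P.m) → ℝ) :
    ∑ r, P.thetaMatrix σ i n r * f r = f (σ (P.highIdx i n)) -
      ∑ l : Fin i, (P.block21 σ i * (P.block11 σ i)⁻¹) n l * f (σ (P.lowIdx i l)) := by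
  simp only [thetaMatrix, Matrix.of_apply, sub_mul, Finset.sum_sub_distrib, ite_mul, one_mul,
    zero_mul, Finset.sum_ite_eq', Finset.mem_univ, if_true, Finset.sum_mul]
  rw [Finset.sum_comm]
  simp

theorem thetaLeft_eq (σ : Equiv.Perm (Fin (2 * P.m))) (i : Fin (2 * P.m))
    (n : Fin (2 * P.m - i)) (j : Fin (2 * P.m)) :
    P.thetaLeft σ i n j = ∑ r, P.thetaMatrix σ i n r * P.leftRow r j :=
  (P.sum_thetaMatrix_mul σ i n fun r => P.leftRow r j).symm

theorem thetaRight_eq (σ : Equiv.Perm (Fin (2 * P.m))) (i : Fin (2 * P.m))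
    (n : Fin (2 * P.m - i)) (j : Fin (2 * P.m)) :
    P.thetaRight σ i n j = ∑ r, P.thetaMatrix σ i n r * P.rightRow r j :=
  (P.sum_thetaMatrix_mul σ i n fun r => P.rightRow r j).symm

/-- The purpose of the elimination: the reduced conditions do not see polynomials of degree less
than i. -/
theorem thetaMatrix_mul_bcMatrix_eq_zero {σ : Equiv.Perm (Fin (2 * P.m))} {i : Fin (2 * P.m)}
    (hσ : IsUnit (P.block11 σ i).det) (n : Fin (2 * P.m - i)) {a : Fin (2 * P.m)} (ha : a < i) :
    (P.thetaMatrix σ i * P.bcMatrix) n a = 0 := by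
  rw [Matrix.mul_apply, sum_thetaMatrix_mul P σ i n fun r => P.bcMatrix r a]
  have h1 : ∑ l : Fin i, (P.block21 σ i * (P.block11 σ i)⁻¹) n l *
      P.bcMatrix (σ (P.lowIdx i l)) a =
      (P.block21 σ i * (P.block11 σ i)⁻¹ * P.block11 σ i) n ⟨a, ha⟩ := rfl
  rw [h1, Matrix.mul_assoc, Matrix.nonsing_inv_mul _ hσ, Matrix.mul_one]
  exact sub_self _

/-- The matrix of the `i`-fold antiderivative on the first modes. -/
def shiftMatrix (i : Fin (2 * P.m)) : Matrix (Fin (2 * P.m)) (Fin (2 * P.m - i)) ℝ :=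
  Matrix.of fun a c => shiftedUnit i c a

theorem reducedMatrix_eq (σ : Equiv.Perm (Fin (2 * P.m))) (i : Fin (2 * P.m)) :
    P.reducedMatrix σ i = P.thetaMatrix σ i * P.bcMatrix * P.shiftMatrix i := by
  ext n c
  rw [Matrix.mul_assoc, Matrix.mul_apply]
  have h : ∀ r, (P.bcMatrix * P.shiftMatrix i) r c =
      ∑ j, (P.leftRow r j * bdryPoly (2 * P.m) (-1) j (shiftedUnit i c) +
        P.rightRow r j * bdryPoly (2 * P.m) 1 j (shiftedUnit i c)) := by
    intro r
    simp only [Matrix.mul_apply, bcMatrix, shiftMatrix, Matrix.of_apply, bdryPoly,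
      Finset.sum_range, Finset.mul_sum, Finset.sum_mul, ← Finset.sum_add_distrib]
    rw [Finset.sum_comm]
    refine Finset.sum_congr rfl fun j _ => Finset.sum_congr rfl fun a _ => ?_
    ring
  simp only [h, reducedMatrix, Matrix.of_apply, thetaLeft_eq, thetaRight_eq, Finset.mul_sum,
    Finset.sum_mul, ← Finset.sum_add_distrib]
  rw [Finset.sum_comm]
  refine Finset.sum_congr rfl fun j _ => Finset.sum_congr rfl fun a _ => ?_
  ring

/-- The matrix that maps the boundary data to the first `2m - i` coefficients of the `i`-th
derivative of the interpolating polynomial. -/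
def polyMatrix (i : Fin (2 * P.m)) : Matrix (Fin (2 * P.m - i)) (Fin (2 * P.m)) ℝ :=
  Matrix.of fun n r => (diffMatrix (2 * P.m) ^ (i : ℕ) * P.bcMatrix⁻¹) ⟨n, by omega⟩ r

/-- Differentiating i times and integrating back changes only coefficients of index less than i,
which the reduced conditions ignore. So the product collapses to `thetaMatrix * bcMatrix *
bcMatrix⁻¹`. -/
theorem reducedMatrix_mul_polyMatrix (hwell : IsUnit P.bcMatrix.det)
    {σ : Equiv.Perm (Fin (2 * P.m))} {i : Fin (2 * P.m)} (hσ : IsUnit (P.block11 σ i).det) :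
    P.reducedMatrix σ i * P.polyMatrix i = P.thetaMatrix σ i := by
  let J : Matrix (Fin (2 * P.m - i)) (Fin (2 * P.m)) ℝ :=
    Matrix.of fun n r => (diffMatrix (2 * P.m) ^ (i : ℕ)) ⟨n, by omega⟩ r
  have hJ : P.polyMatrix i = J * P.bcMatrix⁻¹ := rfl
  have hshift : ∀ a c : Fin (2 * P.m), i ≤ a →
      (P.shiftMatrix i * J) a c = (1 : Matrix (Fin (2 * P.m)) (Fin (2 * P.m)) ℝ) a c := by
    intro a c ha
    -- Rows of index at least 2m - i of the i-th derivative matrix vanish, so truncating the column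
    -- loses nothing.
    have h1 : extSeq (fun n => J n c) =
        extSeq ((diffMatrix (2 * P.m) ^ (i : ℕ)).mulVec (Pi.single c 1)) := by
      funext n
      simp only [extSeq, Matrix.mulVec_single_one, J, Matrix.of_apply, Matrix.col_apply]
      by_cases h : n < 2 * P.m - i
      · rw [dif_pos h, dif_pos (by omega)]
      · rw [dif_neg h]
        split_ifs with h'
        · rw [diffMatrix_pow_apply_eq_zero]
          have := c.2
          simp only
          omega
        · rfl
    have h2 : (P.shiftMatrix i * J) a c = ∑ n : Fin (2 * P.m - i), shiftedUnit i n a * J n c := rfl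
    rw [h2, sum_shiftedUnit i (fun n => J n c) (Fin.le_def.mp ha), h1,
      antiderivSeq_iterate_diffMatrix _ _ (Fin.le_def.mp ha), extSeq_fin, Pi.single_apply,
      Matrix.one_apply]
  have hcancel : P.thetaMatrix σ i * P.bcMatrix * (P.shiftMatrix i * J) =
      P.thetaMatrix σ i * P.bcMatrix := by
    conv_rhs => rw [← Matrix.mul_one (P.thetaMatrix σ i * P.bcMatrix)]
    ext n c
    rw [Matrix.mul_apply, Matrix.mul_apply]
    refine Finset.sum_congr rfl fun a _ => ?_
    rcases lt_or_ge a i with h | h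
    · rw [P.thetaMatrix_mul_bcMatrix_eq_zero hσ n h, zero_mul, zero_mul]
    · rw [hshift a c h]
  rw [reducedMatrix_eq, hJ, ← Matrix.mul_assoc, Matrix.mul_assoc _ _ J, hcancel,
    Matrix.mul_assoc, Matrix.mul_nonsing_inv _ hwell, Matrix.mul_one]

/-- `thetaMatrix` has an identity block in the columns of the retained conditions, so the preceding
identity yields a right inverse. -/
theorem isUnit_det_reducedMatrix (hwell : IsUnit P.bcMatrix.det)
    {σ : Equiv.Perm (Fin (2 * P.m))} {i : Fin (2 * P.m)} (hσ : IsUnit (P.block11 σ i).det) :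
    IsUnit (P.reducedMatrix σ i).det := by
  let X : Matrix (Fin (2 * P.m)) (Fin (2 * P.m - i)) ℝ :=
    Matrix.of fun r n => if r = σ (P.highIdx i n) then 1 else 0
  have hX : P.thetaMatrix σ i * X = 1 := by
    ext n n'
    rw [Matrix.mul_apply, sum_thetaMatrix_mul P σ i n fun r => X r n']
    have h1 : ∀ l, X (σ (P.lowIdx i l)) n' = 0 := fun l => by
      refine if_neg fun h => ?_
      have := congrArg Fin.val (σ.injective h)
      simp only [lowIdx, highIdx] at this
      omega
    simp only [h1, mul_zero, Finset.sum_const_zero, sub_zero, X, Matrix.of_apply,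
      EmbeddingLike.apply_eq_iff_eq, Matrix.one_apply]
    congr 1
    simp [highIdx, Fin.ext_iff]
  refine Matrix.isUnit_det_of_right_inverse (B := P.polyMatrix i * X) ?_
  rw [← Matrix.mul_assoc, P.reducedMatrix_mul_polyMatrix hwell hσ, hX]

theorem polyMatrix_eq (hwell : IsUnit P.bcMatrix.det)
    {σ : Equiv.Perm (Fin (2 * P.m))} {i : Fin (2 * P.m)} (hσ : IsUnit (P.block11 σ i).det) :
    P.polyMatrix i = (P.reducedMatrix σ i)⁻¹ * P.thetaMatrix σ i := by
  rw [← P.reducedMatrix_mul_polyMatrix hwell hσ, ← Matrix.mul_assoc,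
    Matrix.nonsing_inv_mul _ (P.isUnit_det_reducedMatrix hwell hσ), Matrix.one_mul]

/-- The vector of boundary data of `S^{2m} w`. -/
def bcData (w : Ell1 ℂ) : Fin (2 * P.m) → ℂ := fun r => P.bcIter ℂ r w

/-- The polynomial part of `∂^i v`. -/
def polyPart (i : Fin (2 * P.m)) (w : Ell1 ℂ) : Ell1 ℂ :=
  emb ℂ (2 * P.m - i) (((P.polyMatrix i).map Complex.ofRealHom).mulVec (P.bcData w))

/-- The i-th derivative of a polynomial of degree less than 2m has degree less than 2m - i, so the
double sum in `Kop` reduces to those rows. -/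
theorem Kop_apply (i : Fin (2 * P.m)) (w : Ell1 ℂ) :
    P.Kop ℂ i w = ((-1 : ℂ) ^ (P.m + 1)) •
      ((antideriv ℂ ^ (2 * P.m - i)) w - P.polyPart i w) := by
  have h : P.polyPart i w = ∑ n : Fin (2 * P.m), ∑ r : Fin (2 * P.m),
      ((((diffMatrix (2 * P.m)) ^ (i : ℕ) * P.bcMatrix⁻¹) n r : ℝ) : ℂ) •
        (P.bcIter ℂ r w) • (unitSeq ℂ n) := by
    refine Ell1.ext fun k => ?_
    rw [polyPart, emb_apply, sum_apply]
    simp only [sum_apply, smul_apply, unitSeq_apply]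
    by_cases hk : k < 2 * P.m - i
    · rw [dif_pos hk, Finset.sum_eq_single ⟨k, by omega⟩]
      · simp only [Matrix.mulVec, dotProduct, Matrix.map_apply, polyMatrix, Matrix.of_apply,
          bcData, if_true, mul_one]
        rfl
      · intro n _ hn
        refine Finset.sum_eq_zero fun r _ => ?_
        rw [if_neg fun h => hn (Fin.ext h.symm), mul_zero, mul_zero]
      · simp
    · rw [dif_neg hk]
      symm
      refine Finset.sum_eq_zero fun n _ => Finset.sum_eq_zero fun r _ => ?_
      by_cases hkn : k = n
      · have : ((diffMatrix (2 * P.m)) ^ (i : ℕ) * P.bcMatrix⁻¹) n r = 0 := by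
          rw [Matrix.mul_apply]
          refine Finset.sum_eq_zero fun c _ => ?_
          rw [diffMatrix_pow_apply_eq_zero (by have := c.2; omega), zero_mul]
        rw [this]
        simp
      · rw [if_neg hkn, mul_zero, mul_zero]
  rw [h, Kop]
  simp only [_root_.smul_apply, _root_.sub_apply, _root_.sum_apply,
    ContinuousLinearMap.smulRight_apply]
  rfl

theorem norm_neg_one_pow_smul (n : ℕ) (U : Ell1 ℂ) : ‖((-1 : ℂ) ^ n) • U‖ = ‖U‖ := by
  rw [norm_smul, norm_pow, norm_neg, norm_one, one_pow, one_mul]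

/-- Both norms are governed by the same columns, so complexifying a real matrix does not enlarge its
operator norm. -/
theorem norm_finOp_map_ofReal_le {d : ℕ} (M : Matrix (Fin d) (Fin d) ℝ) :
    ‖finOp (M.map Complex.ofRealHom)‖ ≤ ‖finOp M‖ := by
  refine ContinuousLinearMap.opNorm_le_bound _ (norm_nonneg _) fun U => ?_
  refine norm_apply_le_of_unitSeq _ U fun k _ => ?_
  by_cases hk : k < d
  · have h1 := (finOp M).le_opNorm (unitSeq ℝ k)
    rw [norm_unitSeq] at h1
    refine le_trans (le_of_eq ?_) h1
    have e1 := emb_single (𝕜 := ℂ) (⟨k, hk⟩ : Fin d)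
    have e2 := emb_single (𝕜 := ℝ) (⟨k, hk⟩ : Fin d)
    simp only at e1 e2
    rw [finOp_apply, finOp_apply, ← e1, ← e2, res_emb, res_emb, norm_emb, norm_emb]
    simp
  · have : res ℂ d (unitSeq ℂ k) = 0 := by
      funext n
      rw [res_apply, unitSeq_apply, if_neg (by have := n.2; omega)]
      rfl
    rw [finOp_apply, this, Matrix.mulVec_zero, map_zero, norm_zero]
    exact mul_nonneg (norm_nonneg _) (xi_pos k).le

/-- The second summand of `eta`. -/
def etaPoly (σ : Equiv.Perm (Fin (2 * P.m))) (i : Fin (2 * P.m)) (k : ℕ) : ℝ :=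
  ‖finOp (P.reducedMatrix σ i)⁻¹‖ *
    ∑ n : Fin (2 * P.m - i), ∑ j : Fin (2 * P.m),
      (|P.thetaLeft σ i n j| + |P.thetaRight σ i n j|) * gam (2 * P.m - j) k

theorem eta_eq (σ : Equiv.Perm (Fin (2 * P.m))) (i : Fin (2 * P.m)) (k : ℕ) :
    P.eta σ i k = gam (2 * P.m - i) k + P.etaPoly σ i k := rfl

theorem bcIter_apply (r : Fin (2 * P.m)) (w : Ell1 ℂ) :
    P.bcIter ℂ r w = ∑ j : Fin (2 * P.m),
      ((P.leftRow r j : ℂ) * evalEnd ℂ (-1) ((antideriv ℂ ^ (2 * P.m - j)) w) +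
        (P.rightRow r j : ℂ) * evalEnd ℂ 1 ((antideriv ℂ ^ (2 * P.m - j)) w)) := by
  simp only [bcIter, _root_.sum_apply, _root_.add_apply, _root_.smul_apply, smul_eq_mul]
  rfl

/-- By `polyMatrix_eq` the coefficients are the inverse reduced matrix applied to the reduced
boundary data, and those data are bounded by endpoint values of antiderivatives. -/
theorem norm_polyPart_le (hwell : IsUnit P.bcMatrix.det)
    {σ : Equiv.Perm (Fin (2 * P.m))} {i : Fin (2 * P.m)} (hσ : IsUnit (P.block11 σ i).det)
    {N : ℕ} (hN : 2 * P.m ≤ N) {w : Ell1 ℂ} (hw : ∀ k ≤ N, w k = 0) :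
    ‖P.polyPart i w‖ ≤ P.etaPoly σ i (N + 1) * ‖w‖ := by
  set t : Fin (2 * P.m - i) → ℂ :=
    ((P.thetaMatrix σ i).map Complex.ofRealHom).mulVec (P.bcData w) with ht
  have h1 : P.polyPart i w = emb ℂ (2 * P.m - i)
      (((P.reducedMatrix σ i)⁻¹.map Complex.ofRealHom).mulVec t) := by
    rw [polyPart, P.polyMatrix_eq hwell hσ, Matrix.map_mul, ht, Matrix.mulVec_mulVec]
  have h2 : ∀ n, t n = ∑ j : Fin (2 * P.m),
      ((P.thetaLeft σ i n j : ℂ) * evalEnd ℂ (-1) ((antideriv ℂ ^ (2 * P.m - j)) w) +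
        (P.thetaRight σ i n j : ℂ) * evalEnd ℂ 1 ((antideriv ℂ ^ (2 * P.m - j)) w)) := by
    intro n
    simp only [ht, Matrix.mulVec, dotProduct, Matrix.map_apply, bcData, bcIter_apply,
      thetaLeft_eq, thetaRight_eq, Complex.ofReal_sum, Complex.ofReal_mul, Finset.sum_mul,
      Finset.mul_sum, ← Finset.sum_add_distrib, Complex.ofRealHom_eq_coe]
    rw [Finset.sum_comm]
    refine Finset.sum_congr rfl fun j _ => Finset.sum_congr rfl fun r _ => ?_
    ring
  have h3 : ∀ n, ‖t n‖ ≤ ∑ j : Fin (2 * P.m),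
      (|P.thetaLeft σ i n j| + |P.thetaRight σ i n j|) *
        (gam (2 * P.m - j) (N + 1) / 2 * ‖w‖) := by
    intro n
    rw [h2]
    refine (norm_sum_le _ _).trans (Finset.sum_le_sum fun j _ => ?_)
    refine (norm_add_le _ _).trans ?_
    rw [norm_mul, norm_mul, Complex.norm_real, Complex.norm_real, add_mul, Real.norm_eq_abs,
      Real.norm_eq_abs]
    have hj := j.2
    exact add_le_add
      (mul_le_mul_of_nonneg_left (norm_evalEnd_antideriv_pow_le _ (by omega) (by omega) hw)
        (abs_nonneg _))
      (mul_le_mul_of_nonneg_left (norm_evalEnd_antideriv_pow_le _ (by omega) (by omega) hw)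
        (abs_nonneg _))
  rw [h1, etaPoly, mul_assoc]
  refine (norm_emb_mulVec_le _ _).trans ?_
  refine mul_le_mul (norm_finOp_map_ofReal_le _) ?_
    (Finset.sum_nonneg fun n _ => mul_nonneg (xi_pos n).le (norm_nonneg _)) (norm_nonneg _)
  rw [Finset.sum_mul]
  refine Finset.sum_le_sum fun n _ => ?_
  -- The weight 2 cancels the factor 1/2 gained at the endpoints.
  refine (mul_le_mul (xi_le_two n) (h3 n) (norm_nonneg _) two_pos.le).trans_eq ?_
  rw [Finset.mul_sum, Finset.sum_mul]
  refine Finset.sum_congr rfl fun j _ => ?_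
  ring

theorem norm_Kop_le (hwell : IsUnit P.bcMatrix.det)
    {σ : Equiv.Perm (Fin (2 * P.m))} {i : Fin (2 * P.m)} (hσ : IsUnit (P.block11 σ i).det)
    {N : ℕ} (hN : 2 * P.m ≤ N) {w : Ell1 ℂ} (hw : ∀ k ≤ N, w k = 0) :
    ‖P.Kop ℂ i w‖ ≤ P.eta σ i (N + 1) * ‖w‖ := by
  rw [Kop_apply, norm_neg_one_pow_smul, eta_eq, add_mul]
  exact (norm_sub_le _ _).trans (add_le_add (norm_antideriv_pow_le (by omega) hw)
    (P.norm_polyPart_le hwell hσ hN hw))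

theorem norm_projGT_le (N : ℕ) (U : Ell1 ℂ) : ‖projGT ℂ N U‖ ≤ ‖U‖ := by
  refine Summable.tsum_le_tsum (fun n => ?_) (summable_weighted _) (summable_weighted _)
  refine mul_le_mul_of_nonneg_left ?_ (xi_pos n).le
  rw [projGT_apply]
  split_ifs <;> simp

/-- The polynomial part has degree less than 2m ≤ N and is removed by the projection; only the
antiderivative contributes. -/
theorem norm_projGT_Kop_le (i : Fin (2 * P.m))
    {N : ℕ} (hN : 2 * P.m ≤ N) {w : Ell1 ℂ} (hw : ∀ k ≤ N, w k = 0) :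
    ‖projGT ℂ N (P.Kop ℂ i w)‖ ≤ gam (2 * P.m - i) (N + 1) * ‖w‖ := by
  have h : projGT ℂ N (P.polyPart i w) = 0 := by
    refine Ell1.ext fun k => ?_
    rw [projGT_apply, zero_apply]
    split_ifs with hk
    · rfl
    · rw [polyPart, emb_apply, dif_neg (by omega)]
  rw [Kop_apply, map_smul, norm_neg_one_pow_smul, map_sub, h, sub_zero]
  exact (norm_projGT_le N _).trans (norm_antideriv_pow_le (by omega) hw)

end BVP

end ChebSpec

end

noncomputable section

namespace ChebSpec

open Filter Topology

/-! ### Complexification -/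

section Complexification

theorem toC_apply (U : Ell1 ℝ) (n : ℕ) : toC U n = (U n : ℂ) := rfl

theorem norm_toC (U : Ell1 ℝ) : ‖toC U‖ = ‖U‖ := by
  rw [norm_def, norm_def]
  simp [toC_apply]

/-- `toC` as a homomorphism of groups. -/
def toCHom : Ell1 ℝ →+ Ell1 ℂ where
  toFun := toC
  map_zero' := Ell1.ext fun n => by simp [toC_apply, zero_apply]
  map_add' U V := Ell1.ext fun n => by simp [toC_apply, add_apply]

theorem toC_sub (U V : Ell1 ℝ) : toC (U - V) = toC U - toC V := map_sub toCHom U V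

theorem toC_sum {ι : Type} (s : Finset ι) (f : ι → Ell1 ℝ) :
    toC (∑ i ∈ s, f i) = ∑ i ∈ s, toC (f i) := map_sum toCHom f s

theorem toC_smul (c : ℝ) (U : Ell1 ℝ) : toC (c • U) = (c : ℂ) • toC U :=
  Ell1.ext fun n => by rw [toC_apply, smul_apply, smul_apply, toC_apply, Complex.ofReal_mul]

theorem toC_unitSeq (k : ℕ) : toC (unitSeq ℝ k) = unitSeq ℂ k :=
  Ell1.ext fun n => by
    rw [toC_apply, unitSeq_apply, unitSeq_apply]
    split_ifs <;> simp

theorem toC_conv (U V : Ell1 ℝ) : toC (conv U V) = conv (toC U) (toC V) :=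
  Ell1.ext fun n => by
    rw [toC_apply, conv_apply, conv_apply, Complex.ofReal_tsum]
    simp [toC_apply]

theorem toC_convPow (U : Ell1 ℝ) (n : ℕ) : toC (convPow U n) = convPow (toC U) n := by
  induction n with
  | zero => exact toC_unitSeq 0
  | succ n ih => rw [convPow, convPow, toC_conv, ih]

theorem toC_convProd (l : List (Ell1 ℝ)) : toC (convProd l) = convProd (l.map toC) := by
  induction l with
  | nil => exact toC_unitSeq 0
  | cons U l ih =>
    change toC (conv U (convProd l)) = conv (toC U) (convProd (l.map toC))
    rw [toC_conv, ih]

theorem toC_antideriv (U : Ell1 ℝ) : toC (antideriv ℝ U) = antideriv ℂ (toC U) :=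
  Ell1.ext fun n => by
    rw [toC_apply, antideriv_apply, antideriv_apply, antiderivSeq, antiderivSeq]
    split_ifs <;> simp [toC_apply]

theorem toC_antideriv_pow (p : ℕ) (U : Ell1 ℝ) :
    toC ((antideriv ℝ ^ p) U) = (antideriv ℂ ^ p) (toC U) := by
  induction p generalizing U with
  | zero => rfl
  | succ p ih => rw [antideriv_pow_succ_apply, antideriv_pow_succ_apply, ih, toC_antideriv]

theorem evalEnd_toC (s : ℤˣ) (U : Ell1 ℝ) : evalEnd ℂ s (toC U) = (evalEnd ℝ s U : ℂ) := by
  change ∑' n, ((xi n * ((s : ℤ) : ℝ) ^ n : ℝ) : ℂ) * toC U n =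
    ((∑' n, ((xi n * ((s : ℤ) : ℝ) ^ n : ℝ)) * U n : ℝ) : ℂ)
  rw [Complex.ofReal_tsum]
  refine tsum_congr fun n => ?_
  rw [toC_apply]
  push_cast
  rfl

namespace BVP

variable (P : BVP)

theorem bcIter_toC (r : Fin (2 * P.m)) (U : Ell1 ℝ) :
    P.bcIter ℂ r (toC U) = (P.bcIter ℝ r U : ℂ) := by
  have h : P.bcIter ℝ r U = ∑ j : Fin (2 * P.m),
      (P.leftRow r j * evalEnd ℝ (-1) ((antideriv ℝ ^ (2 * P.m - j)) U) +
        P.rightRow r j * evalEnd ℝ 1 ((antideriv ℝ ^ (2 * P.m - j)) U)) := by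
    simp only [bcIter, _root_.sum_apply, _root_.add_apply, _root_.smul_apply, smul_eq_mul]
    rfl
  rw [bcIter_apply, h]
  simp only [Complex.ofReal_sum, Complex.ofReal_add, Complex.ofReal_mul, ← toC_antideriv_pow,
    evalEnd_toC]

theorem Kop_toC (i : ℕ) (U : Ell1 ℝ) : P.Kop ℂ i (toC U) = toC (P.Kop ℝ i U) := by
  have h1 : P.Kop ℝ i U = ((-1 : ℝ) ^ (P.m + 1)) • ((antideriv ℝ ^ (2 * P.m - i)) U -
      ∑ n : Fin (2 * P.m), ∑ r : Fin (2 * P.m),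
        ((diffMatrix (2 * P.m)) ^ i * P.bcMatrix⁻¹) n r • P.bcIter ℝ r U • unitSeq ℝ n) := by
    simp only [Kop, _root_.smul_apply, _root_.sub_apply, _root_.sum_apply,
      ContinuousLinearMap.smulRight_apply]
    rfl
  have h2 : P.Kop ℂ i (toC U) = ((-1 : ℂ) ^ (P.m + 1)) • ((antideriv ℂ ^ (2 * P.m - i)) (toC U) -
      ∑ n : Fin (2 * P.m), ∑ r : Fin (2 * P.m),
        ((((diffMatrix (2 * P.m)) ^ i * P.bcMatrix⁻¹) n r : ℝ) : ℂ) •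
          P.bcIter ℂ r (toC U) • unitSeq ℂ n) := by
    simp only [Kop, _root_.smul_apply, _root_.sub_apply, _root_.sum_apply,
      ContinuousLinearMap.smulRight_apply]
    rfl
  rw [h1, h2, toC_smul, toC_sub, toC_sum]
  simp only [toC_sum, toC_smul, toC_unitSeq, toC_antideriv_pow, bcIter_toC]
  push_cast
  rfl

/-- Links the complex derivative at a real point to the real coefficients in which ε is expressed.
-/
theorem Vk_toC (U : Ell1 ℝ) (i : Fin (2 * P.m)) : P.Vk (toC U) i = toC (P.V U i) := by
  rw [Vk, V, toC_smul, toC_conv, toC_convPow, toC_convProd, List.map_map]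
  simp only [Kop_toC, Function.comp_def, toC_convPow]
  simp

end BVP

end Complexification

/-! ### Tail estimates -/

section Tail

/-- The sum of the moduli of the coefficients of index greater than `M`. -/
def tail (V : Ell1 ℂ) (M : ℕ) : ℝ := ∑' k, if M < k then ‖V k‖ else 0

theorem summable_tail (V : Ell1 ℂ) (M : ℕ) : Summable fun k => if M < k then ‖V k‖ else 0 := by
  refine Summable.of_nonneg_of_le (fun k => ?_) (fun k => ?_) (summable_norm V)
  · split_ifs <;> simp
  · split_ifs <;> simp

theorem tail_nonneg (V : Ell1 ℂ) (M : ℕ) : 0 ≤ tail V M :=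
  tsum_nonneg fun k => by split_ifs <;> simp

theorem tail_antitone (V : Ell1 ℂ) {M M' : ℕ} (h : M ≤ M') : tail V M' ≤ tail V M := by
  refine (summable_tail V M').tsum_le_tsum (fun k => ?_) (summable_tail V M)
  by_cases h1 : M' < k
  · rw [if_pos h1, if_pos (h.trans_lt h1)]
  · rw [if_neg h1]
    split_ifs <;> simp

/-- Multiplication by the c-th unit sequence (which is 2T_c for c > 0) shifts by c in both
directions; for c = 0 the two shifts coincide and count once. -/
theorem norm_conv_unitSeq_apply_le (V : Ell1 ℂ) {c n : ℕ} (hc : c ≤ n) :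
    ‖conv V (unitSeq ℂ c) n‖ ≤ (if c = 0 then 0 else ‖V (n + c)‖) + ‖V (n - c)‖ := by
  by_cases h0 : c = 0
  · subst h0
    simp [conv_unitSeq_zero]
  · rw [conv_comm, conv_apply, tsum_eq_sum (s := {-(c : ℤ), (c : ℤ)}), Finset.sum_pair (by omega)]
    · have h1 : ((n : ℤ) - -(c : ℤ)).natAbs = n + c := by omega
      have h2 : ((n : ℤ) - (c : ℤ)).natAbs = n - c := by omega
      rw [h1, h2, if_neg h0]
      simpa [unitSeq_apply] using norm_add_le (V (n + c)) (V (n - c))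
    · intro k hk
      have : k.natAbs ≠ c := by
        intro h
        simp only [Finset.mem_insert, Finset.mem_singleton] at hk
        omega
      simp [unitSeq_apply, this]

/-- A mode n > N is reached only from indices n ± c > N - c. Two shifts with weight 2 give 4 tails,
which is 2 tails times `xi c`; for c = 0 a single shift matches `xi 0 = 1`. -/
theorem norm_projGT_conv_unitSeq_le (V : Ell1 ℂ) {N c : ℕ} (hc : c ≤ N) :
    ‖projGT ℂ N (conv V (unitSeq ℂ c))‖ ≤ 2 * tail V (N - c) * xi c := by
  set g : ℕ → ℝ := fun k => if N - c < k then ‖V k‖ else 0 with hg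
  set h : ℕ → ℝ := fun n => if N < n then ‖V (n - c)‖ else 0 with hh
  have hgs : Summable g := summable_tail V _
  have hg0 : ∀ k, 0 ≤ g k := fun k => by simp only [hg]; split_ifs <;> simp
  have hgc : Summable fun n => g (n + c) := (summable_nat_add_iff c).mpr hgs
  have hhg : ∀ n, h (n + c) = g n := fun n => by
    simp only [hh, hg, Nat.add_sub_cancel]
    exact if_congr (by omega) rfl rfl
  have hhs : Summable h := (summable_nat_add_iff c).mp (by simpa only [hhg] using hgs)
  have hht : ∑' n, h n = tail V (N - c) := by
    rw [← hhs.sum_add_tsum_nat_add c, Finset.sum_eq_zero, zero_add]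
    · simp only [hhg]; rfl
    · intro n hn
      have := Finset.mem_range.mp hn
      simp only [hh]
      rw [if_neg (by omega)]
  have hgt : ∑' n, g (n + c) ≤ tail V (N - c) := by
    have h1 := hgs.sum_add_tsum_nat_add c
    have h2 : 0 ≤ ∑ k ∈ Finset.range c, g k := Finset.sum_nonneg fun k _ => hg0 k
    have h3 : tail V (N - c) = ∑' k, g k := rfl
    linarith
  have hterm : ∀ n, xi n * ‖projGT ℂ N (conv V (unitSeq ℂ c)) n‖ ≤
      2 * ((if c = 0 then 0 else 1) * g (n + c) + h n) := by
    intro n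
    rw [projGT_apply]
    by_cases hn : n ≤ N
    · rw [if_pos hn, norm_zero, mul_zero]
      have : 0 ≤ h n := by simp only [hh]; split_ifs <;> simp
      have := hg0 (n + c)
      split_ifs <;> positivity
    · rw [if_neg hn]
      refine mul_le_mul (xi_le_two n) ((norm_conv_unitSeq_apply_le V (by omega)).trans_eq ?_)
        (norm_nonneg _) two_pos.le
      simp only [hg, hh]
      rw [if_pos (by omega : N - c < n + c), if_pos (by omega : N < n)]
      split_ifs <;> simp
  have hsum : Summable fun n => 2 * ((if c = 0 then 0 else 1) * g (n + c) + h n) :=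
    ((hgc.mul_left _).add hhs).mul_left 2
  rw [norm_def]
  refine ((summable_weighted _).tsum_le_tsum hterm hsum).trans ?_
  rw [tsum_mul_left, (hgc.mul_left _).tsum_add hhs, tsum_mul_left, hht, xi]
  have := tail_nonneg V (N - c)
  split_ifs <;> linarith

theorem conv_sum {ι : Type} (s : Finset ι) (V : Ell1 ℂ) (f : ι → Ell1 ℂ) :
    conv V (∑ i ∈ s, f i) = ∑ i ∈ s, conv V (f i) :=
  map_sum (⟨⟨conv V, by simpa using conv_smul (0 : ℂ) V 0⟩, conv_add V⟩ : Ell1 ℂ →+ Ell1 ℂ) f s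

theorem norm_projGT_conv_emb_le (V : Ell1 ℂ) {N d : ℕ} (hd : d ≤ N) (q : Fin d → ℂ) :
    ‖projGT ℂ N (conv V (emb ℂ d q))‖ ≤ 2 * tail V (N - d) * ‖emb ℂ d q‖ := by
  rw [norm_emb, Finset.mul_sum, emb_eq, conv_sum, map_sum]
  refine (norm_sum_le _ _).trans (Finset.sum_le_sum fun n _ => ?_)
  rw [conv_smul, map_smul, norm_smul]
  have h1 := norm_projGT_conv_unitSeq_le V (N := N) (c := n) (by have := n.2; omega)
  have h2 : 2 * tail V (N - n) * xi n ≤ 2 * tail V (N - d) * xi n :=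
    mul_le_mul_of_nonneg_right
      (mul_le_mul_of_nonneg_left (tail_antitone V (by have := n.2; omega)) two_pos.le)
      (xi_pos n).le
  calc _ ≤ ‖q n‖ * (2 * tail V (N - d) * xi n) :=
        mul_le_mul_of_nonneg_left (h1.trans h2) (norm_nonneg _)
    _ = _ := by ring

end Tail

/-! ### High-mode blocks of the pencil: the constants ε and η₀. -/

namespace BVP

variable (P : BVP)

/-- The antiderivative part is small outright. The polynomial part has low degree, so its product
with V passes mode N only through high coefficients of V. -/
theorem norm_projGT_conv_Kop_le (hwell : IsUnit P.bcMatrix.det)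
    {σ : Equiv.Perm (Fin (2 * P.m))} {i : Fin (2 * P.m)} (hσ : IsUnit (P.block11 σ i).det)
    {N : ℕ} (hN : 2 * P.m ≤ N) (V : Ell1 ℂ) {w : Ell1 ℂ} (hw : ∀ k ≤ N, w k = 0) :
    ‖projGT ℂ N (conv V (P.Kop ℂ i w))‖ ≤
      (2 * P.eta σ i (N + 1) * tail V (N - 2 * P.m + i) +
        ‖V‖ * gam (2 * P.m - i) (N + 1)) * ‖w‖ := by
  have hi := i.2
  have hsub : ∀ U W : Ell1 ℂ, conv V (U - W) = conv V U - conv V W := fun U W => by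
    rw [sub_eq_add_neg, conv_add, ← neg_one_smul ℂ W, conv_smul, neg_one_smul, sub_eq_add_neg]
  rw [Kop_apply, conv_smul, map_smul, norm_neg_one_pow_smul, hsub, map_sub]
  have h1 : ‖projGT ℂ N (conv V ((antideriv ℂ ^ (2 * P.m - i)) w))‖ ≤
      ‖V‖ * (gam (2 * P.m - i) (N + 1) * ‖w‖) :=
    (norm_projGT_le N _).trans ((norm_conv_le _ _).trans
      (mul_le_mul_of_nonneg_left (norm_antideriv_pow_le (by omega) hw) (norm_nonneg _)))
  have h2 : ‖projGT ℂ N (conv V (P.polyPart i w))‖ ≤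
      2 * tail V (N - 2 * P.m + i) * (P.eta σ i (N + 1) * ‖w‖) := by
    refine (norm_projGT_conv_emb_le V (by omega) _).trans ?_
    rw [show N - (2 * P.m - i) = N - 2 * P.m + i by omega]
    refine mul_le_mul_of_nonneg_left ?_ (mul_nonneg two_pos.le (tail_nonneg _ _))
    refine (P.norm_polyPart_le hwell hσ hN hw).trans ?_
    refine mul_le_mul_of_nonneg_right ?_ (norm_nonneg _)
    rw [eta_eq]
    linarith [gam_nonneg (p := 2 * P.m - i) (k := N + 1) (by omega)]
  refine (norm_sub_le _ _).trans ((add_le_add h1 h2).trans_eq ?_)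
  ring

theorem norm_projGT_fderiv_le (hwell : IsUnit P.bcMatrix.det)
    {σ : Fin (2 * P.m) → Equiv.Perm (Fin (2 * P.m))} (hσ : ∀ i, IsUnit (P.block11 (σ i) i).det)
    {N : ℕ} (hN : 2 * P.m ≤ N) (Ubar : Ell1 ℝ) {w : Ell1 ℂ} (hw : ∀ k ≤ N, w k = 0) :
    ‖projGT ℂ N (fderiv ℂ (P.K ℂ) (toC Ubar) w)‖ ≤
      (∑ i : Fin (2 * P.m), (2 * P.eta (σ i) i (N + 1) *
        (∑' k : ℕ, if N - 2 * P.m + i < k then |P.V Ubar i k| else 0) +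
          ‖P.V Ubar i‖ * gam (2 * P.m - i) (N + 1))) * ‖w‖ := by
  obtain ⟨D, hD, hDw⟩ := P.hasFDerivAt_K (toC Ubar)
  rw [hD.fderiv, hDw, map_sum, Finset.sum_mul]
  refine (norm_sum_le _ _).trans (Finset.sum_le_sum fun i _ => ?_)
  refine (P.norm_projGT_conv_Kop_le hwell (hσ i) hN _ hw).trans_eq ?_
  rw [Vk_toC, norm_toC, tail]
  simp [toC_apply]

theorem norm_projGT_sub_smul_le (hwell : IsUnit P.bcMatrix.det) (hm : 0 < P.m)
    {σ : Fin (2 * P.m) → Equiv.Perm (Fin (2 * P.m))} (hσ : ∀ i, IsUnit (P.block11 (σ i) i).det)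
    {N : ℕ} (hN : 2 * P.m ≤ N) (Ubar : Ell1 ℝ) {D : Ell1 ℂ →L[ℂ] Ell1 ℂ} {lmax ζ : ℝ}
    (hD : ‖projGT ℂ N ∘L (fderiv ℂ (P.K ℂ) (toC Ubar) - D)‖ ≤ ζ) {z : ℂ} (hz : ‖z‖ ≤ lmax) :
    ‖projGT ℂ N ∘L (D - z • P.Linv ℂ) ∘L projGT ℂ N‖ ≤ P.eps σ N Ubar lmax ζ := by
  have hζ : 0 ≤ ζ := (norm_nonneg _).trans hD
  have hlm : 0 ≤ lmax := (norm_nonneg _).trans hz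
  have hgam : ∀ p ≤ 2 * P.m, 0 ≤ gam p (N + 1) := fun p hp => gam_nonneg (by omega)
  have heta : ∀ i : Fin (2 * P.m), 0 ≤ P.eta (σ i) i (N + 1) := fun i => by
    rw [eta_eq]
    refine add_nonneg (hgam _ (by omega)) (mul_nonneg (norm_nonneg _) ?_)
    exact Finset.sum_nonneg fun n _ => Finset.sum_nonneg fun j _ =>
      mul_nonneg (add_nonneg (abs_nonneg _) (abs_nonneg _)) (hgam _ (by omega))
  have hS : 0 ≤ ∑ i : Fin (2 * P.m), (2 * P.eta (σ i) i (N + 1) *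
        (∑' k : ℕ, if N - 2 * P.m + i < k then |P.V Ubar i k| else 0) +
          ‖P.V Ubar i‖ * gam (2 * P.m - i) (N + 1)) := by
    refine Finset.sum_nonneg fun i _ => add_nonneg (mul_nonneg (mul_nonneg two_pos.le (heta i)) ?_)
      (mul_nonneg (norm_nonneg _) (hgam _ (by omega)))
    exact tsum_nonneg fun k => by split_ifs <;> simp
  have hε : 0 ≤ P.eps σ N Ubar lmax ζ :=
    add_nonneg (add_nonneg hS hζ) (mul_nonneg hlm (hgam _ le_rfl))
  refine ContinuousLinearMap.opNorm_le_bound _ hε fun u => ?_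
  set w := projGT ℂ N u with hw
  have hw0 : ∀ k ≤ N, w k = 0 := fun k hk => by rw [hw, projGT_apply, if_pos hk]
  have h1 := P.norm_projGT_fderiv_le hwell hσ hN Ubar hw0
  have h2 : ‖projGT ℂ N ((fderiv ℂ (P.K ℂ) (toC Ubar) - D) w)‖ ≤ ζ * ‖w‖ :=
    (projGT ℂ N ∘L (fderiv ℂ (P.K ℂ) (toC Ubar) - D)).le_of_opNorm_le hD w
  have h3 : ‖projGT ℂ N (P.Linv ℂ w)‖ ≤ gam (2 * P.m) (N + 1) * ‖w‖ :=
    P.norm_projGT_Kop_le ⟨0, by omega⟩ hN hw0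
  have h4 : (projGT ℂ N ∘L (D - z • P.Linv ℂ) ∘L projGT ℂ N) u =
      projGT ℂ N (fderiv ℂ (P.K ℂ) (toC Ubar) w) -
        projGT ℂ N ((fderiv ℂ (P.K ℂ) (toC Ubar) - D) w) - z • projGT ℂ N (P.Linv ℂ w) := by
    simp only [ContinuousLinearMap.comp_apply, _root_.sub_apply, _root_.smul_apply, map_sub,
      map_smul, ← hw]
    abel
  have h5 : ‖z • projGT ℂ N (P.Linv ℂ w)‖ ≤ lmax * (gam (2 * P.m) (N + 1) * ‖w‖) := by
    rw [norm_smul]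
    exact mul_le_mul hz h3 (norm_nonneg _) hlm
  rw [h4]
  refine (norm_sub_le _ _).trans ((add_le_add ((norm_sub_le _ _).trans (add_le_add h1 h2))
    h5).trans ?_)
  refine le_trans (le_of_eq ?_) (mul_le_mul_of_nonneg_left (norm_projGT_le N u) hε)
  rw [eps]
  ring

theorem norm_Linv_projGT_le (hwell : IsUnit P.bcMatrix.det) (i : Fin (2 * P.m))
    (hi : (i : ℕ) = 0) {σ : Equiv.Perm (Fin (2 * P.m))} (hσ : IsUnit (P.block11 σ i).det)
    {N : ℕ} (hN : 2 * P.m ≤ N) :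
    ‖P.Linv ℂ ∘L projGT ℂ N‖ ≤ P.eta σ i (N + 1) := by
  have heta : 0 ≤ P.eta σ i (N + 1) := by
    rw [eta_eq]
    refine add_nonneg (gam_nonneg (by omega)) (mul_nonneg (norm_nonneg _) ?_)
    exact Finset.sum_nonneg fun n _ => Finset.sum_nonneg fun j _ =>
      mul_nonneg (add_nonneg (abs_nonneg _) (abs_nonneg _)) (gam_nonneg (by omega))
  refine ContinuousLinearMap.opNorm_le_bound _ heta fun u => ?_
  have hw0 : ∀ k ≤ N, projGT ℂ N u k = 0 := fun k hk => by rw [projGT_apply, if_pos hk]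
  have := P.norm_Kop_le hwell hσ hN hw0
  rw [hi] at this
  exact this.trans (mul_le_mul_of_nonneg_left (norm_projGT_le N u) heta)

end BVP

end ChebSpec

end

noncomputable section

namespace ChebSpec

open Filter Topology

/-! ### Block elimination in a normed algebra -/

section Schur

variable {R : Type} [NormedRing R]

/-- The Neumann bound without the series: EW = E - E(EW) gives ‖EW‖ ≤ ε + ε‖EW‖. -/
theorem norm_mul_of_eq_one_sub_mul {E W : R} {ε : ℝ} (hE : ‖E‖ ≤ ε) (hε : ε < 1)
    (hW : W = 1 - E * W) : ‖E * W‖ ≤ ε / (1 - ε) := by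
  have h1 : E * W = E - E * (E * W) := by
    conv_lhs => rw [hW]
    rw [mul_sub, mul_one]
  have h2 : ‖E * W‖ ≤ ε + ε * ‖E * W‖ := by
    conv_lhs => rw [h1]
    exact (norm_sub_le _ _).trans (add_le_add hE ((norm_mul_le _ _).trans
      (mul_le_mul_of_nonneg_right hE (norm_nonneg _))))
  rw [le_div_iff₀ (by linarith)]
  linarith

variable {p q a b K Kb L D W : R}

/-- 1 + Dq is block triangular, with the identity on the p-block and 1 + qDq on the q-block; its
inverse is found by back substitution. Multiplying 1 + D by that inverse leaves the Schur complement
in the p-corner. -/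
theorem schur_identities (hpq : p + q = 1) (hp : p * p = p) (hq : q * q = q)
    (hW : W * (1 + q * D * q) = 1) (hW' : (1 + q * D * q) * W = 1) :
    (W - p * D * q * W) * (1 + D * q) = 1 ∧ (1 + D * q) * (W - p * D * q * W) = 1 ∧
      p * ((W - p * D * q * W) * (1 + D)) * p = p + p * D * p - p * D * q * W * q * D * p := by
  have hqe : q = 1 - p := by rw [← hpq]; abel
  have hqp : q * p = 0 := by rw [hqe, sub_mul, hp, one_mul, sub_self]
  have hpq0 : p * q = 0 := by rw [hqe, mul_sub, hp, mul_one, sub_self]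
  have hWp : W * p = p := by
    calc W * p = W * (1 + q * D * q) * p := by
          rw [mul_assoc, add_mul, mul_assoc (q * D), hqp, mul_zero, add_zero, one_mul]
      _ = p := by rw [hW, one_mul]
  have hpW : p * W = p := by
    calc p * W = p * ((1 + q * D * q) * W) := by
          rw [← mul_assoc, mul_add, ← mul_assoc p, ← mul_assoc p, hpq0, zero_mul, zero_mul,
            add_zero, mul_one]
      _ = p := by rw [hW', mul_one]
  have hC : 1 + D * q = (1 + q * D * q) + p * D * q := by
    rw [add_assoc, ← add_mul, ← add_mul, add_comm q p, hpq, one_mul]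
  have hqWp : q * W * p = 0 := by rw [mul_assoc, hWp, hqp]
  have hqW : q * W = W * q := by rw [hqe, sub_mul, mul_sub, one_mul, mul_one, hWp, hpW]
  refine ⟨?_, ?_, ?_⟩
  · have h1 : (W - p * D * q * W) * (1 + D * q) =
        W * (1 + q * D * q) - p * D * q * (W * (1 + q * D * q)) + (W * p) * D * q -
          p * D * (q * W * p) * D * q := by
      rw [hC]; noncomm_ring
    rw [h1, hW, hWp, hqWp]
    noncomm_ring
  · have h1 : (1 + D * q) * (W - p * D * q * W) =
        (1 + q * D * q) * W + p * D * q * W - p * D * q * W - q * D * (q * p) * D * q * W -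
          p * D * (q * p) * D * q * W := by
      rw [hC]; noncomm_ring
    rw [h1, hW', hqp]
    noncomm_ring
  · have h1 : p * ((W - p * D * q * W) * (1 + D)) * p =
        (p * W) * p + (p * W) * D * p - (p * p) * D * (q * W * p) - (p * p) * D * (q * W) * D * p := by
      noncomm_ring
    have h2 : p * D * q * W * q * D * p = p * D * ((q * W) * q) * D * p := by noncomm_ring
    have h3 : (q * W) * q = q * W := by rw [hqW, mul_assoc, hq]
    rw [h1, h2, h3, hpW, hp, hqWp]
    noncomm_ring

variable [NormedAlgebra ℂ R] {z : ℂ}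

/-- Replace W by 1 - qDqW. The leading term aDqDb is a quadratic polynomial in z, whose coefficients
are estimated as whole products after passing from K to Kb; the remainder carries the factor ε/(1 -
ε) and is estimated factor by factor. -/
theorem norm_schur_correction_le (hq : q * q = q) (hD : D = K - z • L) {lmax ε : ℝ} (hz : ‖z‖ ≤ lmax)
    (hE : ‖q * D * q‖ ≤ ε) (hε : ε < 1) (hW : W = 1 - q * D * q * W)
    {η₀ ζ ζ' β₀₁ β₀₂ β₁₁ β₁₂ β₁₃ β₁₄ β₂₁ β₂₂ : ℝ}
    (hη : ‖L * q‖ ≤ η₀) (hζ : ‖q * (Kb - K)‖ ≤ ζ) (hζ' : ‖a * (Kb - K) * q‖ ≤ ζ')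
    (h01 : ‖q * Kb * b‖ + ‖b‖ * ζ ≤ β₀₁)
    (h02 : ‖a * Kb * q * Kb * b‖ + ‖a * Kb * q‖ * ‖b‖ * ζ ≤ β₀₂)
    (h11 : η₀ * ‖a‖ * (‖q * Kb * b‖ + ‖b‖ * ζ) ≤ β₁₁)
    (h12 : ‖q * L * b‖ ≤ β₁₂)
    (h13 : ‖a * Kb * q * L * b‖ ≤ β₁₃)
    (h14 : ‖a * Kb * q‖ + ζ' ≤ β₁₄)
    (h21 : ‖a * L * q * L * b‖ ≤ β₂₁)
    (h22 : η₀ * ‖a‖ ≤ β₂₂) :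
    ‖a * D * q * W * q * D * b‖ ≤
      (β₂₁ + ε / (1 - ε) * (β₁₂ * β₂₂)) * lmax ^ 2 +
      (β₁₁ + β₁₃ + ζ' * β₁₂ + ε / (1 - ε) * (β₁₂ * β₁₄ + β₀₁ * β₂₂)) * lmax +
      (β₀₂ + ζ' * β₀₁ + ε / (1 - ε) * (β₀₁ * β₁₄)) := by
  have hl : 0 ≤ lmax := (norm_nonneg _).trans hz
  have hζ0 : 0 ≤ ζ := (norm_nonneg _).trans hζ
  have hζ0' : 0 ≤ ζ' := (norm_nonneg _).trans hζ'
  have hη0 : 0 ≤ η₀ := (norm_nonneg _).trans hη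
  have hε0 : 0 ≤ ε := (norm_nonneg _).trans hE
  have hr : 0 ≤ ε / (1 - ε) := div_nonneg hε0 (by linarith)
  have hβ12 : 0 ≤ β₁₂ := (norm_nonneg _).trans h12
  have eqKb : ‖q * K * b‖ ≤ ‖q * Kb * b‖ + ‖b‖ * ζ := by
    have : q * K * b = q * Kb * b - q * (Kb - K) * b := by noncomm_ring
    rw [this]
    refine (norm_sub_le _ _).trans (add_le_add le_rfl ((norm_mul_le _ _).trans ?_))
    rw [mul_comm]
    exact mul_le_mul_of_nonneg_left hζ (norm_nonneg _)
  have eaLq : ‖a * L * q‖ ≤ η₀ * ‖a‖ := by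
    rw [mul_assoc, mul_comm η₀]
    exact (norm_mul_le _ _).trans (mul_le_mul_of_nonneg_left hη (norm_nonneg _))
  have t0 : ‖a * K * q * (q * K * b)‖ ≤ β₀₂ + ζ' * β₀₁ := by
    have e : a * K * q * (q * K * b) = a * Kb * (q * q) * Kb * b -
        a * Kb * q * (q * (Kb - K)) * b - a * (Kb - K) * q * (q * K * b) := by noncomm_ring
    rw [e, hq]
    refine (norm_sub_le _ _).trans (add_le_add ((norm_sub_le _ _).trans (le_trans ?_ h02)) ?_)
    · refine add_le_add le_rfl ((norm_mul_le _ _).trans ?_)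
      refine (mul_le_mul_of_nonneg_right ((norm_mul_le _ _).trans
        (mul_le_mul_of_nonneg_left hζ (norm_nonneg _))) (norm_nonneg _)).trans_eq ?_
      ring
    · exact (norm_mul_le _ _).trans (mul_le_mul hζ' (eqKb.trans h01) (norm_nonneg _) hζ0')
  have t13 : ‖a * K * q * (q * L * b)‖ ≤ β₁₃ + ζ' * β₁₂ := by
    have e : a * K * q * (q * L * b) = a * Kb * (q * q) * L * b -
        a * (Kb - K) * q * (q * L * b) := by noncomm_ring
    rw [e, hq]
    exact (norm_sub_le _ _).trans (add_le_add h13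
      ((norm_mul_le _ _).trans (mul_le_mul hζ' h12 (norm_nonneg _) hζ0')))
  have t11 : ‖a * L * q * (q * K * b)‖ ≤ β₁₁ :=
    ((norm_mul_le _ _).trans (mul_le_mul eaLq eqKb (norm_nonneg _)
      (mul_nonneg hη0 (norm_nonneg _)))).trans h11
  have t2 : ‖a * L * q * (q * L * b)‖ ≤ β₂₁ := by
    have e : a * L * q * (q * L * b) = a * L * (q * q) * L * b := by noncomm_ring
    rw [e, hq]
    exact h21
  have eaD : ‖a * D * q‖ ≤ β₁₄ + lmax * β₂₂ := by
    have e : a * D * q = a * Kb * q - a * (Kb - K) * q - z • (a * L * q) := by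
      rw [hD]
      simp only [mul_sub, sub_mul, mul_smul_comm, smul_mul_assoc]
      abel
    rw [e]
    refine (norm_sub_le _ _).trans (add_le_add (((norm_sub_le _ _).trans
      (add_le_add le_rfl hζ')).trans h14) ?_)
    rw [norm_smul]
    exact mul_le_mul hz (eaLq.trans h22) (norm_nonneg _) hl
  have eDb : ‖q * D * b‖ ≤ β₀₁ + lmax * β₁₂ := by
    have e : q * D * b = q * K * b - z • (q * L * b) := by
      rw [hD]
      simp only [mul_sub, sub_mul, mul_smul_comm, smul_mul_assoc]
    rw [e]
    refine (norm_sub_le _ _).trans (add_le_add (eqKb.trans h01) ?_)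
    rw [norm_smul]
    exact mul_le_mul hz h12 (norm_nonneg _) hl
  have t3 : ‖a * D * q * (q * D * q * W) * (q * D * b)‖ ≤
      (β₁₄ + lmax * β₂₂) * (ε / (1 - ε)) * (β₀₁ + lmax * β₁₂) := by
    have h0 := (norm_nonneg _).trans eaD
    have h1 := norm_mul_of_eq_one_sub_mul hE hε hW
    exact (norm_mul_le _ _).trans (mul_le_mul ((norm_mul_le _ _).trans
      (mul_le_mul eaD h1 (norm_nonneg _) h0)) eDb (norm_nonneg _) (mul_nonneg h0 hr))
  have e : a * D * q * W * q * D * b = a * K * q * (q * K * b) - z • (a * K * q * (q * L * b)) -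
      z • (a * L * q * (q * K * b)) + (z ^ 2) • (a * L * q * (q * L * b)) -
        a * D * q * (q * D * q * W) * (q * D * b) := by
    have e1 : a * D * q * W * q * D * b = a * D * q * (1 - q * D * q * W) * q * D * b := by
      rw [← hW]
    have e2 : a * D * q * (1 - q * D * q * W) * q * D * b =
        a * D * q * (q * D * b) - a * D * q * (q * D * q * W) * (q * D * b) := by noncomm_ring
    have e3 : a * D * q * (q * D * b) = a * K * q * (q * K * b) - z • (a * K * q * (q * L * b)) -
        z • (a * L * q * (q * K * b)) + (z ^ 2) • (a * L * q * (q * L * b)) := by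
      rw [hD]
      simp only [mul_sub, sub_mul, mul_smul_comm, smul_mul_assoc, smul_sub, smul_smul, pow_two]
      abel
    rw [e1, e2, e3]
  rw [e]
  have n1 : ‖z • (a * K * q * (q * L * b))‖ ≤ lmax * (β₁₃ + ζ' * β₁₂) := by
    rw [norm_smul]; exact mul_le_mul hz t13 (norm_nonneg _) hl
  have n2 : ‖z • (a * L * q * (q * K * b))‖ ≤ lmax * β₁₁ := by
    rw [norm_smul]; exact mul_le_mul hz t11 (norm_nonneg _) hl
  have n3 : ‖(z ^ 2) • (a * L * q * (q * L * b))‖ ≤ lmax ^ 2 * β₂₁ := by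
    rw [norm_smul, norm_pow]
    exact mul_le_mul (pow_le_pow_left₀ (norm_nonneg _) hz 2) t2 (norm_nonneg _) (by positivity)
  refine (norm_sub_le _ _).trans ((add_le_add ((norm_add_le _ _).trans (add_le_add
    ((norm_sub_le _ _).trans (add_le_add ((norm_sub_le _ _).trans (add_le_add t0 n1)) n2)) n3))
    t3).trans_eq ?_)
  ring

/-- The distance to the diagonal model p - z·Mm consists of the off-diagonal part z·Rm, the Schur
correction and the two defects X₁, X₂ of the approximate inverse. -/
theorem norm_schur_sub_le (ha : a * p = a) (hb : p * b = b) (hD : D = K - z • L)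
    {X₁ X₂ Rm Mm : R} (hab : a * (1 + K) * b = p - X₁ - X₂) (hM : a * L * b = Rm + Mm)
    {lmax z₁ z₂ c : ℝ} (hz : ‖z‖ ≤ lmax) (h1 : ‖X₁‖ ≤ z₁) (h2 : ‖X₂‖ ≤ z₂)
    (hc : ‖a * D * q * W * q * D * b‖ ≤ c) :
    ‖a * (p + p * D * p - p * D * q * W * q * D * p) * b - (p - z • Mm)‖ ≤
      lmax * ‖Rm‖ + c + z₁ + z₂ := by
  have e1 : a * (p + p * D * p - p * D * q * W * q * D * p) * b =
      (a * p) * b + (a * p) * D * (p * b) - (a * p) * D * q * W * q * D * (p * b) := by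
    noncomm_ring
  have e2 : a * b + a * D * b = a * (1 + K) * b - z • (a * L * b) := by
    rw [hD]
    simp only [mul_sub, sub_mul, mul_add, add_mul, mul_one, mul_smul_comm, smul_mul_assoc]
    abel
  have e3 : a * (p + p * D * p - p * D * q * W * q * D * p) * b - (p - z • Mm) =
      -(z • Rm) - a * D * q * W * q * D * b - X₁ - X₂ := by
    rw [e1, ha, hb, e2, hab, hM, smul_add]
    abel
  rw [e3]
  refine (norm_sub_le _ _).trans (add_le_add ((norm_sub_le _ _).trans (add_le_add
    ((norm_sub_le _ _).trans (add_le_add ?_ hc)) h1)) h2)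
  rw [norm_neg, norm_smul]
  exact mul_le_mul_of_nonneg_right hz (norm_nonneg _)

end Schur

/-! ### Diagonally dominant matrices and disks -/

theorem mem_disk {δ : ℝ} {μ z : ℂ} : z ∈ disk δ μ ↔ ‖1 - z * μ‖ ≤ δ := by
  rw [disk]
  split_ifs with h
  · simp [h]
  · have h1 : z - 1 / μ = -((1 - z * μ) * (1 / μ)) := by field_simp; ring
    rw [Metric.mem_closedBall, dist_eq_norm, h1, norm_neg, norm_mul]
    exact mul_le_mul_iff_left₀ (norm_pos_iff.mpr (one_div_ne_zero h))

theorem isClosed_disk (δ : ℝ) (μ : ℂ) : IsClosed (disk δ μ) := by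
  have : disk δ μ = {z | ‖1 - z * μ‖ ≤ δ} := Set.ext fun z => mem_disk
  rw [this]
  exact isClosed_le (by fun_prop) continuous_const

/-- The weighted ℓ¹ norm is monotone in the moduli of the coordinates, so a diagonal matrix expands
every vector by at least its smallest entry. On a kernel vector this is balanced against t‖G‖ ≤ δ.
-/
theorem exists_mem_disk_of_det_eq_zero {N : ℕ} {μ : Fin (N + 1) → ℂ}
    {G : Matrix (Fin (N + 1)) (Fin (N + 1)) ℂ} {δ t : ℝ} (ht : t ∈ Set.Icc (0 : ℝ) 1)
    (hG : ‖finOp G‖ ≤ δ) {z : ℂ}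
    (hdet : (Matrix.diagonal (fun j => 1 - z * μ j) + (t : ℂ) • G).det = 0) :
    ∃ j, z ∈ disk δ (μ j) := by
  obtain ⟨v, hv, hv0⟩ := Matrix.exists_mulVec_eq_zero_iff.mpr hdet
  obtain ⟨j, _, hj⟩ := Finset.exists_min_image Finset.univ (fun j => ‖1 - z * μ j‖)
    Finset.univ_nonempty
  refine ⟨j, mem_disk.mpr ?_⟩
  have hpos : 0 < ‖emb ℂ (N + 1) v‖ :=
    norm_pos_iff.mpr fun h => hv (emb_injective (h.trans (map_zero _).symm))
  have h1 := mul_norm_le_norm_emb_diagonal (a := fun j => 1 - z * μ j)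
    (fun k => hj k (Finset.mem_univ k)) v
  have h2 : (Matrix.diagonal fun j => 1 - z * μ j).mulVec v = -((t : ℂ) • G.mulVec v) := by
    rw [Matrix.add_mulVec, Matrix.smul_mulVec] at hv0
    exact eq_neg_of_add_eq_zero_left hv0
  have h3 : ‖emb ℂ (N + 1) (G.mulVec v)‖ ≤ δ * ‖emb ℂ (N + 1) v‖ := by
    have := (finOp G).le_of_opNorm_le hG (emb ℂ (N + 1) v)
    rwa [finOp_apply, res_emb] at this
  rw [h2, map_neg, norm_neg, map_smul, norm_smul, Complex.norm_real, Real.norm_eq_abs,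
    abs_of_nonneg ht.1] at h1
  have h4 : t * ‖emb ℂ (N + 1) (G.mulVec v)‖ ≤ 1 * (δ * ‖emb ℂ (N + 1) v‖) :=
    mul_le_mul ht.2 h3 (norm_nonneg _) zero_le_one
  exact le_of_mul_le_mul_right (by linarith) hpos

/-- By a Neumann series the composite with B is invertible, so the left factor is surjective;
restricted to the low modes this is surjectivity of A₀. -/
theorem isUnit_det_of_norm_id_sub_lt {N : ℕ} (A₀ : Matrix (Fin (N + 1)) (Fin (N + 1)) ℝ)
    (B : Ell1 ℝ →L[ℝ] Ell1 ℝ)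
    (h : ‖ContinuousLinearMap.id ℝ (Ell1 ℝ) - (finOp A₀ + projGT ℝ N) ∘L B‖ < 1) :
    IsUnit A₀.det := by
  have hu : IsUnit ((finOp A₀ + projGT ℝ N) * B) := by
    have := isUnit_one_sub_of_norm_lt_one
      (x := (1 : Ell1 ℝ →L[ℝ] Ell1 ℝ) - (finOp A₀ + projGT ℝ N) * B) h
    rwa [sub_sub_cancel] at this
  obtain ⟨X, hX⟩ := hu.exists_right_inv
  rw [← Matrix.isUnit_iff_isUnit_det, ← Matrix.mulVec_surjective_iff_isUnit]
  intro v
  have h1 := congrArg (fun T : Ell1 ℝ →L[ℝ] Ell1 ℝ => T (emb ℝ (N + 1) v)) hX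
  set u := B (X (emb ℝ (N + 1) v))
  have h2 : finOp A₀ u + projGT ℝ N u = emb ℝ (N + 1) v := h1
  refine ⟨res ℝ (N + 1) u, ?_⟩
  have h3 : res ℝ (N + 1) (projGT ℝ N u) = 0 := by
    funext k
    rw [res_apply, projGT_apply, if_pos (by omega)]
    rfl
  have h4 := congrArg (res ℝ (N + 1)) h2
  rwa [map_add, h3, add_zero, finOp_apply, res_emb, res_emb] at h4

end ChebSpec

end

noncomputable section

namespace ChebSpec

open Filter Topology

/-! ### Counting zeros of determinants -/

section Count

theorem analyticAt_det {E : Type} [NormedAddCommGroup E] [NormedSpace ℂ E] {d : ℕ}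
    {M : E → Matrix (Fin d) (Fin d) ℂ} {x : E}
    (h : ∀ n c, AnalyticAt ℂ (fun y => M y n c) x) : AnalyticAt ℂ (fun y => (M y).det) x := by
  simp only [Matrix.det_apply']
  exact Finset.analyticAt_fun_sum _ fun τ _ =>
    analyticAt_const.mul (Finset.analyticAt_fun_prod _ fun i _ => h _ _)

/-- The homotopy diag + tG is run on the open disk minus the disks with j ∉ I, where zeros can only
lie in the compact union over I. -/
theorem count_zeros_det {N : ℕ} {μ : Fin (N + 1) → ℂ}
    {G : ℂ → Matrix (Fin (N + 1)) (Fin (N + 1)) ℂ} {δ lmax : ℝ} (hlmax : 0 < lmax)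
    (hG : ∀ z ∈ Metric.ball (0 : ℂ) lmax, ‖finOp (G z)‖ ≤ δ)
    (hGan : ∀ z ∈ Metric.ball (0 : ℂ) lmax, ∀ n c, AnalyticAt ℂ (fun w => G w n c) z)
    (I : Finset (Fin (N + 1))) (hI : ∀ j ∈ I, μ j ≠ 0)
    (hsub : (⋃ j ∈ I, disk δ (μ j)) ⊆ Metric.ball 0 lmax)
    (hdisj : Disjoint (⋃ j ∈ I, disk δ (μ j)) (⋃ j ∈ Iᶜ, disk δ (μ j))) :
    (∀ z ∈ ⋃ j ∈ I, disk δ (μ j),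
      analyticOrderAt (fun z => (Matrix.diagonal (fun j => 1 - z * μ j) + G z).det) z ≠ ⊤) ∧
    {z | z ∈ (⋃ j ∈ I, disk δ (μ j)) ∧
      (Matrix.diagonal (fun j => 1 - z * μ j) + G z).det = 0}.Finite ∧
    ∑ᶠ z ∈ ⋃ j ∈ I, disk δ (μ j),
      analyticOrderNatAt (fun z => (Matrix.diagonal (fun j => 1 - z * μ j) + G z).det) z =
        I.card := by
  classical
  set Ω := ⋃ j ∈ I, disk δ (μ j) with hΩ
  set Ω' := ⋃ j ∈ Iᶜ, disk δ (μ j) with hΩ'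
  set U := Metric.ball (0 : ℂ) lmax \ Ω' with hU
  -- Nonnegativity puts every finite centre 1/μⱼ in its own disk; by disjointness no centre with j ∉
  -- I can lie in Ω.
  have hδ : 0 ≤ δ := (norm_nonneg _).trans (hG 0 (Metric.mem_ball_self hlmax))
  have hUo : IsOpen U := Metric.isOpen_ball.sdiff
    (isClosed_biUnion_finset fun j _ => isClosed_disk δ (μ j))
  have hΩc : IsCompact Ω := by
    refine Metric.isCompact_of_isClosed_isBounded
      (isClosed_biUnion_finset fun j _ => isClosed_disk δ (μ j))
      (Metric.isBounded_ball.subset hsub)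
  have hΩU : Ω ⊆ U := fun z hz => ⟨hsub hz, fun hz' => Set.disjoint_left.mp hdisj hz hz'⟩
  let h : ℂ → ℂ → ℂ := fun t z => (Matrix.diagonal (fun j => 1 - z * μ j) + t • G z).det
  have hz : ∀ t ∈ Set.Icc (0 : ℝ) 1, ∀ z ∈ U, h t z = 0 → z ∈ Ω := by
    intro t ht z hz h0
    obtain ⟨j, hj⟩ := exists_mem_disk_of_det_eq_zero ht (hG z hz.1) h0
    by_cases hjI : j ∈ I
    · exact Set.mem_biUnion (by exact hjI) hj
    · exact absurd (Set.mem_biUnion (Finset.mem_coe.mpr (Finset.mem_compl.mpr hjI)) hj) hz.2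
  have han : AnalyticOnNhd ℂ (fun p : ℂ × ℂ => h p.1 p.2) (Set.univ ×ˢ U) := by
    rintro ⟨t, z⟩ ⟨_, hzU⟩
    refine analyticAt_det (M := fun p : ℂ × ℂ =>
      Matrix.diagonal (fun j => 1 - p.2 * μ j) + p.1 • G p.2) fun n c => ?_
    simp only [Matrix.add_apply, Matrix.smul_apply, smul_eq_mul, Matrix.diagonal_apply]
    refine AnalyticAt.add ?_ (analyticAt_fst.mul
      (AnalyticAt.fun_comp (g := fun w => G w n c) (hGan z hzU.1 n c) analyticAt_snd))
    split_ifs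
    · exact analyticAt_const.sub (analyticAt_snd.mul analyticAt_const)
    · exact analyticAt_const
  have hslice : ∀ t : ℂ, AnalyticOnNhd ℂ (h t) U := fun t => analyticOnNhd_slice han t
  have h1 : (fun z => (Matrix.diagonal (fun j => 1 - z * μ j) + G z).det) = h 1 := by
    funext z
    simp only [h, one_smul]
  have h1' : ∀ z, (Matrix.diagonal (fun j => 1 - z * μ j) + G z).det = h 1 z := fun z =>
    congrFun h1 z
  have htop1 := analyticOrderAt_ne_top_of_zeros hUo hΩc hΩU (hslice 1) (by
    simpa using hz 1 (by simp))
  have htop0 := analyticOrderAt_ne_top_of_zeros hUo hΩc hΩU (hslice 0) (by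
    simpa using hz 0 (by simp))
  simp only [h1']
  refine ⟨fun z hz' => htop1 z (hΩU hz'), finite_zeros_of_isCompact hΩc
    ((hslice 1).mono hΩU) (fun z hz' => htop1 z (hΩU hz')), ?_⟩
  rw [zero_count_eq hUo hΩc hΩU han hz]
  have h0 : ∀ z, h 0 z = ∏ j, (1 - z * μ j) := fun z => by
    simp only [h, zero_smul, add_zero, Matrix.det_diagonal]
  have hmem : ∀ z ∈ Ω, ∀ j, z * μ j = 1 → j ∈ I := by
    intro z hzΩ j hj
    by_contra hjI
    refine Set.disjoint_left.mp hdisj hzΩ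
      (Set.mem_biUnion (Finset.mem_coe.mpr (Finset.mem_compl.mpr hjI)) (mem_disk.mpr ?_))
    rw [hj, sub_self, norm_zero]
    exact hδ
  have hord : ∀ z ∈ Ω, analyticOrderNatAt (h 0) z = (I.filter fun j => 1 / μ j = z).card := by
    intro z hzΩ
    have hfil : (I.filter fun j => 1 / μ j = z) = Finset.univ.filter fun j => z * μ j = 1 := by
      ext j
      simp only [Finset.mem_filter, Finset.mem_univ, true_and]
      constructor
      · rintro ⟨hj, rfl⟩
        exact one_div_mul_cancel (hI j hj)
      · intro hj
        have hjI := hmem z hzΩ j hj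
        exact ⟨hjI, (eq_div_of_mul_eq (hI j hjI) hj).symm⟩
    rw [hfil]
    -- If zμⱼ = 1, then 1 - wμⱼ = -μⱼ(w - z), and all other factors are nonzero at z.
    refine analyticOrderAt_eq_of_eq_mul (hslice 0 z (hΩU hzΩ)) (htop0 z (hΩU hzΩ))
      (u := fun w => (∏ j ∈ Finset.univ.filter (fun j => z * μ j = 1), (-μ j)) *
        ∏ j ∈ Finset.univ.filter (fun j => ¬ z * μ j = 1), (1 - w * μ j)) (by fun_prop)
      (Eventually.of_forall fun w => ?_) ?_
    · rw [h0, ← Finset.prod_filter_mul_prod_filter_not Finset.univ (fun j => z * μ j = 1),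
        mul_right_comm]
      congr 1
      rw [← Finset.prod_const, ← Finset.prod_mul_distrib]
      refine Finset.prod_congr rfl fun j hj => ?_
      rw [← (Finset.mem_filter.mp hj).2]
      ring
    · refine mul_ne_zero (Finset.prod_ne_zero_iff.mpr fun j hj => neg_ne_zero.mpr fun h => ?_)
        (Finset.prod_ne_zero_iff.mpr fun j hj => sub_ne_zero.mpr fun h =>
          (Finset.mem_filter.mp hj).2 h.symm)
      have := (Finset.mem_filter.mp hj).2
      rw [h, mul_zero] at this
      exact zero_ne_one this
  have hs : ∀ j ∈ I, 1 / μ j ∈ Ω := fun j hj => by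
    refine Set.mem_biUnion (Finset.mem_coe.mpr hj) (mem_disk.mpr ?_)
    rw [one_div_mul_cancel (hI j hj), sub_self, norm_zero]
    exact hδ
  rw [finsum_mem_congr rfl hord, finsum_mem_eq_sum_of_inter_support_eq (t := I.image (fun j => 1 / μ j))]
  · exact (Finset.card_eq_sum_card_image (fun j => 1 / μ j) I).symm
  · ext z
    simp only [Set.mem_inter_iff, Function.mem_support, Finset.coe_image, Set.mem_image,
      Finset.mem_coe, ne_eq, Finset.card_eq_zero, ← Finset.nonempty_iff_ne_empty,
      Finset.filter_nonempty_iff]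
    constructor
    · rintro ⟨_, j, hj, rfl⟩
      exact ⟨⟨j, hj, rfl⟩, j, hj, rfl⟩
    · rintro ⟨_, j, hj, rfl⟩
      exact ⟨hs j hj, j, hj, rfl⟩

end Count

/-! ### Finite sections of operators and of the compressed pencil. -/

section SectionMatrix

variable {N : ℕ}

theorem compressedDet_eq_det_sectionMatrix (T L : Ell1 ℂ →L[ℂ] Ell1 ℂ)
    (Cinv : ℂ → Ell1 ℂ →L[ℂ] Ell1 ℂ) (z : ℂ) :
    compressedDet T L (res ℂ (N + 1)) (emb ℂ (N + 1)) Cinv z =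
      (sectionMatrix N (Cinv z * (T - z • L))).det := by
  rw [compressedDet, ← LinearMap.det_toLin']
  congr 1
  refine LinearMap.ext fun v => ?_
  rw [Matrix.toLin'_apply, mulVec_sectionMatrix]
  rfl

theorem sectionMatrix_projLE_mul (T : Ell1 ℂ →L[ℂ] Ell1 ℂ) :
    sectionMatrix N (projLE ℂ N * T * projLE ℂ N) = sectionMatrix N T := by
  have : projLE ℂ N * T * projLE ℂ N = finOp (sectionMatrix N T) := by
    rw [finOp_sectionMatrix]
    rfl
  rw [this, sectionMatrix_finOp]

theorem analyticAt_sectionMatrix {X : ℂ → Ell1 ℂ →L[ℂ] Ell1 ℂ} {z : ℂ} (hX : AnalyticAt ℂ X z)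
    (n c : Fin (N + 1)) : AnalyticAt ℂ (fun w => sectionMatrix N (X w) n c) z :=
  AnalyticAt.fun_comp (g := fun T : Ell1 ℂ →L[ℂ] Ell1 ℂ => (coord ℂ n ∘L
    ContinuousLinearMap.apply ℂ (Ell1 ℂ) (unitSeq ℂ c)) T) (ContinuousLinearMap.analyticAt _ _) hX

theorem projLE_mul_self : projLE ℂ N * projLE ℂ N = projLE ℂ N := by
  refine ContinuousLinearMap.ext fun U => Ell1.ext fun k => ?_
  change projLE ℂ N (projLE ℂ N U) k = _
  rw [projLE_apply, projLE_apply]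
  split_ifs <;> rfl

theorem projGT_mul_self : projGT ℂ N * projGT ℂ N = projGT ℂ N := by
  refine ContinuousLinearMap.ext fun U => Ell1.ext fun k => ?_
  change projGT ℂ N (projGT ℂ N U) k = _
  rw [projGT_apply, projGT_apply]
  split_ifs <;> rfl

theorem projLE_add_projGT : projLE ℂ N + projGT ℂ N = 1 := by
  rw [projGT, add_sub_cancel]
  rfl

theorem finOp_mul_projLE (M : Matrix (Fin (N + 1)) (Fin (N + 1)) ℂ) :
    finOp M * projLE ℂ N = finOp M := by
  rw [← finOp_one, ContinuousLinearMap.mul_def, ← finOp_mul, mul_one]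

theorem projLE_mul_finOp (M : Matrix (Fin (N + 1)) (Fin (N + 1)) ℂ) :
    projLE ℂ N * finOp M = finOp M := by
  rw [← finOp_one, ContinuousLinearMap.mul_def, ← finOp_mul, one_mul]

theorem projGT_of_res_eq_zero {x : Ell1 ℂ} (hx : res ℂ (N + 1) x = 0) : projGT ℂ N x = x := by
  change x - projLE ℂ N x = x
  rw [projLE_eq, hx, map_zero, sub_zero]

end SectionMatrix

theorem BVP.hasFDerivAt_F (P : BVP) {𝕜 : Type} [RCLike 𝕜] (Ψ U : Ell1 𝕜) :
    HasFDerivAt (P.F 𝕜 Ψ) (ContinuousLinearMap.id 𝕜 (Ell1 𝕜) + fderiv 𝕜 (P.K 𝕜) U) U := by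
  obtain ⟨D, hD, _⟩ := P.hasFDerivAt_K U
  rw [hD.fderiv]
  exact ((hasFDerivAt_id U).add hD).add_const Ψ

end ChebSpec

end

/-! ### Enclosure and counting of the eigenvalues. -/

open ChebSpec in
theorem mainTheorem4
    (P : BVP) (hm : 0 < P.m) (hwell : IsUnit P.bcMatrix.det)
    (N : ℕ) (hN : 4 * P.m ≤ N)
    (Ψ Ubar Util : Ell1 ℝ)
    (A₀ : Matrix (Fin (N + 1)) (Fin (N + 1)) ℝ)
    (A : Ell1 ℝ →L[ℝ] Ell1 ℝ) (hA : A = finOp A₀ + projGT ℝ N)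
    -- the Newton-Kantorovich hypotheses
    (Y Z₁ r : ℝ) (Z₂ : ℝ → ℝ) (hY0 : 0 ≤ Y) (hZ₁0 : 0 ≤ Z₁) (hZ₂0 : ∀ s, 0 < s → 0 ≤ Z₂ s)
    (hY : ‖A (P.F ℝ Ψ Ubar)‖ ≤ Y)
    (hZ₁ : ‖ContinuousLinearMap.id ℝ (Ell1 ℝ) - A ∘L fderiv ℝ (P.F ℝ Ψ) Ubar‖ ≤ Z₁)
    (hZ₂ : ∀ s, 0 < s → ∀ h : Ell1 ℝ, h ∈ Metric.closedBall 0 s →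
      ‖A ∘L (fderiv ℝ (P.F ℝ Ψ) (Ubar + h) - fderiv ℝ (P.F ℝ Ψ) Ubar)‖ ≤ Z₂ s * s)
    (hr : 0 < r) (hr1 : 1 / 2 * Z₂ r * r ^ 2 - (1 - Z₁) * r + Y < 0) (hr2 : Z₁ + Z₂ r * r < 1)
    (hUtil : Util ∈ Metric.closedBall Ubar r) (hzero : P.F ℝ Ψ Util = 0)
    -- the operators of the complexified problem
    (L DKbar DKtil DFbar DFtil : Ell1 ℂ →L[ℂ] Ell1 ℂ)
    (hL : L = P.Linv ℂ)
    (hDKbar : DKbar = fderiv ℂ (P.K ℂ) (toC Ubar))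
    (hDKtil : DKtil = fderiv ℂ (P.K ℂ) (toC Util))
    (hDFbar : DFbar = fderiv ℂ (P.F ℂ (toC Ψ)) (toC Ubar))
    (hDFtil : DFtil = fderiv ℂ (P.F ℂ (toC Ψ)) (toC Util))
    (πle πgt : Ell1 ℂ →L[ℂ] Ell1 ℂ) (hπle : πle = projLE ℂ N) (hπgt : πgt = projGT ℂ N)
    -- the finite-dimensional operators, and the pseudo-diagonalized matrix
    (P₀ : Matrix (Fin (N + 1)) (Fin (N + 1)) ℂ) (hP₀ : IsUnit P₀.det)
    (Aop Pop Pinv : Ell1 ℂ →L[ℂ] Ell1 ℂ)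
    (hAop : Aop = finOp (A₀.map fun x => (x : ℂ)))
    (hPop : Pop = finOp P₀) (hPinv : Pinv = finOp P₀⁻¹)
    (M₀ R₀ : Matrix (Fin (N + 1)) (Fin (N + 1)) ℂ) (μ : Fin (N + 1) → ℂ)
    (hM₀ : M₀ = P₀⁻¹ * (A₀.map fun x => (x : ℂ)) * sectionMatrix N L * P₀)
    (hμ : μ = M₀.diag) (hR₀ : R₀ = M₀ - Matrix.diagonal μ)
    -- the orderings of the boundary conditions used in the constants η
    (σ : Fin (2 * P.m) → Equiv.Perm (Fin (2 * P.m)))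
    (hσ : ∀ i, IsUnit (P.block11 (σ i) i).det)
    (η₀ : ℝ) (hη₀ : η₀ = P.eta (σ ⟨0, by omega⟩) ⟨0, by omega⟩ (N + 1))
    -- the bounds
    (lmax : ℝ) (hlmax : 0 < lmax)
    (Z₁P Z₂P Z₂le Z₂gt : ℝ)
    (hZ₁P : ‖Pinv ∘L (πle - Aop ∘L πle ∘L DFbar ∘L πle) ∘L Pop‖ ≤ Z₁P)
    (hZ₂P : ‖Pinv ∘L Aop ∘L πle ∘L (DFbar - DFtil) ∘L πle ∘L Pop‖ ≤ Z₂P * r)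
    (hZ₂le : ‖Aop ∘L πle ∘L (DFbar - DFtil) ∘L πgt‖ ≤ Z₂le * r)
    (hZ₂gt : ‖πgt ∘L (DKbar - DKtil)‖ ≤ Z₂gt * r)
    (β₀₁ β₀₂ β₁₁ β₁₂ β₁₃ β₁₄ β₂₁ β₂₂ : ℝ)
    (hβ₀₁ : ‖πgt ∘L DKbar ∘L πle ∘L Pop‖ + ‖Pop‖ * (Z₂gt * r) ≤ β₀₁)
    (hβ₀₂ : ‖Pinv ∘L Aop ∘L πle ∘L DKbar ∘L πgt ∘L DKbar ∘L πle ∘L Pop‖ +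
      ‖Pinv ∘L Aop ∘L πle ∘L DKbar ∘L πgt‖ * ‖Pop‖ * (Z₂gt * r) ≤ β₀₂)
    (hβ₁₁ : η₀ * ‖Pinv ∘L Aop‖ *
      (‖πgt ∘L DKbar ∘L πle ∘L Pop‖ + ‖Pop‖ * (Z₂gt * r)) ≤ β₁₁)
    (hβ₁₂ : ‖πgt ∘L L ∘L πle ∘L Pop‖ ≤ β₁₂)
    (hβ₁₃ : ‖Pinv ∘L Aop ∘L πle ∘L DKbar ∘L πgt ∘L L ∘L πle ∘L Pop‖ ≤ β₁₃)
    (hβ₁₄ : ‖Pinv ∘L Aop ∘L πle ∘L DKbar ∘L πgt‖ + ‖Pinv‖ * (Z₂le * r) ≤ β₁₄)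
    (hβ₂₁ : ‖Pinv ∘L Aop ∘L πle ∘L L ∘L πgt ∘L L ∘L πle ∘L Pop‖ ≤ β₂₁)
    (hβ₂₂ : η₀ * ‖Pinv ∘L Aop‖ ≤ β₂₂)
    (ε β₀ β₁ β₂ δ : ℝ)
    (hε : ε = P.eps σ N Ubar lmax (Z₂gt * r)) (hε1 : ε < 1)
    (hβ₂ : β₂ = β₂₁ + ε / (1 - ε) * (β₁₂ * β₂₂))
    (hβ₁ : β₁ = β₁₁ + β₁₃ + ‖Pinv‖ * (Z₂le * r) * β₁₂ +
      ε / (1 - ε) * (β₁₂ * β₁₄ + β₀₁ * β₂₂))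
    (hβ₀ : β₀ = β₀₂ + ‖Pinv‖ * (Z₂le * r) * β₀₁ + ε / (1 - ε) * (β₀₁ * β₁₄))
    (hδ : δ = lmax * ‖finOp R₀‖ + β₂ * lmax ^ 2 + β₁ * lmax + β₀ + Z₁P + Z₂P * r) :
    -- enclosure
    (∀ z : ℂ, IsGenEigenvalue DFtil L z → ‖z‖ ≤ lmax → ∃ j, z ∈ disk δ (μ j)) ∧
    -- counting with algebraic multiplicity
    (∀ I : Finset (Fin (N + 1)),
      (∀ j ∈ I, μ j ≠ 0) →
      (⋃ j ∈ I, disk δ (μ j)) ⊆ Metric.ball 0 lmax →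
      Disjoint (⋃ j ∈ I, disk δ (μ j)) (⋃ j ∈ Iᶜ, disk δ (μ j)) →
      ∃ s : Finset ℂ,
        (∀ z, z ∈ s ↔ IsGenEigenvalue DFtil L z ∧ z ∈ ⋃ j ∈ I, disk δ (μ j)) ∧
        (∀ z ∈ s, FiniteDimensional ℂ (maxRootSpace DFtil L z)) ∧
        ∑ z ∈ s, algMult DFtil L z = I.card) := by
  classical
  have hN2 : 2 * P.m ≤ N := by omega
  -- derivatives
  have hKF : ∀ U : Ell1 ℂ, fderiv ℂ (P.F ℂ (toC Ψ)) U = 1 + fderiv ℂ (P.K ℂ) U :=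
    fun U => (P.hasFDerivAt_F (toC Ψ) U).fderiv
  have hDFb : DFbar = 1 + DKbar := by rw [hDFbar, hDKbar, hKF]
  have hDFt : DFtil = 1 + DKtil := by rw [hDFtil, hDKtil, hKF]
  have hdiff : DFbar - DFtil = DKbar - DKtil := by rw [hDFb, hDFt]; abel
  -- the approximate inverse is invertible
  have hA₀ : IsUnit A₀.det := by
    refine isUnit_det_of_norm_id_sub_lt A₀ (fderiv ℝ (P.F ℝ Ψ) Ubar) ?_
    rw [← hA]
    exact hZ₁.trans_lt (by linarith [mul_nonneg (hZ₂0 r hr) hr.le])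
  set Ac : Matrix (Fin (N + 1)) (Fin (N + 1)) ℂ := A₀.map fun x => (x : ℂ)
  have hAcdet : Ac.det ≠ 0 := by
    have h : Ac.det = ((A₀.det : ℝ) : ℂ) := (RingHom.map_det Complex.ofRealHom A₀).symm
    rw [h]
    exact_mod_cast hA₀.ne_zero
  -- algebra of the projections and of the finite operators
  have hpp : πle * πle = πle := by rw [hπle]; exact projLE_mul_self
  have hqq : πgt * πgt = πgt := by rw [hπgt]; exact projGT_mul_self
  have hpq : πle + πgt = 1 := by rw [hπle, hπgt]; exact projLE_add_projGT
  have hAp : Aop * πle = Aop := by rw [hAop, hπle]; exact finOp_mul_projLE _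
  have hap : Pinv * Aop * πle = Pinv * Aop := by rw [mul_assoc, hAp]
  have hpb : πle * Pop = Pop := by rw [hPop, hπle]; exact projLE_mul_finOp _
  have hPP : Pinv * Pop = πle := by
    rw [hPinv, hPop, hπle, ContinuousLinearMap.mul_def, ← finOp_mul, Matrix.nonsing_inv_mul _ hP₀,
      finOp_one]
  have hpb' : ∀ X : Ell1 ℂ →L[ℂ] Ell1 ℂ, X * πle * Pop = X * Pop := fun X => by
    rw [mul_assoc, hpb]
  have hfin : ∀ X : Ell1 ℂ →L[ℂ] Ell1 ℂ,
      finOp (P₀⁻¹ * Ac * sectionMatrix N X * P₀) = Pinv * Aop * X * Pop := by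
    intro X
    rw [finOp_mul, finOp_mul, finOp_mul, finOp_sectionMatrix, ← hPinv, ← hAop, ← hPop, ← hπle]
    simp only [← ContinuousLinearMap.mul_def, ← mul_assoc, hap, hpb']
  -- the bounds, in terms of products
  simp only [← ContinuousLinearMap.mul_def, ← mul_assoc, hap, hpb', hdiff] at hZ₂P hZ₂le hZ₂gt
  simp only [← ContinuousLinearMap.mul_def, ← mul_assoc, hap, hpb']
    at hZ₁P hβ₀₁ hβ₀₂ hβ₁₁ hβ₁₂ hβ₁₃ hβ₁₄ hβ₂₁ hβ₂₂
  have hζ' : ‖Pinv * Aop * (DKbar - DKtil) * πgt‖ ≤ ‖Pinv‖ * (Z₂le * r) := by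
    have h : Pinv * Aop * (DKbar - DKtil) * πgt = Pinv * (Aop * πle * (DKbar - DKtil) * πgt) := by
      rw [hAp]
      simp only [mul_assoc]
    rw [h]
    exact (norm_mul_le _ _).trans (mul_le_mul_of_nonneg_left hZ₂le (norm_nonneg _))
  have hη : ‖L * πgt‖ ≤ η₀ := by
    rw [hL, hπgt, hη₀]
    exact P.norm_Linv_projGT_le hwell _ rfl (hσ _) hN2
  -- the pencil and its block elimination
  set D : ℂ → Ell1 ℂ →L[ℂ] Ell1 ℂ := fun z => DKtil - z • L with hD
  set W : ℂ → Ell1 ℂ →L[ℂ] Ell1 ℂ := fun z => Ring.inverse (1 + πgt * D z * πgt) with hW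
  set C : ℂ → Ell1 ℂ →L[ℂ] Ell1 ℂ := fun z => 1 + D z * πgt with hC
  set Cinv : ℂ → Ell1 ℂ →L[ℂ] Ell1 ℂ := fun z => W z - πle * D z * πgt * W z with hCinv
  set S : ℂ → Ell1 ℂ →L[ℂ] Ell1 ℂ := fun z =>
    πle + πle * D z * πle - πle * D z * πgt * W z * πgt * D z * πle with hS
  have hE : ∀ z : ℂ, ‖z‖ ≤ lmax → ‖πgt * D z * πgt‖ ≤ ε := by
    intro z hz
    rw [hε, hπgt, mul_assoc, hD, hL]
    refine P.norm_projGT_sub_smul_le hwell hm hσ hN2 Ubar ?_ hz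
    rw [← hπgt, ← hDKbar]
    exact hZ₂gt
  have hunit : ∀ z : ℂ, ‖z‖ ≤ lmax → IsUnit (1 + πgt * D z * πgt) := by
    intro z hz
    have := isUnit_one_sub_of_norm_lt_one (x := -(πgt * D z * πgt))
      (by rw [norm_neg]; exact (hE z hz).trans_lt hε1)
    rwa [sub_neg_eq_add] at this
  have hWl : ∀ z : ℂ, ‖z‖ ≤ lmax → W z * (1 + πgt * D z * πgt) = 1 := fun z hz =>
    Ring.inverse_mul_cancel _ (hunit z hz)
  have hWr : ∀ z : ℂ, ‖z‖ ≤ lmax → (1 + πgt * D z * πgt) * W z = 1 := fun z hz =>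
    Ring.mul_inverse_cancel _ (hunit z hz)
  have hschur : ∀ z : ℂ, ‖z‖ ≤ lmax → Cinv z * C z = 1 ∧ C z * Cinv z = 1 ∧
      πle * (Cinv z * (1 + D z)) * πle = S z := fun z hz =>
    schur_identities hpq hpp hqq (hWl z hz) (hWr z hz)
  have hpencil : ∀ z : ℂ, DFtil - z • L = 1 + D z := fun z => by
    rw [hDFt, hD]
    exact add_sub_assoc _ _ _
  have hCl : ∀ z : ℂ, ‖z‖ ≤ lmax → ∀ x, Cinv z (C z x) = x := fun z hz x =>
    DFunLike.congr_fun (hschur z hz).1 x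
  have hCr : ∀ z : ℂ, ‖z‖ ≤ lmax → ∀ x, C z (Cinv z x) = x := fun z hz x =>
    DFunLike.congr_fun (hschur z hz).2.1 x
  have hB : ∀ z x, res ℂ (N + 1) x = 0 → DFtil x - z • L x = C z x := by
    intro z x hx
    have h1 : DFtil x - z • L x = (1 + D z) x := DFunLike.congr_fun (hpencil z) x
    have h2 : (1 + D z) x = x + D z x := rfl
    have h3 : C z x = x + D z (πgt x) := rfl
    rw [h1, h2, h3, hπgt, projGT_of_res_eq_zero hx]
  -- the matrix of the Schur complement
  set G : ℂ → Matrix (Fin (N + 1)) (Fin (N + 1)) ℂ := fun z =>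
    P₀⁻¹ * Ac * sectionMatrix N (S z) * P₀ - Matrix.diagonal (fun j => 1 - z * μ j) with hG
  set g : ℂ → ℂ := compressedDet DFtil L (res ℂ (N + 1)) (emb ℂ (N + 1)) Cinv with hg
  have hdet : ∀ z : ℂ, ‖z‖ ≤ lmax →
      (Matrix.diagonal (fun j => 1 - z * μ j) + G z).det = Ac.det * g z := by
    intro z hz
    have h1 : g z = (sectionMatrix N (S z)).det := by
      rw [hg, compressedDet_eq_det_sectionMatrix, hpencil, ← (hschur z hz).2.2, hπle,
        sectionMatrix_projLE_mul]
    have h2 : P₀.det ≠ 0 := hP₀.ne_zero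
    have h3 : (P₀⁻¹).det * P₀.det = 1 := by
      rw [← Matrix.det_mul, Matrix.nonsing_inv_mul _ hP₀, Matrix.det_one]
    rw [hG, h1]
    simp only [add_sub_cancel, Matrix.det_mul]
    linear_combination Ac.det * (sectionMatrix N (S z)).det * h3
  have hdiag : ∀ z : ℂ, finOp (Matrix.diagonal (fun j => 1 - z * μ j)) =
      πle - z • finOp (Matrix.diagonal μ) := by
    intro z
    have h : (Matrix.diagonal (fun j => 1 - z * μ j) : Matrix (Fin (N + 1)) (Fin (N + 1)) ℂ) =
        1 - z • Matrix.diagonal μ := by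
      rw [← Matrix.diagonal_one, ← Matrix.diagonal_smul, ← Matrix.diagonal_sub]
      rfl
    rw [h, finOp_sub, finOp_one, finOp_smul, hπle]
  have hLM : Pinv * Aop * L * Pop = finOp R₀ + finOp (Matrix.diagonal μ) := by
    rw [← hfin, ← hM₀, ← finOp_add, hR₀, sub_add_cancel]
  -- The derivative at the exact zero is split into the one at the approximation, which gives the Z₁
  -- defect, and the difference, which gives the Z₂ defect.
  have hab : Pinv * Aop * (1 + DKtil) * Pop =
      πle - Pinv * (πle - Aop * πle * DFbar * πle) * Pop -
        Pinv * Aop * (DKbar - DKtil) * Pop := by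
    have h1 : Pinv * (πle - Aop * πle * DFbar * πle) * Pop =
        Pinv * (πle * Pop) - Pinv * (Aop * πle) * DFbar * (πle * Pop) := by noncomm_ring
    rw [h1, hpb, hAp, hPP, hDFb]
    noncomm_ring
  have hGle : ∀ z : ℂ, ‖z‖ ≤ lmax → ‖finOp (G z)‖ ≤ δ := by
    intro z hz
    have hcorr := norm_schur_correction_le (W := W z) hqq rfl hz (hE z hz) hε1
      (by rw [← hWr z hz, add_mul, one_mul, add_sub_cancel_right])
      hη hZ₂gt hζ' (by simpa only [← mul_assoc] using hβ₀₁)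
      (by simpa only [← mul_assoc] using hβ₀₂) (by simpa only [← mul_assoc] using hβ₁₁) hβ₁₂ hβ₁₃
      (by simpa only [← mul_assoc] using hβ₁₄) hβ₂₁ hβ₂₂
    have h1 := norm_schur_sub_le (D := D z) hap hpb rfl hab hLM hz hZ₁P hZ₂P hcorr
    rw [hG]
    simp only
    rw [finOp_sub, hfin, hdiag]
    refine h1.trans_eq ?_
    rw [hδ, hβ₂, hβ₁, hβ₀]
    ring
  -- analyticity
  have hDan : ∀ z : ℂ, AnalyticAt ℂ D z := fun z =>
    analyticAt_const.sub (analyticAt_id.smul analyticAt_const)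
  have hWan : ∀ z : ℂ, ‖z‖ ≤ lmax → AnalyticAt ℂ W z := by
    intro z hz
    obtain ⟨u, hu⟩ := hunit z hz
    have h1 := analyticAt_inverse (𝕜 := ℂ) u
    rw [hu] at h1
    exact AnalyticAt.fun_comp (g := Ring.inverse) h1
      (analyticAt_const.add ((analyticAt_const.mul (hDan z)).mul analyticAt_const))
  have hCan : ∀ z : ℂ, ‖z‖ ≤ lmax → AnalyticAt ℂ Cinv z := fun z hz =>
    (hWan z hz).sub (((analyticAt_const.mul (hDan z)).mul analyticAt_const).mul (hWan z hz))
  have hSan : ∀ z : ℂ, ‖z‖ ≤ lmax → AnalyticAt ℂ S z := fun z hz =>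
    (analyticAt_const.add ((analyticAt_const.mul (hDan z)).mul analyticAt_const)).sub
      ((((((analyticAt_const.mul (hDan z)).mul analyticAt_const).mul (hWan z hz)).mul
        analyticAt_const).mul (hDan z)).mul analyticAt_const)
  have hgan : ∀ z : ℂ, ‖z‖ ≤ lmax → AnalyticAt ℂ g z := by
    intro z hz
    have h : g = fun z => (sectionMatrix N (Cinv z * (DFtil - z • L))).det :=
      funext fun z => compressedDet_eq_det_sectionMatrix _ _ _ _
    rw [h]
    exact analyticAt_det fun n c => analyticAt_sectionMatrix
      ((hCan z hz).mul (analyticAt_const.sub (analyticAt_id.smul analyticAt_const))) n c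
  have hGan : ∀ z : ℂ, ‖z‖ ≤ lmax → ∀ n c, AnalyticAt ℂ (fun w => G w n c) z := by
    intro z hz n c
    simp only [hG, Matrix.sub_apply, Matrix.mul_apply, Matrix.diagonal_apply]
    refine AnalyticAt.sub (Finset.analyticAt_fun_sum _ fun k _ => AnalyticAt.mul
      (Finset.analyticAt_fun_sum _ fun l _ => analyticAt_const.mul
        (analyticAt_sectionMatrix (hSan z hz) l k)) analyticAt_const) ?_
    split_ifs
    · exact analyticAt_const.sub (analyticAt_id.mul analyticAt_const)
    · exact analyticAt_const
  have heig : ∀ z : ℂ, ‖z‖ ≤ lmax → (IsGenEigenvalue DFtil L z ↔ g z = 0) := fun z hz =>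
    isGenEigenvalue_iff_compressedDet_eq_zero res_emb (hCl z hz) (hCr z hz) (hB z)
  have hzero_iff : ∀ z : ℂ, ‖z‖ ≤ lmax →
      ((Matrix.diagonal (fun j => 1 - z * μ j) + G z).det = 0 ↔ g z = 0) := fun z hz => by
    rw [hdet z hz, mul_eq_zero, or_iff_right hAcdet]
  refine ⟨fun z hzE hz => ?_, fun I hI hsub hdisj => ?_⟩
  · refine exists_mem_disk_of_det_eq_zero (t := 1) (by simp) (hGle z hz) ?_
    rw [Complex.ofReal_one, one_smul]
    exact (hzero_iff z hz).mpr ((heig z hz).mp hzE)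
  · have hball : ∀ z ∈ Metric.ball (0 : ℂ) lmax, ‖z‖ ≤ lmax := fun z hz =>
      (mem_ball_zero_iff.mp hz).le
    obtain ⟨htop, hfinite, hcount⟩ := count_zeros_det hlmax (fun z hz => hGle z (hball z hz))
      (fun z hz => hGan z (hball z hz)) I hI hsub hdisj
    set Ω := ⋃ j ∈ I, disk δ (μ j) with hΩ
    -- Orders and multiplicities are local, so the identities must hold near z; hence Ω has to lie
    -- in the open disk.
    have hnhds : ∀ z ∈ Ω, ∀ᶠ w in nhds z, ‖w‖ ≤ lmax := fun z hz => by
      filter_upwards [Metric.isOpen_ball.mem_nhds (hsub hz)] with w hw using hball w hw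
    -- The two functions differ by the nonzero constant factor det A₀.
    have hord : ∀ z ∈ Ω,
        analyticOrderAt (fun z => (Matrix.diagonal (fun j => 1 - z * μ j) + G z).det) z =
          analyticOrderAt g z := by
      intro z hz
      have h1 : (fun z => (Matrix.diagonal (fun j => 1 - z * μ j) + G z).det) =ᶠ[nhds z]
          (fun _ => Ac.det) * g := (hnhds z hz).mono fun w hw => hdet w hw
      rw [analyticOrderAt_congr h1, analyticOrderAt_mul analyticAt_const
        (hgan z (hball z (hsub hz))), (analyticAt_const.analyticOrderAt_eq_zero).mpr hAcdet,
        zero_add]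
    have hmult : ∀ z ∈ Ω, FiniteDimensional ℂ (maxRootSpace DFtil L z) ∧
        algMult DFtil L z = analyticOrderNatAt g z := fun z hz =>
      finrank_maxRootSpace_eq_order res_emb ((hnhds z hz).mono hCl) ((hnhds z hz).mono hCr)
        (Filter.Eventually.of_forall hB) (hCan z (hball z (hsub hz))).continuousAt
        (hgan z (hball z (hsub hz))) (by rw [← hg, ← hord z hz]; exact htop z hz)
    have hmem : ∀ z, z ∈ hfinite.toFinset ↔ IsGenEigenvalue DFtil L z ∧ z ∈ Ω := by
      intro z
      rw [Set.Finite.mem_toFinset, Set.mem_ofPred_eq, and_comm]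
      refine and_congr_left fun hz => ?_
      rw [hzero_iff z (hball z (hsub hz)), heig z (hball z (hsub hz))]
    refine ⟨hfinite.toFinset, hmem, fun z hz => (hmult z ((hmem z).mp hz).2).1, ?_⟩
    rw [← hcount, finsum_mem_eq_sum_of_inter_support_eq (t := hfinite.toFinset)]
    · refine Finset.sum_congr rfl fun z hz => ?_
      rw [(hmult z ((hmem z).mp hz).2).2, analyticOrderNatAt, analyticOrderNatAt,
        hord z ((hmem z).mp hz).2]
    · ext z
      simp only [Set.mem_inter_iff, Set.Finite.coe_toFinset, Set.mem_ofPred_eq]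
      refine and_congr_left fun hz => ⟨fun hzΩ => ⟨hzΩ, ?_⟩, fun h => h.1⟩
      by_contra hne
      refine hz ?_
      have han : AnalyticAt ℂ
          (fun z => (Matrix.diagonal (fun j => 1 - z * μ j) + G z).det) z :=
        analyticAt_det fun n c => by
          simp only [Matrix.add_apply, Matrix.diagonal_apply]
          refine AnalyticAt.add ?_ (hGan z (hball z (hsub hzΩ)) n c)
          split_ifs
          · exact analyticAt_const.sub (analyticAt_id.mul analyticAt_const)
          · exact analyticAt_const
      rw [analyticOrderNatAt, han.analyticOrderAt_eq_zero.mpr hne]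
      rfl
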